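/- Let $(E,\Phi,\Delta)$ be an irreducible reduced crystallographic root system $\Phi$ in a real vector space $E$ with a base $\Delta$, not of type $F_4$ or $G_2$. Let $P$ be its weight lattice, $W$ its Weyl group, $\epsilon$ the sign character of $W$, $\omega_\beta$ ($\beta\in\Delta$) the fundamental weights and $\rho=\sum_{\beta\in\Delta}\omega_\beta$. Write a weight as $\lambda=\sum_{\beta\in\Delta}m_\beta(\lambda)\,\omega_\beta$, let $d(\lambda)=\gcd\{m_\beta(\lambda):\beta\in\Delta\}$, and let $m(\Phi)$ be the ratio of the squared length of a long root to that of a short root ($m(\Phi)=1$ if $\Phi$ is simply laced). For a commutative ring $\mathcal O$ let $S(\lambda)=\sum_{w\in W}\epsilon(w)e^{w\lambda}\in\mathcal O[P]$, and let $C(\lambda,d)=S(\lambda)/S(d\rho)$ whenever $S(d\rho)$ divides $S(\lambda)$ in $\mathcal O[P]$. Let $\mu\in P$ be a dominant regular weight ($m_\beta(\mu)>0$ for all $\beta\in\Delta$), let $\alpha\in\Delta$, let $c$ be a positive integer and let $\eta=\mu+c\,\omega_\alpha$. If $\Phi$ is not simply laced, assume that $\alpha$ is a corner (an end vertex) of the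 Dynkin diagram. Let $\mathcal O$ be an integral domain of characteristic zero in which no rational prime $p\le 2\,m(\Phi)\sum_{\beta\in\Delta}m_\beta(\mu)$ is a unit. Let $d,e$ be natural numbers with $d\mid e$, $e\ne d$ and $e\mid d(\mu)$. Suppose that there are non-unit elements $U,V\in\mathcal O[P]^W$ such that (i) $UV=C(\mu,d)$; (ii) $V$ divides $C(e\rho,d)$; (iii) there are $X,Y\in\mathcal O[P]$ with $UX+VY=C(\eta,d)$. Then: (1) if $\Phi$ is simply laced or $\alpha$ is a short root, then $\gcd(e,c)>d$; (2) if $\Phi$ is not simply laced and $\alpha$ is a long root, then $\gcd(e,m(\Phi)c)>d$. -/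

import Mathlib

open scoped BigOperators

noncomputable section

namespace RootPairing

variable {ι M N : Type*} [AddCommGroup M] [Module ℝ M] [AddCommGroup N] [Module ℝ N]

/-- The lattice `P` of integral weights of a root system: the vectors on which all coroots take
integral values. -/
def weightLattice (R : RootPairing ι ℝ M N) : AddSubgroup M where
  carrier := {x | ∀ i, ∃ n : ℤ, R.coroot' i x = n}
  zero_mem' i := ⟨0, by simp⟩
  add_mem' {x y} hx hy i := by
    obtain ⟨m, hm⟩ := hx i
    obtain ⟨n, hn⟩ := hy i
    exact ⟨m + n, by simp only [map_add, hm, hn, Int.cast_add]⟩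
  neg_mem' {x} hx i := by
    obtain ⟨m, hm⟩ := hx i
    exact ⟨-m, by simp only [map_neg, hm, Int.cast_neg]⟩

/-- The integer `m_i(x) = ⟨αᵢ*, x⟩` for a weight `x`, where `αᵢ*` is the `i`-th coroot. -/
def weightCoeff (R : RootPairing ι ℝ M N) (i : ι) (x : R.weightLattice) : ℤ :=
  (x.2 i).choose

lemma weightCoeff_spec (R : RootPairing ι ℝ M N) (i : ι) (x : R.weightLattice) :
    R.coroot' i (x : M) = R.weightCoeff i x :=
  (x.2 i).choose_spec

lemma smul_mem_weightLattice (R : RootPairing ι ℝ M N) [R.IsCrystallographic]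
    (w : R.weylGroup) (x : M) (hx : x ∈ R.weightLattice) : w • x ∈ R.weightLattice := by
  obtain ⟨w, hw⟩ := w
  induction hw using weylGroup.induction generalizing x with
  | mem j =>
    intro i
    obtain ⟨m, hm⟩ := hx i
    obtain ⟨n, hn⟩ := hx j
    obtain ⟨k, hk⟩ := R.exists_value (S := ℤ) j i
    refine ⟨m - n * k, ?_⟩
    change R.coroot' i (R.reflection j x) = _
    rw [R.reflection_apply, map_sub, map_smul, hm, hn, R.root_coroot'_eq_pairing, ← hk]
    simp
  | one => simpa using hx
  | mul g₁ g₂ h₁ h₂ ih₁ ih₂ =>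
    rw [← Submonoid.mk_mul_mk _ _ _ h₁ h₂, mul_smul]
    exact ih₁ _ (ih₂ _ hx)

/-- The action of an element of the Weyl group on the weight lattice. -/
def weylAct (R : RootPairing ι ℝ M N) [R.IsCrystallographic] (w : R.weylGroup) :
    R.weightLattice →+ R.weightLattice where
  toFun x := ⟨w • (x : M), R.smul_mem_weightLattice w x x.2⟩
  map_zero' := by ext; simp
  map_add' x y := by ext; simp

instance finite_weylGroup [Finite ι] (R : RootPairing ι ℝ M N) [R.IsRootSystem] :
    Finite R.weylGroup := by
  refine Finite.of_injective R.weylGroupToPerm fun g h hgh => ?_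
  apply Subtype.ext
  apply Equiv.weightHom_injective R
  apply LinearEquiv.toLinearMap_injective
  refine LinearMap.ext_on_range (v := R.root) (IsRootSystem.span_root_eq_top) fun i => ?_
  have h1 := R.weylGroup_apply_root g i
  have h2 := R.weylGroup_apply_root h i
  rw [hgh] at h1
  exact h1.trans h2.symm

/-- The sign `ε(w)` of a Weyl group element: its determinant on the ambient space. It is the
homomorphism to `{1, -1}` sending every reflection to `-1`, so it is `(-1) ^ l(w)`. -/
def weylSign (R : RootPairing ι ℝ M N) (w : R.weylGroup) : ℤ :=
  SignType.sign (LinearMap.det (R.weylGroupRootRep w))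

lemma weylSign_one (R : RootPairing ι ℝ M N) : R.weylSign 1 = 1 := by
  simp [weylSign]

lemma weylSign_mul (R : RootPairing ι ℝ M N) (v w : R.weylGroup) :
    R.weylSign (v * w) = R.weylSign v * R.weylSign w := by
  simp [weylSign, map_mul, sign_mul]

lemma weylSign_reflection [Finite ι] (R : RootPairing ι ℝ M N) [R.IsRootSystem] (i : ι) :
    R.weylSign (weylGroup.ofIdx R i) = -1 := by
  have : Module.Finite ℝ M :=
    ⟨⟨(Set.finite_range R.root).toFinset, by simp⟩⟩
  have h : R.weylGroupRootRep (weylGroup.ofIdx R i) =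
      LinearMap.transvection (R.coroot' i) (-R.root i) := by
    ext x
    change R.reflection i x = _
    rw [R.reflection_apply, LinearMap.transvection.apply]
    simp [sub_eq_add_neg]
  rw [weylSign, h, LinearMap.transvection.det, map_neg, R.root_coroot'_eq_pairing,
    R.pairing_same]
  norm_num

/-- The Schur-Weyl element `S(x) = ∑_{w ∈ W} ε(w) e^{w x}` of the group algebra `A[P]`. -/
def schurWeyl [Finite ι] (R : RootPairing ι ℝ M N) [R.IsRootSystem] [R.IsCrystallographic]
    (A : Type*) [CommRing A] (x : R.weightLattice) : AddMonoidAlgebra A R.weightLattice :=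
  letI := Fintype.ofFinite R.weylGroup
  ∑ w : R.weylGroup, AddMonoidAlgebra.single (R.weylAct w x) (R.weylSign w : A)

/-- The ring `A[P]^W` of Weyl group invariants in the group algebra of the weight lattice. -/
def weylInvariants (R : RootPairing ι ℝ M N) [R.IsCrystallographic] (A : Type*) [CommRing A] :
    Subring (AddMonoidAlgebra A R.weightLattice) :=
  ⨅ w : R.weylGroup,
    (AddMonoidAlgebra.mapDomainRingHom A (R.weylAct w)).eqLocus (RingHom.id _)

/-- The square of the length of the `i`-th root, for the canonical Weyl group invariant inner
product. -/
def normSq [Fintype ι] (R : RootPairing ι ℝ M N) (i : ι) : ℝ :=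
  R.RootForm (R.root i) (R.root i)

/-- All roots have the same length. -/
def SimplyLaced [Fintype ι] (R : RootPairing ι ℝ M N) : Prop :=
  ∀ i j, R.normSq i = R.normSq j

/-- The `i`-th root is long (if all roots have the same length, every root is long). -/
def IsLong [Fintype ι] (R : RootPairing ι ℝ M N) (i : ι) : Prop :=
  ∀ j, R.normSq j ≤ R.normSq i

/-- The `i`-th root is short (if all roots have the same length, every root is short). -/
def IsShort [Fintype ι] (R : RootPairing ι ℝ M N) (i : ι) : Prop :=
  ∀ j, R.normSq i ≤ R.normSq j

/-- The ratio `m(Φ)` of the squared length of a long root to that of a short root; for an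
irreducible reduced crystallographic root system it is `1`, `2` or `3`. -/
def lengthRatio [Fintype ι] (R : RootPairing ι ℝ M N) : ℕ :=
  ⌊(⨆ i, R.normSq i) / (⨅ i, R.normSq i)⌋₊

lemma normSq_eq_lengthRatio_mul [Fintype ι] (R : RootPairing ι ℝ M N) [R.IsRootSystem]
    [R.IsCrystallographic] [R.IsReduced] [R.IsIrreducible] {i j : ι}
    (hi : R.IsLong i) (hj : R.IsShort j) :
    R.normSq i = R.lengthRatio * R.normSq j := by
  have hne : Nonempty ι := ⟨i⟩
  have h1 : (⨆ k, R.normSq k) = R.normSq i :=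
    le_antisymm (ciSup_le hi) (le_ciSup (Set.finite_range _).bddAbove i)
  have h2 : (⨅ k, R.normSq k) = R.normSq j :=
    le_antisymm (ciInf_le (Set.finite_range _).bddBelow j) (le_ciInf hj)
  have hpos : ∀ k, 0 < R.normSq k := fun k =>
    R.rootForm_pos_of_ne_zero (by simp) (R.ne_zero k)
  have hij : R.normSq j ≤ R.normSq i := hi j
  have key := R.toInvariantForm.apply_eq_or i j
  change R.normSq i = R.normSq j ∨ R.normSq i = 2 * R.normSq j ∨ R.normSq i = 3 * R.normSq j ∨
    R.normSq j = 2 * R.normSq i ∨ R.normSq j = 3 * R.normSq i at key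
  have hn := hpos j
  have h3 : ∃ n : ℕ, R.normSq i = n * R.normSq j := by
    rcases key with h | h | h | h | h
    · exact ⟨1, by simpa using h⟩
    · exact ⟨2, by simpa using h⟩
    · exact ⟨3, by simpa using h⟩
    · linarith [hpos i]
    · linarith [hpos i]
  obtain ⟨n, h⟩ := h3
  have h4 : R.lengthRatio = n := by
    rw [lengthRatio, h1, h2, h, mul_div_cancel_right₀ _ hn.ne', Nat.floor_natCast]
  rw [h4, h]

namespace Base

variable {R : RootPairing ι ℝ M N}

/-- The fundamental weight `ω_i` attached to a simple root: its pairing with the simple coroots is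
`1` at `i` and `0` elsewhere. -/
def fundamentalWeight [R.IsRootSystem] (b : R.Base) (i : b.support) :
    R.weightLattice :=
  ⟨R.toPerfPair.symm (b.toCoweightBasis.coord i), by
    have key : ∀ y ∈ Submodule.span ℤ (R.coroot '' b.support),
        ∃ n : ℤ, b.toCoweightBasis.coord i y = n := by
      intro y hy
      induction hy using Submodule.span_induction with
      | mem y hy =>
        obtain ⟨j, hj, rfl⟩ := hy
        have : b.toCoweightBasis.coord i (R.coroot j) =
            (Finsupp.single (⟨j, hj⟩ : b.support) (1 : ℝ)) i := by
          rw [Module.Basis.coord_apply, ← b.toCoweightBasis_repr_coroot ⟨j, hj⟩]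
        classical
        rw [this, Finsupp.single_apply]
        split_ifs
        · exact ⟨1, by simp⟩
        · exact ⟨0, by simp⟩
      | zero => exact ⟨0, by simp⟩
      | add x y _ _ hx hy =>
        obtain ⟨m, hm⟩ := hx
        obtain ⟨n, hn⟩ := hy
        exact ⟨m + n, by simp only [map_add, hm, hn, Int.cast_add]⟩
      | smul a x _ hx =>
        obtain ⟨m, hm⟩ := hx
        exact ⟨a * m, by simp only [map_zsmul, hm, zsmul_eq_mul, Int.cast_mul]⟩
    intro j
    obtain ⟨n, hn⟩ := key _ (b.coroot_mem_span_int j)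
    refine ⟨n, ?_⟩
    exact (LinearMap.congr_fun (R.toPerfPair.apply_symm_apply (b.toCoweightBasis.coord i))
      (R.coroot j)).trans hn⟩

lemma weightCoeff_fundamentalWeight [R.IsRootSystem] (b : R.Base) [DecidableEq ι]
    (i j : b.support) :
    R.weightCoeff j (b.fundamentalWeight i) = if i = j then 1 else 0 := by
  have h := R.weightCoeff_spec j (b.fundamentalWeight i)
  have h' : R.coroot' j (b.fundamentalWeight i : M) = b.toCoweightBasis.coord i (R.coroot j) :=
    LinearMap.congr_fun (R.toPerfPair.apply_symm_apply (b.toCoweightBasis.coord i)) (R.coroot j)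
  rw [h', Module.Basis.coord_apply, b.toCoweightBasis_repr_coroot j, Finsupp.single_apply] at h
  have h'' : ((R.weightCoeff j (b.fundamentalWeight i) : ℤ) : ℝ) =
      ((if i = j then 1 else 0 : ℤ) : ℝ) := by
    rw [← h]
    by_cases hij : i = j
    · simp [hij]
    · simp [hij, Ne.symm hij]
  exact_mod_cast h''

/-- The Weyl weight `ρ`, the sum of the fundamental weights. -/
def rho [R.IsRootSystem] (b : R.Base) : R.weightLattice :=
  ∑ i : b.support, b.fundamentalWeight i

/-- A weight is dominant and regular if all its coefficients with respect to the fundamental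
weights are positive. -/
def DominantRegular (b : R.Base) (x : R.weightLattice) : Prop :=
  ∀ i ∈ b.support, 0 < R.weightCoeff i x

/-- `d(x)`, the greatest common divisor of the coefficients of `x` with respect to the fundamental
weights. -/
def weightGcd (b : R.Base) (x : R.weightLattice) : ℕ :=
  b.support.gcd fun i => (R.weightCoeff i x).natAbs

/-- The `i`-th simple root is a corner of the Dynkin diagram: it is joined to at most one other
simple root. -/
def IsCorner (b : R.Base) (i : b.support) : Prop :=
  {j : b.support | j ≠ i ∧ R.pairing i j ≠ 0}.Subsingleton

/-- The Cartan matrix of the base is `A`, for a suitable numbering of the simple roots. -/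
def HasCartanMatrix [R.IsCrystallographic] (b : R.Base) {n : ℕ}
    (A : Matrix (Fin n) (Fin n) ℤ) : Prop :=
  ∃ f : b.support ≃ Fin n, b.cartanMatrix.reindex f f = A

/-- `F` is the quotient `C(x, d) = S(x) / S(dρ)` in `A[P]`. -/
def IsC [Finite ι] [R.IsRootSystem] [R.IsCrystallographic] (b : R.Base) {A : Type*} [CommRing A]
    (F : AddMonoidAlgebra A R.weightLattice) (x : R.weightLattice) (d : ℕ) : Prop :=
  F * R.schurWeyl A (d • b.rho) = R.schurWeyl A x

end Base

end RootPairing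

end

noncomputable section

set_option linter.unusedSectionVars false

/-! ### Reduced words in the Weyl group -/

namespace RootPairing

variable {ι M N : Type*} [AddCommGroup M] [Module ℝ M] [AddCommGroup N] [Module ℝ N]
  (R : RootPairing ι ℝ M N)

/-! Write `[n] = z^n - z^(-n)`. Suppose the relevant gcd does not exceed `d`. Since `d` divides `e`
and also `c` (`dvd_of_mul_schurWeyl_eq`), the gcd is `d`, and `GcdCondition` holds. A contradiction
is derived from it.

Fix a simple root `β` and a unit `z` of an algebraically closed field containing `𝒪`, and send `e^x`
to `z^⟨x, β*⟩ e^(x mod β)`. In the image of `S(x)`, the two orbit points over the top class combine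
to `[m_β(x)]`. Hence the top coefficients `u(z)`, `v(z)` of the images of `U`, `V` (`leadingValue`)
satisfy `u v [d] = [m_β(μ)]`, and the right side has only simple zeros, all of them roots of unity.
By (ii), a zero `z` of `v` has `z^(2e) = 1`. There the image of `S(μ)` is zero because `e ∣ d(μ)`,
and `u(z) ≠ 0`, so the whole image of `V` is zero. Then (iii) reads `U X = C(η, d)` in the image.
The top coefficient of `S(η)` is `±[n]` with `gcd(n, e) = d`, which makes `u(z)` a unit in the
integral closure (`exists_leadingValue_mul_eq_one`).

If `u` and `v` both had zeros, a walk through roots of unity in steps of prime power order would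
produce a zero `z` of `v` and a zero `zξ` of `u` with `ξ` of `p`-power order. Then `u(z) = u(z) -
u(zξ)` is a multiple of `1 - ξ`, and `p` becomes a unit of `𝒪`. So one of `u`, `v` has no zeros. It
is a monomial, by reflection symmetry of exponent zero, so the leading exponent of that factor is
orthogonal to `β`, while the image of the other factor is zero whenever `z^(2e) = 1` and `[d] ≠ 0`
(`vanishesAt_dichotomy`).

If the same factor were zero-free at every `β`, its leading exponent would be `0` and it would be a
unit. As the Dynkin diagram is connected, different factors vanish at some adjacent `β`, `δ`. For
invariants, vanishing depends only on the Weyl orbit of the root, so `β` and `δ` have different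
lengths; with `G₂` excluded, the bond is double. Working modulo both roots over the dual numbers,
the image of `S(η)` is zero, which amounts to `p [p + 2r] = (p + 2r) [p]` for the pairings `p`, `r`
of suitable orbit points with the short and the long root (`mul_antisymmPow_eq`). For an orbit point
with one of `p`, `r` divisible by `e` and the other congruent to `c` (`exists_fibre`), this is
impossible. -/

/-- The reflection in the `i`-th root, as an element of the Weyl group. -/
abbrev simpleRefl (i : ι) : R.weylGroup := weylGroup.ofIdx R i

lemma simpleRefl_smul (i : ι) (x : M) : R.simpleRefl i • x = x - R.coroot' i x • R.root i := by
  rw [weylGroup.ofIdx_smul]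
  change R.reflection i x = _
  rw [R.reflection_apply]

lemma simpleRefl_perm (i j : ι) :
    R.weylGroupToPerm (R.simpleRefl i) j = R.reflectionPerm i j := rfl

lemma weyl_smul_root (w : R.weylGroup) (i : ι) :
    R.root (R.weylGroupToPerm w i) = w • R.root i := (R.weylGroup_apply_root w i).symm

lemma weyl_smul_real (w : R.weylGroup) (a : ℝ) (x : M) : w • (a • x) = a • (w • x) :=
  smul_comm _ _ _

lemma weyl_ext {g h : R.weylGroup} (H : ∀ x : M, g • x = h • x) : g = h := by
  apply Subtype.ext
  apply Equiv.weightHom_injective R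
  ext x
  exact H x

lemma coroot'_perm_smul (w : R.weylGroup) (i : ι) (x : M) :
    R.coroot' (R.weylGroupToPerm w i) (w • x) = R.coroot' i x := by
  obtain ⟨w, hw⟩ := w
  induction hw using weylGroup.induction generalizing x i with
  | mem j =>
    change R.coroot' (R.reflectionPerm j i) (R.reflection j x) = _
    rw [coroot'_reflectionPerm]
    simp
  | one => rfl
  | mul g₁ g₂ h₁ h₂ ih₁ ih₂ =>
    rw [← Submonoid.mk_mul_mk _ _ _ h₁ h₂, mul_smul, map_mul]
    exact (ih₁ _ _).trans (ih₂ _ _)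

lemma simpleRefl_perm_eq (w : R.weylGroup) (i : ι) :
    R.simpleRefl (R.weylGroupToPerm w i) = w * R.simpleRefl i * w⁻¹ := by
  refine R.weyl_ext fun x => ?_
  obtain ⟨y, rfl⟩ : ∃ y, x = w • y := ⟨w⁻¹ • x, by simp⟩
  rw [simpleRefl_smul, coroot'_perm_smul, mul_smul, inv_smul_smul, mul_smul, simpleRefl_smul,
    smul_sub, weyl_smul_real, weyl_smul_root]

lemma simpleRefl_mul_self (i : ι) : R.simpleRefl i * R.simpleRefl i = 1 := by
  refine R.weyl_ext fun x => ?_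
  rw [mul_smul, simpleRefl_smul, simpleRefl_smul]
  simp only [map_sub, map_smul, R.root_coroot'_eq_pairing, R.pairing_same]
  rw [one_smul]
  module

lemma simpleRefl_inv (i : ι) : (R.simpleRefl i)⁻¹ = R.simpleRefl i :=
  inv_eq_of_mul_eq_one_left (R.simpleRefl_mul_self i)

namespace Base

variable {R} (b : R.Base)

/-- The Weyl group element attached to a word in the simple reflections. -/
def wordProd (l : List b.support) : R.weylGroup :=
  (l.map fun i => R.simpleRefl i).prod

lemma wordProd_nil : b.wordProd [] = 1 := rfl

lemma wordProd_cons (i : b.support) (l : List b.support) :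
    b.wordProd (i :: l) = R.simpleRefl i * b.wordProd l := by
  simp [wordProd]

lemma wordProd_append (l l' : List b.support) :
    b.wordProd (l ++ l') = b.wordProd l * b.wordProd l' := by
  simp [wordProd]

variable [Finite ι] [R.IsCrystallographic] [R.IsReduced]

/-- A simple reflection makes only its own simple root negative. So when the letters are applied
from the right, the image of the root must be a simple root `j` just before the letter `j` turns it
negative. -/
lemma exists_split_of_not_isPos (l : List b.support) {i : ι} (hi : b.IsPos i)
    (h : ¬ b.IsPos (R.weylGroupToPerm (b.wordProd l) i)) :
    ∃ l₁ j l₂, l = l₁ ++ j :: l₂ ∧ R.weylGroupToPerm (b.wordProd l₂) i = (j : b.support) := by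
  induction l with
  | nil => exact absurd hi (by simpa [wordProd_nil] using h)
  | cons j t ih =>
    by_cases ht : b.IsPos (R.weylGroupToPerm (b.wordProd t) i)
    · refine ⟨[], j, t, rfl, ?_⟩
      by_contra hne
      apply h
      rw [wordProd_cons, map_mul]
      exact ht.reflectionPerm j.2 hne
    · obtain ⟨l₁, k, l₂, rfl, h₂⟩ := ih ht
      exact ⟨j :: l₁, k, l₂, rfl, h₂⟩

lemma exists_wordProd_eq (w : R.weylGroup) : ∃ l, b.wordProd l = w := by
  have key : ∀ i, ∃ l, b.wordProd l = R.simpleRefl i := by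
    intro i
    refine b.induction_reflect i (p := fun i => ∃ l, b.wordProd l = R.simpleRefl i) ?_ ?_ ?_
    · rintro i ⟨l, hl⟩
      refine ⟨l ++ (l ++ l), ?_⟩
      rw [wordProd_append, wordProd_append, hl, ← R.simpleRefl_perm, R.simpleRefl_perm_eq,
        R.simpleRefl_inv, mul_assoc]
    · intro i hi
      exact ⟨[⟨i, hi⟩], by simp [wordProd]⟩
    · rintro i j ⟨l, hl⟩ hj
      refine ⟨⟨j, hj⟩ :: (l ++ [⟨j, hj⟩]), ?_⟩
      rw [wordProd_cons, wordProd_append, hl, ← R.simpleRefl_perm, R.simpleRefl_perm_eq,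
        R.simpleRefl_inv, wordProd_cons, wordProd_nil, mul_one, mul_assoc]
  obtain ⟨w, hw⟩ := w
  induction hw using weylGroup.induction with
  | mem j => exact key j
  | one => exact ⟨[], rfl⟩
  | mul g₁ g₂ h₁ h₂ ih₁ ih₂ =>
    obtain ⟨l₁, h₁⟩ := ih₁
    obtain ⟨l₂, h₂⟩ := ih₂
    exact ⟨l₁ ++ l₂, by rw [wordProd_append, h₁, h₂]; rfl⟩

/-- Induction along reduced words: every element of the Weyl group is reached from `1` by right
multiplications with simple reflections in simple roots which stay positive. -/
lemma weyl_induction {p : R.weylGroup → Prop} (one : p 1)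
    (mul : ∀ (w : R.weylGroup) (i : b.support), p w → b.IsPos (R.weylGroupToPerm w i) →
      p (w * R.simpleRefl i)) (w : R.weylGroup) : p w := by
  have key : ∀ (n : ℕ) (l : List b.support), l.length = n →
      (∀ l', b.wordProd l' = b.wordProd l → l.length ≤ l'.length) → p (b.wordProd l) := by
    intro n
    induction n with
    | zero =>
      intro l hl _
      rw [List.length_eq_zero_iff] at hl
      subst hl
      exact one
    | succ n ih =>
      intro l hl hmin
      obtain ⟨t, i, rfl⟩ : ∃ t i, l = t ++ [i] := by
        rcases List.eq_nil_or_concat l with rfl | ⟨t, i, rfl⟩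
        · simp at hl
        · exact ⟨t, i, by simp⟩
      have hl' : t.length = n := by simpa using hl
      have hprod : b.wordProd (t ++ [i]) = b.wordProd t * R.simpleRefl i := by
        simp [wordProd]
      rw [hprod]
      refine mul _ _ (ih t hl' fun l' h' => ?_) ?_
      · have := hmin (l' ++ [i]) (by rw [wordProd_append, h', ← wordProd_append])
        simpa using this
      · by_contra hneg
        -- Exchange condition: `s_j = l₂ s_i l₂⁻¹`, so `l₁ s_j l₂ s_i = l₁ l₂` is shorter by two
        -- letters, against minimality.
        obtain ⟨l₁, j, l₂, rfl, h₂⟩ :=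
          b.exists_split_of_not_isPos t (b.isPos_of_mem_support i.2) hneg
        have hj := R.simpleRefl_perm_eq (b.wordProd l₂) i
        rw [h₂] at hj
        have := hmin (l₁ ++ l₂) (by
          rw [hprod, wordProd_append, wordProd_append, wordProd_cons, hj]
          have := R.simpleRefl_mul_self i
          simp only [mul_assoc, inv_mul_cancel_left]
          rw [this, mul_one])
        simp only [List.length_append, List.length_cons, List.length_nil] at this
        omega
  classical
  have hex : ∃ n, ∃ l : List b.support, b.wordProd l = w ∧ l.length = n := by
    obtain ⟨l, hl⟩ := b.exists_wordProd_eq w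
    exact ⟨_, l, hl, rfl⟩
  obtain ⟨l, rfl, hl⟩ := Nat.find_spec hex
  exact key _ l rfl fun l' h' => hl ▸ Nat.find_min' hex ⟨l', h', rfl⟩

end Base

end RootPairing

/-! ### Coordinates in the simple roots (fundamental coweights) and their stabilizers -/

namespace RootPairing.Base

variable {ι M N : Type*} [AddCommGroup M] [Module ℝ M] [AddCommGroup N] [Module ℝ N]
  {R : RootPairing ι ℝ M N} [R.IsRootSystem] (b : R.Base)

/-- The coordinate functional of a vector with respect to the basis of simple roots. -/
def coord (i : b.support) : M →ₗ[ℝ] ℝ := b.toWeightBasis.coord i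

lemma coord_root_self (i : b.support) : b.coord i (R.root i) = 1 := by
  simp [coord]

lemma coord_root_of_ne {i j : b.support} (h : i ≠ j) : b.coord i (R.root j) = 0 := by
  classical
  simp [coord, h.symm]

lemma coord_root [DecidableEq b.support] (i j : b.support) :
    b.coord i (R.root j) = if i = j then 1 else 0 := by
  split_ifs with h
  · rw [h, coord_root_self]
  · exact b.coord_root_of_ne h

lemma sum_coord_smul (x : M) : ∑ i, b.coord i x • R.root i = x := by
  simpa [coord] using b.toWeightBasis.sum_repr x

lemma ext_coord {x y : M} (h : ∀ i, b.coord i x = b.coord i y) : x = y := by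
  rw [← b.sum_coord_smul x, ← b.sum_coord_smul y]
  simp_rw [h]

lemma coroot'_fundamentalWeight [DecidableEq b.support] (i j : b.support) :
    R.coroot' j (b.fundamentalWeight i : M) = if i = j then 1 else 0 := by
  classical
  rw [weightCoeff_spec, weightCoeff_fundamentalWeight]
  split_ifs <;> simp

lemma coroot'_fundamentalWeight_self (i : b.support) :
    R.coroot' i (b.fundamentalWeight i : M) = 1 := by
  classical
  rw [coroot'_fundamentalWeight, if_pos rfl]

lemma coroot'_fundamentalWeight_of_ne {i j : b.support} (h : i ≠ j) :
    R.coroot' j (b.fundamentalWeight i : M) = 0 := by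
  classical
  rw [coroot'_fundamentalWeight, if_neg h]

lemma eq_zero_of_coroot'_eq_zero {x : M} (h : ∀ i : b.support, R.coroot' i x = 0) : x = 0 := by
  rw [R.eq_zero_iff_forall_coroot'_eq_zero]
  have key : ∀ y ∈ Submodule.span ℤ (R.coroot '' b.support), R.toLinearMap x y = 0 := by
    intro y hy
    induction hy using Submodule.span_induction with
    | mem y hy =>
      obtain ⟨j, hj, rfl⟩ := hy
      exact h ⟨j, hj⟩
    | zero => simp
    | add x y _ _ hx hy => simp [hx, hy]
    | smul a x _ hx => simp [hx]
  intro i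
  exact key _ (b.coroot_mem_span_int i)

/-- If an integer divides the pairings of a weight with the simple coroots, it divides the pairings
with all coroots. -/
lemma dvd_weightCoeff {n : ℤ} {x : R.weightLattice} (h : ∀ i ∈ b.support, n ∣ R.weightCoeff i x)
    (i : ι) : n ∣ R.weightCoeff i x := by
  have key : ∀ y ∈ Submodule.span ℤ (R.coroot '' b.support),
      ∃ k : ℤ, R.toLinearMap (x : M) y = (n * k : ℤ) := by
    intro y hy
    induction hy using Submodule.span_induction with
    | mem y hy =>
      obtain ⟨j, hj, rfl⟩ := hy
      obtain ⟨k, hk⟩ := h j hj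
      exact ⟨k, by rw [← hk]; exact R.weightCoeff_spec j x⟩
    | zero => exact ⟨0, by simp⟩
    | add x y _ _ hx hy =>
      obtain ⟨k, hk⟩ := hx
      obtain ⟨l, hl⟩ := hy
      exact ⟨k + l, by rw [map_add, hk, hl]; push_cast; ring⟩
    | smul a x _ hx =>
      obtain ⟨k, hk⟩ := hx
      exact ⟨a * k, by rw [map_zsmul, hk]; push_cast [zsmul_eq_mul]; ring⟩
  obtain ⟨k, hk⟩ := key _ (b.coroot_mem_span_int i)
  refine ⟨k, ?_⟩
  have := (R.weightCoeff_spec i x).symm.trans hk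
  exact_mod_cast this

variable [R.IsCrystallographic]

lemma simpleRefl_fundamentalWeight_of_ne {i j : b.support} (h : i ≠ j) :
    R.simpleRefl j • (b.fundamentalWeight i : M) = b.fundamentalWeight i := by
  rw [simpleRefl_smul, b.coroot'_fundamentalWeight_of_ne h, zero_smul, sub_zero]

lemma simpleRefl_fundamentalWeight_self (i : b.support) :
    R.simpleRefl i • (b.fundamentalWeight i : M) = b.fundamentalWeight i - R.root i := by
  rw [simpleRefl_smul, b.coroot'_fundamentalWeight_self, one_smul]

lemma coord_simpleRefl_of_ne {i j : b.support} (h : i ≠ j) (x : M) :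
    b.coord i (R.simpleRefl j • x) = b.coord i x := by
  rw [simpleRefl_smul, map_sub, map_smul, b.coord_root_of_ne h, smul_zero, sub_zero]

lemma coord_simpleRefl_self (i : b.support) (x : M) :
    b.coord i (R.simpleRefl i • x) = b.coord i x - R.coroot' i x := by
  rw [simpleRefl_smul, map_sub, map_smul, b.coord_root_self, smul_eq_mul, mul_one]

lemma exists_coord_root_eq_natCast {j : ι} (hj : b.IsPos j) (i : b.support) :
    ∃ n : ℕ, b.coord i (R.root j) = n := by
  classical
  obtain ⟨f, hf, h | h⟩ := b.exists_root_eq_sum_nat_or_neg j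
  · refine ⟨f i, ?_⟩
    rw [h, ← Finset.sum_coe_sort b.support (fun k => f k • R.root k), map_sum]
    simp [coord_root, map_nsmul]
  · exfalso
    have h' : R.root j = ∑ k ∈ b.support, (fun k => -(f k : ℤ)) k • R.root k := by
      rw [h, ← Finset.sum_neg_distrib]
      exact Finset.sum_congr rfl fun k _ => by simp
    rw [isPos_iff, height_eq_sum h'] at hj
    simp only [Finset.sum_neg_distrib] at hj
    have : (0 : ℤ) ≤ ∑ k ∈ b.support, (f k : ℤ) := Finset.sum_nonneg fun _ _ => by positivity
    omega

variable [Finite ι] [R.IsReduced]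

/-- The functionals in the Weyl orbit of a coordinate functional differ from it by nonnegative
combinations of simple coroots. -/
lemma exists_coord_smul_eq (w : R.weylGroup) (i : b.support) : ∃ k : b.support → ℕ,
    (∀ x : M, b.coord i (w • x) = b.coord i x - ∑ j, k j * R.coroot' j x) ∧
      (k = 0 ∨ 1 ≤ k i) := by
  classical
  induction w using b.weyl_induction with
  | one => exact ⟨0, by simp, Or.inl rfl⟩
  | mul w j ih hpos =>
    obtain ⟨k, hk, hk'⟩ := ih
    -- Passing from `w` to `w s_j` subtracts `n = coord_i (w α_j)` times the coroot of `j`, and `n ≥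
    -- 0` because `w α_j` is positive. As long as `k = 0`, this `n` is `1` for `j = i` and `0`
    -- otherwise.
    obtain ⟨n, hn⟩ := b.exists_coord_root_eq_natCast hpos i
    rw [weyl_smul_root] at hn
    refine ⟨k + Pi.single j n, fun x => ?_, ?_⟩
    · rw [mul_smul, simpleRefl_smul, smul_sub, weyl_smul_real, map_sub, (b.coord i).map_smul, hn, hk]
      simp only [Pi.add_apply, Nat.cast_add, add_mul, Finset.sum_add_distrib, smul_eq_mul]
      have : ∑ l, ((Pi.single j n : b.support → ℕ) l : ℝ) * R.coroot' l x = n * R.coroot' j x := by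
        rw [Finset.sum_eq_single j] <;> simp +contextual
      rw [this]
      ring
    · rcases hk' with rfl | hk'
      · rw [hk] at hn
        simp only [Pi.zero_apply, Nat.cast_zero, zero_mul, Finset.sum_const_zero, sub_zero,
          coord_root] at hn
        by_cases hij : i = j
        · right
          rw [if_pos hij] at hn
          subst hij
          have : n = 1 := by exact_mod_cast hn.symm
          simp [this]
        · left
          rw [if_neg hij] at hn
          have : n = 0 := by exact_mod_cast hn.symm
          simp [this]
      · right
        rw [Pi.add_apply]
        omega

/-- Weyl group elements fixing the coordinate functionals outside of `J` lie in the parabolic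
subgroup of `J`. -/
lemma mem_closure_of_coord_fixed (J : Set b.support) (w : R.weylGroup)
    (hw : ∀ i ∉ J, ∀ x : M, b.coord i (w • x) = b.coord i x) :
    w ∈ Subgroup.closure ((fun i : b.support => R.simpleRefl i) '' J) := by
  classical
  induction w using b.weyl_induction with
  | one => exact one_mem _
  | mul w j ih hpos =>
    have key : ∀ i ∉ J, (∀ x : M, b.coord i (w • x) = b.coord i x) ∧ i ≠ j := by
      intro i hi
      obtain ⟨k, hk, -⟩ := b.exists_coord_smul_eq w i
      obtain ⟨n, hn⟩ := b.exists_coord_root_eq_natCast hpos i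
      rw [weyl_smul_root] at hn
      -- Evaluation at the fundamental weights isolates the coefficients. Each is a sum of two
      -- nonnegative terms, so `w` itself fixes the functional and `n = 0`, which excludes `i = j`.
      have h0 : ∀ l : b.support, (k l : ℝ) + (if l = j then (n : ℝ) else 0) = 0 := by
        intro l
        have := hw i hi (b.fundamentalWeight l)
        rw [mul_smul, simpleRefl_smul, smul_sub, weyl_smul_real, map_sub, (b.coord i).map_smul, hn, hk] at this
        simp only [coroot'_fundamentalWeight, mul_ite, mul_one, mul_zero, Finset.sum_ite_eq,
          Finset.mem_univ, if_true, smul_eq_mul, ite_mul, one_mul, zero_mul] at this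
        linarith
      have hk0 : ∀ l, (k l : ℝ) = 0 := by
        intro l
        have := h0 l
        have h1 : (0 : ℝ) ≤ k l := by positivity
        have h2 : (0 : ℝ) ≤ if l = j then (n : ℝ) else 0 := by positivity
        linarith
      have hw' : ∀ x : M, b.coord i (w • x) = b.coord i x := by
        intro x
        rw [hk]
        simp [hk0]
      refine ⟨hw', ?_⟩
      rintro rfl
      have := h0 i
      rw [hk0, if_pos rfl, zero_add] at this
      rw [hw', b.coord_root_self, this] at hn
      exact one_ne_zero hn
    refine mul_mem (ih fun i hi => (key i hi).1) (Subgroup.subset_closure ⟨j, ?_, rfl⟩)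
    by_contra hj
    exact (key j hj).2 rfl

/-- Such a `w` is a product of simple reflections other than the `i`-th, and each of these fixes
`ω_i`. -/
lemma smul_fundamentalWeight_of_coord_fixed {i : b.support} {w : R.weylGroup}
    (hw : ∀ x : M, b.coord i (w • x) = b.coord i x) :
    w • (b.fundamentalWeight i : M) = b.fundamentalWeight i := by
  have h := b.mem_closure_of_coord_fixed {i}ᶜ w (fun j hj x => by
    obtain rfl : j = i := by simpa using hj
    exact hw x)
  clear hw
  induction h using Subgroup.closure_induction with
  | mem x hx =>
    obtain ⟨j, hj, rfl⟩ := hx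
    exact b.simpleRefl_fundamentalWeight_of_ne (fun h => hj h.symm)
  | one => simp
  | mul x y _ _ hx hy => rw [mul_smul, hy, hx]
  | inv x _ hx => rw [inv_smul_eq_iff, hx]

end RootPairing.Base

/-! ### Coordinates along a regular orbit, and adapted elements -/

namespace RootPairing.Base

variable {ι M N : Type*} [Finite ι] [AddCommGroup M] [Module ℝ M] [AddCommGroup N] [Module ℝ N]
  {R : RootPairing ι ℝ M N} [R.IsRootSystem] [R.IsCrystallographic] [R.IsReduced] (b : R.Base)

/-- A Weyl group element fixing the coordinate functionals in `K` either fixes the `i`-th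
coordinate functional, or it lowers the `i`-th coordinate of vectors which are strictly dominant
outside of `K` at least as much as the `i`-th simple reflection does. -/
lemma coord_smul_dichotomy (K : Set b.support) {w : R.weylGroup}
    (hw : ∀ i ∈ K, ∀ y : M, b.coord i (w • y) = b.coord i y) {x : M}
    (hx : ∀ j ∉ K, 0 < R.coroot' (j : b.support) x) (i : b.support) :
    (∀ y : M, b.coord i (w • y) = b.coord i y) ∨
      (b.coord i (w • x) ≤ b.coord i x - R.coroot' i x ∧
        (b.coord i (w • x) = b.coord i x - R.coroot' i x →
          ∀ y : M, b.coord i (w • y) = b.coord i (R.simpleRefl i • y))) := by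
  classical
  obtain ⟨k, hk, hk'⟩ := b.exists_coord_smul_eq w i
  by_cases hiK : i ∈ K
  · exact Or.inl (hw i hiK)
  rcases hk' with rfl | hk'
  · left
    intro y
    rw [hk]
    simp
  right
  -- For `j ∈ K` the element `w` fixes `ω_j`, and evaluation at `ω_j` isolates `k j`.
  have hK : ∀ j ∈ K, k j = 0 := by
    intro j hj
    have h := hk (b.fundamentalWeight j)
    rw [b.smul_fundamentalWeight_of_coord_fixed (hw j hj)] at h
    simp only [coroot'_fundamentalWeight, mul_ite, mul_one, mul_zero, Finset.sum_ite_eq,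
      Finset.mem_univ, if_true] at h
    have : (k j : ℝ) = 0 := by linarith
    exact_mod_cast this
  have hnn : ∀ j, 0 ≤ (k j : ℝ) * R.coroot' j x := by
    intro j
    by_cases hj : j ∈ K
    · simp [hK j hj]
    · have := hx j hj
      positivity
  have h1 : (1 : ℝ) ≤ k i := by exact_mod_cast hk'
  have hxi := hx i hiK
  have hsplit := Finset.add_sum_erase Finset.univ (fun j => (k j : ℝ) * R.coroot' j x)
    (Finset.mem_univ i)
  have hrest : 0 ≤ ∑ j ∈ Finset.univ.erase i, (k j : ℝ) * R.coroot' j x :=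
    Finset.sum_nonneg fun j _ => hnn j
  constructor
  · rw [hk, ← hsplit]
    nlinarith
  -- Equality leaves only `k i = 1` with all other `k j = 0`, which is the functional moved by the
  -- `i`-th reflection.
  · intro heq y
    rw [hk, ← hsplit] at heq
    have hki : (k i : ℝ) = 1 := by
      by_contra hne
      have : (1 : ℝ) < k i := lt_of_le_of_ne h1 (Ne.symm hne)
      nlinarith
    have h0 : ∑ j ∈ Finset.univ.erase i, (k j : ℝ) * R.coroot' j x = 0 := by
      rw [hki] at heq
      linarith
    have hkj : ∀ j, j ≠ i → (k j : ℝ) = 0 := by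
      intro j hj
      by_cases hjK : j ∈ K
      · simp [hK j hjK]
      · have := (Finset.sum_eq_zero_iff_of_nonneg fun j _ => hnn j).1 h0 j (by simp [hj])
        exact (mul_eq_zero.1 this).resolve_right (hx j hjK).ne'
    rw [hk, coord_simpleRefl_self, Finset.sum_eq_single i (fun j _ hj => by simp [hkj j hj])
      (by simp), hki, one_mul]

lemma coord_smul_le {x : M} (hx : ∀ i : b.support, 0 < R.coroot' i x) (w : R.weylGroup)
    (i : b.support) : b.coord i (w • x) ≤ b.coord i x := by
  rcases b.coord_smul_dichotomy ∅ (w := w) (by simp) (fun j _ => hx j) i with h | h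
  · exact (h x).le
  · linarith [h.1, hx i]

lemma eq_one_of_smul_eq {x : M} (hx : ∀ i : b.support, 0 < R.coroot' i x) {w : R.weylGroup}
    (hw : w • x = x) : w = 1 := by
  refine R.weyl_ext fun y => b.ext_coord fun i => ?_
  rw [one_smul]
  rcases b.coord_smul_dichotomy ∅ (w := w) (by simp) (fun j _ => hx j) i with h | h
  · exact h y
  · rw [hw] at h
    linarith [h.1, hx i]

lemma smul_injective_of_dominant {x : M} (hx : ∀ i : b.support, 0 < R.coroot' i x)
    {v w : R.weylGroup} (h : v • x = w • x) : v = w := by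
  have : w⁻¹ * v = 1 := b.eq_one_of_smul_eq hx (by rw [mul_smul, h, inv_smul_smul])
  rw [← mul_one w, ← this, mul_inv_cancel_left]

/-- Two elements of a regular Weyl orbit which differ by a multiple of a root differ by the
reflection in this root. -/
lemma eq_or_eq_simpleRefl_mul {x : M} (hx : ∀ i : b.support, 0 < R.coroot' i x)
    {v w : R.weylGroup} {i : ι} {t : ℝ} (h : w • x = v • x - t • R.root i) :
    w = v ∨ w = R.simpleRefl i * v := by
  have := Fintype.ofFinite ι
  let B := R.RootForm
  have hB : ∀ (g : R.weylGroup) (y z : M), B (g • y) (g • z) = B y z := fun g y z =>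
    InvariantForm.apply_weylGroup_smul R (B := R.toInvariantForm) g y z
  have h1 : B (v • x) (v • x) = B (w • x) (w • x) := by rw [hB, hB]
  have hsymm : ∀ y z, B y z = B z y := fun y z => R.rootForm_symmetric.eq z y |>.symm
  have hii : 0 < B (R.root i) (R.root i) :=
    R.rootForm_pos_of_ne_zero (by simp) (R.ne_zero i)
  have hco : 2 * B (R.root i) (v • x) = R.coroot' i (v • x) * B (R.root i) (R.root i) := by
    have h2 := hB (R.simpleRefl i) (R.root i) (v • x)
    rw [simpleRefl_smul, simpleRefl_smul, R.root_coroot'_eq_pairing, R.pairing_same] at h2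
    simp only [map_sub, map_smul, LinearMap.sub_apply, LinearMap.smul_apply, smul_eq_mul] at h2
    linarith
  rw [h] at h1
  simp only [map_sub, (B _).map_smul, B.map_smul, LinearMap.sub_apply, LinearMap.smul_apply,
    smul_eq_mul] at h1
  rw [hsymm (v • x) (R.root i)] at h1
  -- The form is invariant, so both points lie on one sphere, and a line meets a sphere at most
  -- twice: at `t = 0` and at the reflected point.
  have h3 : t * (t - R.coroot' i (v • x)) * B (R.root i) (R.root i) = 0 := by
    linear_combination t * hco - h1
  rcases mul_eq_zero.1 ((mul_eq_zero.1 h3).resolve_right hii.ne') with ht | ht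
  · left
    exact b.smul_injective_of_dominant hx (by rw [h, ht, zero_smul, sub_zero])
  · right
    refine b.smul_injective_of_dominant hx ?_
    rw [h, mul_smul, simpleRefl_smul, sub_eq_zero.1 ht]

/-- `u` maps strictly dominant vectors to vectors which are strictly dominant outside of `K`, and
the elements of the Weyl group which agree with `u` in the coordinates in `K` are determined up to
the stabilizer of these coordinates. -/
structure IsAdapted (K : Set b.support) (u : R.weylGroup) : Prop where
  pos : ∀ x : M, (∀ i : b.support, 0 < R.coroot' i x) → ∀ j ∉ K, 0 < R.coroot' (j : b.support) (u • x)
  fixed : ∀ x : M, (∀ i : b.support, 0 < R.coroot' i x) → ∀ v : R.weylGroup,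
    (∀ i ∈ K, b.coord i (v • x) = b.coord i (u • x)) →
      ∀ i ∈ K, ∀ y : M, b.coord i ((v * u⁻¹) • y) = b.coord i y

lemma isAdapted_empty_one : b.IsAdapted ∅ 1 :=
  ⟨fun x hx j _ => by simpa using hx j, by simp⟩

/-- Pairings of distinct simple roots are nonpositive, so `s_i` can only raise the pairings with the
simple coroots other than `i`. For the uniqueness part, `v u⁻¹` lowers the `i`-th coordinate of `u
x` by exactly the pairing with `i`, which is the equality case of `coord_smul_dichotomy`. -/
lemma IsAdapted.insert {b : R.Base} {K : Set b.support} {u : R.weylGroup} (h : b.IsAdapted K u)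
    {i : b.support} (hi : i ∉ K) : b.IsAdapted (insert i K) (R.simpleRefl i * u) := by
  constructor
  · intro x hx j hj
    rw [Set.mem_insert_iff, not_or] at hj
    rw [mul_smul, simpleRefl_smul, map_sub, (R.coroot' j).map_smul, R.root_coroot'_eq_pairing,
      smul_eq_mul]
    have h1 := h.pos x hx j hj.2
    have h2 := h.pos x hx i hi
    have h3 : R.pairing i j ≤ 0 := by
      rw [← R.algebraMap_pairingIn ℤ]
      have := b.pairingIn_le_zero_of_ne (i := i) (j := j) (fun h => hj.1 (Subtype.ext h.symm))
        i.2 j.2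
      simpa using this
    nlinarith
  · intro x hx v hv
    have hne : ∀ j ∈ K, j ≠ i := fun j hj h => hi (h ▸ hj)
    have hK : ∀ j ∈ K, ∀ y : M, b.coord j ((v * u⁻¹) • y) = b.coord j y := by
      refine h.fixed x hx v fun j hj => ?_
      rw [hv j (Set.mem_insert_of_mem _ hj), mul_smul, b.coord_simpleRefl_of_ne (hne j hj)]
    have hvu : (v * u⁻¹) • u • x = v • x := by rw [mul_smul, inv_smul_smul]
    have hvi := hv i (Set.mem_insert _ _)
    rw [mul_smul, coord_simpleRefl_self] at hvi
    have hpos := h.pos x hx i hi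
    have key : ∀ y : M, b.coord i ((v * u⁻¹) • y) = b.coord i (R.simpleRefl i • y) := by
      rcases b.coord_smul_dichotomy K hK (fun j hj => h.pos x hx j hj) i with h1 | h1
      · have := h1 (u • x)
        rw [hvu] at this
        linarith
      · rw [hvu] at h1
        exact h1.2 hvi
    have e : ∀ y : M, (v * (R.simpleRefl i * u)⁻¹) • y = (v * u⁻¹) • R.simpleRefl i • y := by
      intro y
      rw [mul_inv_rev, simpleRefl_inv, ← mul_smul, mul_assoc]
    intro j hj y
    rw [e]
    rcases hj with rfl | hj
    · rw [key, ← mul_smul, simpleRefl_mul_self, one_smul]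
    · rw [hK j hj, b.coord_simpleRefl_of_ne (hne j hj)]

/-- If `u` is adapted to `K`, two elements agreeing outside of `J` on a strictly dominant vector,
where `J` is disjoint from `K`, differ by an element of the parabolic subgroup of `J`. -/
lemma IsAdapted.mem_closure {b : R.Base} {K : Set b.support} {u : R.weylGroup}
    (h : b.IsAdapted K u) {J : Set b.support} (hJ : Disjoint K J) {x : M}
    (hx : ∀ i : b.support, 0 < R.coroot' i x) {v : R.weylGroup}
    (hv : ∀ i ∉ J, b.coord i (v • x) = b.coord i (u • x)) :
    v * u⁻¹ ∈ Subgroup.closure ((fun i : b.support => R.simpleRefl i) '' J) := by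
  have hK := h.fixed x hx v fun i hi => hv i (Set.disjoint_left.1 hJ hi)
  refine b.mem_closure_of_coord_fixed J _ fun i hi => ?_
  by_cases hiK : i ∈ K
  · exact hK i hiK
  rcases b.coord_smul_dichotomy K hK (fun j hj => h.pos x hx j hj) i with h1 | h1
  · exact h1
  · have hvu : (v * u⁻¹) • u • x = v • x := by rw [mul_smul, inv_smul_smul]
    rw [hvu, hv i hi] at h1
    linarith [h1.1, h.pos x hx i hiK]

lemma pairing_le_zero_of_ne {i j : b.support} (h : i ≠ j) : R.pairing i j ≤ 0 := by
  rw [← R.algebraMap_pairingIn ℤ]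
  have := b.pairingIn_le_zero_of_ne (i := i) (j := j) (fun h' => h (Subtype.ext h')) i.2 j.2
  simpa using this

lemma coroot'_eq_sum_coord (j : ι) (x : M) :
    R.coroot' j x = ∑ i, b.coord i x * R.pairing i j := by
  conv_lhs => rw [← b.sum_coord_smul x]
  simp [R.root_coroot'_eq_pairing]

/-- A Weyl group element moving `ω_α` by a root supported outside of `J`, which is adapted to its
support; the root is not orthogonal to all simple roots in `J`. -/
lemma exists_isAdapted [R.IsIrreducible] (α : b.support) (J : Set b.support) (hJ : J.Nonempty)
    (hα : α ∉ J) :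
    ∃ (K : Set b.support) (u w : R.weylGroup), Disjoint K J ∧ b.IsAdapted K u ∧
      u • (b.fundamentalWeight α : M) = b.fundamentalWeight α - w • R.root α ∧
      b.coord α (w • R.root α) = 1 ∧
      (∀ x : M, b.coord α (u • x) = b.coord α x - R.coroot' α x) ∧
      (∀ i ∈ J, R.coroot' i (w • R.root α) ≤ 0) ∧
      ∃ i ∈ J, R.coroot' i (w • R.root α) < 0 := by
  classical
  -- `K` grows from `{α}` by one simple reflection at a time. The root `w α` keeps support exactly
  -- `K` and `α`-coefficient `1`, hence pairs nonpositively with the simple coroots outside `K`.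
  let P : Set b.support → Prop := fun K => Disjoint K J ∧ α ∈ K ∧ ∃ u w : R.weylGroup,
    b.IsAdapted K u ∧ u • (b.fundamentalWeight α : M) = b.fundamentalWeight α - w • R.root α ∧
      b.coord α (w • R.root α) = 1 ∧ (∀ x : M, b.coord α (u • x) = b.coord α x - R.coroot' α x) ∧
      (∀ i ∈ K, 0 < b.coord i (w • R.root α)) ∧ ∀ i ∉ K, b.coord i (w • R.root α) = 0
  have hP0 : P {α} := by
    refine ⟨by simpa using hα, rfl, R.simpleRefl α, 1, ?_, ?_, ?_, ?_, ?_, ?_⟩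
    · simpa using b.isAdapted_empty_one.insert (i := α) (by simp)
    · rw [simpleRefl_fundamentalWeight_self, one_smul]
    · rw [one_smul, coord_root_self]
    · intro x
      rw [coord_simpleRefl_self]
    · rintro i rfl
      rw [one_smul, coord_root_self]
      exact one_pos
    · intro i hi
      rw [one_smul, b.coord_root_of_ne hi]
  obtain ⟨K, hK⟩ := (Set.toFinite {K | P K}).exists_maximal ⟨_, hP0⟩
  obtain ⟨⟨hKJ, hαK, u, w, had, huα, hwα, huc, hpos, hzero⟩, hmax⟩ := hK
  have hle : ∀ i ∉ K, R.coroot' i (w • R.root α) ≤ 0 := by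
    intro i hi
    rw [b.coroot'_eq_sum_coord]
    refine Finset.sum_nonpos fun j _ => ?_
    by_cases hj : j ∈ K
    · exact mul_nonpos_of_nonneg_of_nonpos (hpos j hj).le
        (b.pairing_le_zero_of_ne fun h => hi (h ▸ hj))
    · rw [hzero j hj, zero_mul]
  have hlt : ∀ i ∉ K, ∀ j ∈ K, R.pairing j i ≠ 0 → R.coroot' i (w • R.root α) < 0 := by
    intro i hi j hj hji
    rw [b.coroot'_eq_sum_coord]
    refine Finset.sum_neg' (fun k _ => ?_) ⟨j, Finset.mem_univ _, ?_⟩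
    · by_cases hk : k ∈ K
      · exact mul_nonpos_of_nonneg_of_nonpos (hpos k hk).le
          (b.pairing_le_zero_of_ne fun h => hi (h ▸ hk))
      · rw [hzero k hk, zero_mul]
    · exact mul_neg_of_pos_of_neg (hpos j hj)
        (lt_of_le_of_ne (b.pairing_le_zero_of_ne fun h => hi (h ▸ hj)) hji)
  refine ⟨K, u, w, hKJ, had, huα, hwα, huc, fun i hi => hle i (Set.disjoint_right.1 hKJ hi), ?_⟩
  -- By irreducibility some simple root outside `K` is adjacent to `K`. If it were not in `J`, it
  -- could be added to `K`, against maximality.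
  obtain ⟨i, hi, j, hj, hji⟩ : ∃ i ∉ K, ∃ j ∈ K, R.pairing j i ≠ 0 := by
    by_contra! hcon
    obtain ⟨k, hk⟩ := hJ
    refine Set.disjoint_right.1 hKJ hk ?_
    refine b.induction_on_cartanMatrix (fun i => i ∈ K) (i := α) (j := k) hαK fun i j hi hij => ?_
    by_contra hj
    have h1 := hcon j hj i hi
    apply hij
    rw [← R.algebraMap_pairingIn ℤ] at h1
    have h2 : R.pairingIn ℤ i j = 0 := by simpa using h1
    rw [b.cartanMatrix_apply_eq_zero_iff_symm]
    exact h2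
  by_cases hiJ : i ∈ J
  · exact ⟨i, hiJ, hlt i hi j hj hji⟩
  exfalso
  have hiα : α ≠ i := fun h => hi (h ▸ hαK)
  have hPi : P (insert i K) := by
    refine ⟨?_, Set.mem_insert_of_mem _ hαK, R.simpleRefl i * u, R.simpleRefl i * w,
      had.insert hi, ?_, ?_, ?_, ?_, ?_⟩
    · rw [Set.disjoint_insert_left]
      exact ⟨hiJ, hKJ⟩
    · rw [mul_smul, huα, smul_sub, b.simpleRefl_fundamentalWeight_of_ne hiα, mul_smul]
    · rw [mul_smul, b.coord_simpleRefl_of_ne hiα, hwα]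
    · intro x
      rw [mul_smul, b.coord_simpleRefl_of_ne hiα, huc]
    · rintro k (rfl | hk)
      · rw [mul_smul, coord_simpleRefl_self, hzero _ hi]
        linarith [hlt _ hi j hj hji]
      · rw [mul_smul, b.coord_simpleRefl_of_ne fun h : k = i => hi (h ▸ hk)]
        exact hpos k hk
    · intro k hk
      rw [Set.mem_insert_iff, not_or] at hk
      rw [mul_smul, b.coord_simpleRefl_of_ne hk.1]
      exact hzero k hk.2
  exact hi (hmax hPi (Set.subset_insert i K) (Set.mem_insert i K))

end RootPairing.Base

/-! ### Twisted projections of group algebras and their top terms -/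

namespace AddMonoidAlgebra

section Twist

variable {A B P G : Type*} [CommRing A] [CommRing B] [Algebra A B] [AddCommGroup P]
  [AddCommGroup G]

/-- The homomorphism of group algebras `e^p ↦ χ(p) e^{g(p)}`. -/
def twist (χ : Multiplicative P →* B) (g : P →+ G) :
    AddMonoidAlgebra A P →ₐ[A] AddMonoidAlgebra B G :=
  lift A (AddMonoidAlgebra B G) P
    { toFun := fun p => single (g p.toAdd) (χ p)
      map_one' := by simp [one_def]
      map_mul' := fun p q => by simp [single_mul_single] }

lemma twist_single (χ : Multiplicative P →* B) (g : P →+ G) (p : P) (a : A) :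
    twist χ g (single p a) = single (g p) (a • χ (Multiplicative.ofAdd p)) := by
  rw [twist, lift_single]
  simp [smul_single]

lemma twist_eq_sum (χ : Multiplicative P →* B) (g : P →+ G) (F : AddMonoidAlgebra A P) :
    twist χ g F = ∑ p ∈ F.coeff.support, single (g p) (F.coeff p • χ (Multiplicative.ofAdd p)) := by
  conv_lhs => rw [← sum_coeff_single F, Finsupp.sum, map_sum]
  simp_rw [twist_single]

lemma coeff_twist [DecidableEq G] (χ : Multiplicative P →* B) (g : P →+ G)
    (F : AddMonoidAlgebra A P) (x : G) :
    (twist χ g F).coeff x =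
      ∑ p ∈ F.coeff.support with g p = x, F.coeff p • χ (Multiplicative.ofAdd p) := by
  rw [twist_eq_sum, coeff_sum, Finsupp.finsetSum_apply, Finset.sum_filter]
  simp_rw [coeff_single, Finsupp.single_apply]

lemma exists_of_coeff_twist_ne_zero {χ : Multiplicative P →* B} {g : P →+ G}
    {F : AddMonoidAlgebra A P} {x : G} (h : (twist χ g F).coeff x ≠ 0) :
    ∃ p, F.coeff p ≠ 0 ∧ g p = x := by
  classical
  rw [coeff_twist] at h
  obtain ⟨p, hp, -⟩ := Finset.exists_ne_zero_of_sum_ne_zero h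
  rw [Finset.mem_filter, Finsupp.mem_support_iff] at hp
  exact ⟨p, hp⟩

/-- A twist with a larger kernel factors through a twist with a smaller kernel. -/
lemma twist_eq_zero_of_factor {G' : Type*} [AddCommGroup G'] {χ χ' : Multiplicative P →* B}
    {g : P →+ G} {g' : P →+ G'}
    (h : ∀ p, g p = 0 → χ' (Multiplicative.ofAdd p) = χ (Multiplicative.ofAdd p) ∧ g' p = 0)
    {F : AddMonoidAlgebra A P} (hF : twist χ g F = 0) : twist χ' g' F = 0 := by
  classical
  have hunit : ∀ (χ : Multiplicative P →* B) (p : P),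
      χ (Multiplicative.ofAdd p) * χ (Multiplicative.ofAdd (-p)) = 1 := by
    intro χ p
    rw [← map_mul, ← ofAdd_add, add_neg_cancel, ofAdd_zero, map_one]
  have hsub : ∀ (χ : Multiplicative P →* B) (p q : P),
      χ (Multiplicative.ofAdd p) = χ (Multiplicative.ofAdd q) * χ (Multiplicative.ofAdd (p - q)) := by
    intro χ p q
    rw [← map_mul, ← ofAdd_add, add_sub_cancel]
  -- On each fibre of `g` the map `g'` is constant and `χ'` is a constant multiple of `χ`, so each
  -- fibre sum for `χ'` is a multiple of a coefficient of the vanishing twist.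
  rw [twist_eq_sum, ← Finset.sum_fiberwise_of_maps_to (g := g) (t := F.coeff.support.image g)
    fun p hp => Finset.mem_image_of_mem g hp]
  refine Finset.sum_eq_zero fun x hx => ?_
  obtain ⟨q, hq, rfl⟩ := Finset.mem_image.1 hx
  have hcoeff : (twist χ g F).coeff (g q) = 0 := by rw [hF]; rfl
  rw [coeff_twist] at hcoeff
  have hterm : ∀ p ∈ F.coeff.support.filter (fun p => g p = g q),
      single (g' p) (F.coeff p • χ' (Multiplicative.ofAdd p)) =
        singleAddHom (g' q) ((χ' (Multiplicative.ofAdd q) * χ (Multiplicative.ofAdd (-q))) *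
          (F.coeff p • χ (Multiplicative.ofAdd p))) := by
    intro p hp
    rw [Finset.mem_filter] at hp
    obtain ⟨h1, h2⟩ := h (p - q) (by rw [map_sub, hp.2, sub_self])
    rw [map_sub, sub_eq_zero] at h2
    rw [h2, hsub χ' p q, h1, hsub χ p q]
    simp only [singleAddHom_apply]
    congr 1
    rw [mul_smul_comm, show χ' (Multiplicative.ofAdd q) * χ (Multiplicative.ofAdd (-q)) *
      (χ (Multiplicative.ofAdd q) * χ (Multiplicative.ofAdd (p - q))) =
      (χ (Multiplicative.ofAdd q) * χ (Multiplicative.ofAdd (-q))) *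
      (χ' (Multiplicative.ofAdd q) * χ (Multiplicative.ofAdd (p - q))) by ring, hunit, one_mul]
  rw [Finset.sum_congr rfl hterm, ← map_sum, ← Finset.mul_sum, hcoeff, mul_zero, map_zero]

lemma twist_mapDomain {Q : Type*} [AddCommGroup Q] (χ : Multiplicative P →* B) (g : P →+ G)
    (h : Q →+ P) (F : AddMonoidAlgebra A Q) :
    twist χ g (mapDomainRingHom A h F) =
      twist (χ.comp (AddMonoidHom.toMultiplicative h)) (g.comp h) F := by
  induction F using induction_linear with
  | zero => simp
  | add x y hx hy => rw [map_add, map_add, map_add, hx, hy]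
  | single p a => simp [twist_single, mapDomainRingHom]

/-- Twists are compatible with homomorphisms of the coefficient rings. -/
lemma map_coeff_twist {C : Type*} [CommRing C] [Algebra A C] (φ : B →ₐ[A] C)
    (χ : Multiplicative P →* B) (g : P →+ G) (F : AddMonoidAlgebra A P) (x : G) :
    φ ((twist χ g F).coeff x) = (twist ((φ : B →* C).comp χ) g F).coeff x := by
  classical
  rw [coeff_twist, coeff_twist, map_sum]
  simp

lemma isIntegral_coeff_twist {χ : Multiplicative P →* B} (hχ : ∀ p, IsIntegral A (χ p))
    (g : P →+ G) (F : AddMonoidAlgebra A P) (x : G) : IsIntegral A ((twist χ g F).coeff x) := by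
  classical
  rw [coeff_twist]
  exact IsIntegral.sum _ fun p _ => (hχ _).smul _

/-- The character `p ↦ z ^ f(p)`. -/
def powChar (z : Bˣ) (f : P →+ ℤ) : Multiplicative P →* B :=
  (Units.coeHom B).comp ((zpowersHom Bˣ z).comp (AddMonoidHom.toMultiplicative f))

lemma powChar_apply (z : Bˣ) (f : P →+ ℤ) (p : P) :
    powChar z f (Multiplicative.ofAdd p) = ((z ^ f p : Bˣ) : B) := rfl

end Twist

section Order

variable {B G : Type*} [CommRing B] [AddCommGroup G] [LinearOrder G] [IsOrderedAddMonoid G]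

/-- All exponents of `F` are at most `a`. -/
def IsTop (F : AddMonoidAlgebra B G) (a : G) : Prop := ∀ x, F.coeff x ≠ 0 → x ≤ a

lemma coeff_mul_of_isTop {F₁ F₂ : AddMonoidAlgebra B G} {a₁ a₂ : G} (h₁ : F₁.IsTop a₁)
    (h₂ : F₂.IsTop a₂) : (F₁ * F₂).coeff (a₁ + a₂) = F₁.coeff a₁ * F₂.coeff a₂ := by
  refine coeff_mul_add_of_uniqueAdd fun x y hx hy hxy => ?_
  rw [Finsupp.mem_support_iff] at hx hy
  have hx' := h₁ x hx
  have hy' := h₂ y hy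
  have : x = a₁ := by
    refine le_antisymm hx' (le_of_not_gt fun hlt => ?_)
    exact (add_lt_add_of_lt_of_le hlt hy').ne hxy
  subst this
  exact ⟨rfl, add_left_cancel hxy⟩

lemma IsTop.mul {F₁ F₂ : AddMonoidAlgebra B G} {a₁ a₂ : G} (h₁ : F₁.IsTop a₁)
    (h₂ : F₂.IsTop a₂) : (F₁ * F₂).IsTop (a₁ + a₂) := by
  classical
  intro x hx
  have := support_coeff_mul_subset F₁ F₂ (Finsupp.mem_support_iff.2 hx)
  obtain ⟨y, hy, z, hz, rfl⟩ := Finset.mem_add.1 this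
  exact add_le_add (h₁ y (Finsupp.mem_support_iff.1 hy)) (h₂ z (Finsupp.mem_support_iff.1 hz))

lemma exists_isTop {F : AddMonoidAlgebra B G} (hF : F ≠ 0) : ∃ a, F.IsTop a ∧ F.coeff a ≠ 0 := by
  have hne : F.coeff.support.Nonempty := by
    rw [Finsupp.support_nonempty_iff]
    simpa using hF
  obtain ⟨a, ha, hmax⟩ := F.coeff.support.exists_max_image id hne
  exact ⟨a, fun x hx => hmax x (Finsupp.mem_support_iff.2 hx), Finsupp.mem_support_iff.1 ha⟩

lemma IsTop.eq_of_ne_zero {F : AddMonoidAlgebra B G} {a a' : G} (h : F.IsTop a) (h' : F.IsTop a')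
    (ha : F.coeff a ≠ 0) (ha' : F.coeff a' ≠ 0) : a = a' :=
  le_antisymm (h' a ha) (h a' ha')

variable {A P : Type*} [CommRing A] [AddCommGroup P]

/-- The exponents of `F` have `f`-value at most `a`, which is attained. -/
def IsMaxValue (f : P →+ G) (F : AddMonoidAlgebra A P) (a : G) : Prop :=
  (∀ p, F.coeff p ≠ 0 → f p ≤ a) ∧ ∃ p, F.coeff p ≠ 0 ∧ f p = a

lemma exists_isMaxValue (f : P →+ G) {F : AddMonoidAlgebra A P} (hF : F ≠ 0) :
    ∃ p, F.coeff p ≠ 0 ∧ IsMaxValue f F (f p) := by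
  have hne : F.coeff.support.Nonempty := by
    rw [Finsupp.support_nonempty_iff]
    simpa using hF
  obtain ⟨a, ha, hmax⟩ := F.coeff.support.exists_max_image f hne
  have ha' := Finsupp.mem_support_iff.1 ha
  exact ⟨a, ha', fun x hx => hmax x (Finsupp.mem_support_iff.2 hx), a, ha', rfl⟩

lemma IsMaxValue.unique {f : P →+ G} {F : AddMonoidAlgebra A P} {a a' : G}
    (h : IsMaxValue f F a) (h' : IsMaxValue f F a') : a = a' := by
  obtain ⟨p, hp, rfl⟩ := h.2
  obtain ⟨q, hq, rfl⟩ := h'.2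
  exact le_antisymm (h'.1 p hp) (h.1 q hq)

lemma IsMaxValue.isTop_twist [Algebra A B] {f : P →+ G} {F : AddMonoidAlgebra A P}
    {a : G} (h : IsMaxValue f F a) (χ : Multiplicative P →* B) : (twist χ f F).IsTop a := by
  intro x hx
  obtain ⟨p, hp, rfl⟩ := exists_of_coeff_twist_ne_zero hx
  exact h.1 p hp

/-- Twisting by the tautological character `p ↦ e^p` keeps all information and grades `A[P]` by `G`.
Top components multiply without cancellation because `A[P]` is a domain. -/
lemma IsMaxValue.mul [IsDomain A] [TwoUniqueSums P] {f : P →+ G} {F₁ F₂ : AddMonoidAlgebra A P}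
    {a₁ a₂ : G} (h₁ : IsMaxValue f F₁ a₁) (h₂ : IsMaxValue f F₂ a₂) :
    IsMaxValue f (F₁ * F₂) (a₁ + a₂) := by
  classical
  let χ : Multiplicative P →* AddMonoidAlgebra A P := of A P
  have hcoeff : ∀ (F : AddMonoidAlgebra A P) (p : P) (a : G), f p = a →
      ((twist χ f F).coeff a).coeff p = F.coeff p := by
    rintro F p _ rfl
    rw [coeff_twist, coeff_sum, Finsupp.finsetSum_apply]
    have : ∀ q : P, (F.coeff q • χ (Multiplicative.ofAdd q)).coeff p =
        if q = p then F.coeff q else 0 := by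
      intro q
      simp [χ, Finsupp.single_apply]
    simp_rw [this]
    rw [Finset.sum_ite_eq']
    simp only [Finset.mem_filter, Finsupp.mem_support_iff, and_true, ne_eq, ite_not]
    split_ifs with h0
    · exact h0.symm
    · rfl
  have hne : ∀ {F : AddMonoidAlgebra A P} {a : G}, IsMaxValue f F a →
      (twist χ f F).coeff a ≠ 0 := by
    intro F a h h0
    obtain ⟨p, hp, hpa⟩ := h.2
    apply hp
    rw [← hcoeff F p a hpa, h0]
    rfl
  have htop : ∀ {F : AddMonoidAlgebra A P} {a : G}, IsMaxValue f F a → (twist χ f F).IsTop a :=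
    fun h => h.isTop_twist χ
  have hmul := coeff_mul_of_isTop (htop h₁) (htop h₂)
  have hmul' := (htop h₁).mul (htop h₂)
  rw [← map_mul] at hmul hmul'
  have hne' := mul_ne_zero (hne h₁) (hne h₂)
  rw [← hmul] at hne'
  refine ⟨fun p hp => hmul' _ fun h0 => hp ?_, ?_⟩
  · rw [← hcoeff _ p _ rfl, h0]
    rfl
  · exact exists_of_coeff_twist_ne_zero hne'

end Order

end AddMonoidAlgebra

/-! ### Vanishing at a root, and orders on weights modulo simple roots -/

namespace RootPairing

variable {ι M N : Type*} [AddCommGroup M] [Module ℝ M] [AddCommGroup N] [Module ℝ N]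
  (R : RootPairing ι ℝ M N)

/-- The pairing of weights with a coroot, as an additive map. -/
def weightCoeffHom (i : ι) : R.weightLattice →+ ℤ :=
  AddMonoidHom.mk' (R.weightCoeff i) fun x y => by
    have h := R.weightCoeff_spec i (x + y)
    rw [AddSubgroup.coe_add, map_add, R.weightCoeff_spec, R.weightCoeff_spec] at h
    exact_mod_cast h.symm

lemma weightCoeffHom_apply (i : ι) (x : R.weightLattice) :
    R.weightCoeffHom i x = R.weightCoeff i x := rfl

lemma weightCoeffHom_cast (i : ι) (x : R.weightLattice) :
    ((R.weightCoeffHom i x : ℤ) : ℝ) = R.coroot' i (x : M) :=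
  (R.weightCoeff_spec i x).symm

lemma weightCoeffHom_eq_iff {i : ι} {x : R.weightLattice} {n : ℤ} :
    R.weightCoeffHom i x = n ↔ R.coroot' i (x : M) = n := by
  rw [← weightCoeffHom_cast]
  exact_mod_cast Iff.rfl

variable [R.IsCrystallographic]

lemma weylAct_coe (w : R.weylGroup) (x : R.weightLattice) :
    ((R.weylAct w x : R.weightLattice) : M) = w • (x : M) := rfl

lemma weylAct_mul (v w : R.weylGroup) (x : R.weightLattice) :
    R.weylAct (v * w) x = R.weylAct v (R.weylAct w x) :=
  Subtype.ext (mul_smul v w (x : M))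

lemma weylAct_one (x : R.weightLattice) : R.weylAct 1 x = x :=
  Subtype.ext (one_smul _ (x : M))

lemma weightCoeffHom_perm_weylAct (w : R.weylGroup) (i : ι) (x : R.weightLattice) :
    R.weightCoeffHom (R.weylGroupToPerm w i) (R.weylAct w x) = R.weightCoeffHom i x := by
  rw [weightCoeffHom_eq_iff, weylAct_coe, coroot'_perm_smul, weightCoeffHom_cast]

lemma weightCoeffHom_simpleRefl (i : ι) (x : R.weightLattice) :
    R.weightCoeffHom i (R.weylAct (R.simpleRefl i) x) = -R.weightCoeffHom i x := by
  rw [weightCoeffHom_eq_iff, weylAct_coe, simpleRefl_smul, map_sub, (R.coroot' i).map_smul,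
    R.root_coroot'_eq_pairing, R.pairing_same]
  push_cast
  rw [weightCoeffHom_cast, smul_eq_mul]
  ring

lemma weylSign_simpleRefl_mul [Finite ι] [R.IsRootSystem] (i : ι) (w : R.weylGroup) :
    R.weylSign (R.simpleRefl i * w) = -R.weylSign w := by
  rw [weylSign_mul, weylSign_reflection, neg_one_mul]

lemma weylSign_eq_or [Finite ι] [R.IsRootSystem] (w : R.weylGroup) :
    R.weylSign w = 1 ∨ R.weylSign w = -1 := by
  have h : R.weylSign w * R.weylSign w⁻¹ = 1 := by
    rw [← weylSign_mul, mul_inv_cancel, weylSign_one]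
  exact Int.isUnit_iff.1 (IsUnit.of_mul_eq_one _ h)

open AddMonoidAlgebra in
lemma weylInvariants_mapDomain {A : Type*} [CommRing A]
    {F : AddMonoidAlgebra A R.weightLattice} (hF : F ∈ R.weylInvariants A) (w : R.weylGroup) :
    mapDomainRingHom A (R.weylAct w) F = F := by
  simp only [weylInvariants, Subring.mem_iInf] at hF
  exact hF w

lemma weylAct_injective (w : R.weylGroup) : Function.Injective (R.weylAct w) := by
  intro x y h
  have := congrArg (R.weylAct w⁻¹) h
  simpa [← weylAct_mul, weylAct_one] using this

lemma coeff_weylAct {A : Type*} [CommRing A]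
    {F : AddMonoidAlgebra A R.weightLattice} (hF : F ∈ R.weylInvariants A) (w : R.weylGroup)
    (x : R.weightLattice) : F.coeff (R.weylAct w x) = F.coeff x := by
  conv_lhs => rw [← R.weylInvariants_mapDomain hF w]
  exact Finsupp.mapDomain_apply (R.weylAct_injective w) _ _

section Twist

open AddMonoidAlgebra

variable {A B G : Type*} [CommRing A] [CommRing B] [Algebra A B] [AddCommGroup G]

/-- The image of `F` under `e^x ↦ z^⟨x, αᵢ*⟩ e^x̄`, where `x̄` is the class modulo the `i`-th root,
is zero. -/
def VanishesAt (i : ι) (z : Bˣ) (F : AddMonoidAlgebra A R.weightLattice) : Prop :=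
  twist (A := A) (powChar z (R.weightCoeffHom i))
    (((Submodule.span ℝ {R.root i}).mkQ.toAddMonoidHom).comp R.weightLattice.subtype) F = 0

/-- Only the kernel of the projection matters. Hence the quotient by the root line may be replaced
by a linearly ordered model, in which top terms make sense. -/
lemma vanishesAt_iff_twist {i : ι} {z : Bˣ} {g : R.weightLattice →+ G}
    (hg : ∀ x, g x = 0 ↔ (x : M) ∈ Submodule.span ℝ {R.root i})
    {F : AddMonoidAlgebra A R.weightLattice} :
    R.VanishesAt i z F ↔ twist (A := A) (powChar z (R.weightCoeffHom i)) g F = 0 := by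
  constructor
  · refine fun h => twist_eq_zero_of_factor (fun p hp => ⟨rfl, (hg p).2 ?_⟩) h
    simpa using hp
  · refine fun h => twist_eq_zero_of_factor (fun p hp => ⟨rfl, ?_⟩) h
    simpa using (hg p).1 hp

/-- The vanishing of Weyl group invariants depends only on the Weyl orbit of the root. -/
lemma VanishesAt.perm {R : RootPairing ι ℝ M N} [R.IsCrystallographic] {i : ι} {z : Bˣ}
    {F : AddMonoidAlgebra A R.weightLattice} (h : R.VanishesAt i z F)
    (hF : F ∈ R.weylInvariants A) (w : R.weylGroup) :
    R.VanishesAt (R.weylGroupToPerm w i) z F := by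
  rw [VanishesAt, ← R.weylInvariants_mapDomain hF w, twist_mapDomain]
  refine twist_eq_zero_of_factor (fun p hp => ⟨?_, ?_⟩) h
  · change powChar z _ (Multiplicative.ofAdd (R.weylAct w p)) = _
    rw [powChar_apply, powChar_apply, weightCoeffHom_perm_weylAct]
  · have hp' : (p : M) ∈ Submodule.span ℝ {R.root i} := by simpa using hp
    obtain ⟨a, ha⟩ := Submodule.mem_span_singleton.1 hp'
    have : ((R.weylAct w p : R.weightLattice) : M) ∈
        Submodule.span ℝ {R.root (R.weylGroupToPerm w i)} := by
      rw [weylAct_coe, ← ha, weyl_smul_real, ← weyl_smul_root]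
      exact Submodule.mem_span_singleton.2 ⟨a, rfl⟩
    exact (Submodule.Quotient.mk_eq_zero _).2 this

variable [Finite ι] [R.IsRootSystem]

lemma twist_schurWeyl [Fintype R.weylGroup] (χ : Multiplicative R.weightLattice →* B)
    (g : R.weightLattice →+ G) (x : R.weightLattice) :
    twist χ g (R.schurWeyl A x) = ∑ w : R.weylGroup,
      single (g (R.weylAct w x)) ((R.weylSign w : B) * χ (Multiplicative.ofAdd (R.weylAct w x))) := by
  rw [schurWeyl, map_sum]
  refine (Finset.sum_congr ?_ fun w _ => ?_)
  · ext
    simp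
  · rw [twist_single, Algebra.smul_def, map_intCast]

lemma coeff_twist_schurWeyl [Fintype R.weylGroup] [DecidableEq G]
    (χ : Multiplicative R.weightLattice →* B)
    (g : R.weightLattice →+ G) (x : R.weightLattice) (a : G) :
    (twist χ g (R.schurWeyl A x)).coeff a = ∑ w : R.weylGroup with g (R.weylAct w x) = a,
      (R.weylSign w : B) * χ (Multiplicative.ofAdd (R.weylAct w x)) := by
  rw [twist_schurWeyl, coeff_sum, Finsupp.finsetSum_apply, Finset.sum_filter]
  simp_rw [coeff_single, Finsupp.single_apply]

lemma exists_of_coeff_twist_schurWeyl_ne_zero {χ : Multiplicative R.weightLattice →* B}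
    {g : R.weightLattice →+ G} {x : R.weightLattice} {a : G}
    (h : (twist χ g (R.schurWeyl A x)).coeff a ≠ 0) : ∃ w, g (R.weylAct w x) = a := by
  classical
  let := Fintype.ofFinite R.weylGroup
  rw [coeff_twist_schurWeyl] at h
  obtain ⟨w, hw, -⟩ := Finset.exists_ne_zero_of_sum_ne_zero h
  exact ⟨w, by simpa using hw⟩

/-- Twists which do not separate the elements of the Weyl orbit of `x` from their reflections in
the `i`-th root kill `S(x)`. -/
lemma twist_schurWeyl_eq_zero {χ : Multiplicative R.weightLattice →* B}
    {g : R.weightLattice →+ G} {x : R.weightLattice} (i : ι)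
    (hχ : ∀ w : R.weylGroup, χ (Multiplicative.ofAdd (R.weylAct (R.simpleRefl i) (R.weylAct w x))) =
      χ (Multiplicative.ofAdd (R.weylAct w x)))
    (hg : ∀ y, g (R.weylAct (R.simpleRefl i) y) = g y) : twist χ g (R.schurWeyl A x) = 0 := by
  let := Fintype.ofFinite R.weylGroup
  rw [twist_schurWeyl]
  refine Finset.sum_involution (fun w _ => R.simpleRefl i * w) ?_ ?_ ?_ ?_
  · intro w _
    rw [weylAct_mul, hg, hχ, weylSign_simpleRefl_mul, ← single_add]
    simp
  · intro w _ _ h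
    have h1 := congrArg R.weylSign h
    rw [weylSign_simpleRefl_mul] at h1
    rcases R.weylSign_eq_or w with h2 | h2 <;> rw [h2] at h1 <;> norm_num at h1
  · intro w _
    exact Finset.mem_univ _
  · intro w _
    rw [← mul_assoc, simpleRefl_mul_self, one_mul]

end Twist

namespace Base

variable {R} [R.IsRootSystem] (b : R.Base)

lemma dominantRegular_iff {x : R.weightLattice} :
    b.DominantRegular x ↔ ∀ i : b.support, 0 < R.coroot' i (x : M) := by
  simp only [DominantRegular, Subtype.forall, weightCoeff_spec, Int.cast_pos]

lemma weightCoeffHom_fundamentalWeight [DecidableEq b.support] (i j : b.support) :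
    R.weightCoeffHom j (b.fundamentalWeight i) = if i = j then 1 else 0 := by
  rw [weightCoeffHom_eq_iff, coroot'_fundamentalWeight]
  split_ifs <;> simp

lemma weightCoeffHom_rho (i : b.support) : R.weightCoeffHom i b.rho = 1 := by
  classical
  rw [rho, map_sum]
  simp [weightCoeffHom_fundamentalWeight]

lemma weightCoeffHom_smul_rho (i : b.support) (d : ℕ) : R.weightCoeffHom i (d • b.rho) = d := by
  rw [map_nsmul, weightCoeffHom_rho]
  simp

lemma dominantRegular_smul_rho {d : ℕ} (hd : 0 < d) : b.DominantRegular (d • b.rho) := by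
  intro i hi
  rw [← weightCoeffHom_apply, b.weightCoeffHom_smul_rho ⟨i, hi⟩]
  exact_mod_cast hd

open Classical in
/-- An additive map to a linearly ordered group which compares weights modulo the span of the simple
roots in `J` by their coordinates lexicographically, starting with the `α`-coordinate. -/
def lexHom (α : b.support) (J : Set b.support) :
    R.weightLattice →+ Lex (Fin (Fintype.card b.support + 1) → ℝ) where
  -- The `α`-coordinate is put in position `0` to decide comparisons first; its second occurrence
  -- later is harmless.
  toFun x := toLex (Fin.cons (if α ∈ J then 0 else b.coord α x) fun k =>
    if (Fintype.equivFin b.support).symm k ∈ J then 0 else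
      b.coord ((Fintype.equivFin b.support).symm k) x)
  map_zero' := by
    rw [← toLex_zero]
    congr 1
    funext k
    refine Fin.cases ?_ (fun k => ?_) k <;> simp
  map_add' x y := by
    rw [← toLex_add]
    congr 1
    funext k
    refine Fin.cases ?_ (fun k => ?_) k
    · simp only [Fin.cons_zero, Pi.add_apply]
      split_ifs <;> simp
    · simp only [Fin.cons_succ, Pi.add_apply]
      split_ifs <;> simp

variable {b} {α : b.support} {J : Set b.support}

lemma lexHom_eq_iff {x y : R.weightLattice} :
    b.lexHom α J x = b.lexHom α J y ↔ ∀ i ∉ J, b.coord i (x : M) = b.coord i (y : M) := by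
  classical
  constructor
  · intro h i hi
    have h1 := congrFun (toLex.injective h) (Fin.succ (Fintype.equivFin b.support i))
    simpa [hi] using h1
  · intro h
    refine congrArg toLex ?_
    funext k
    refine Fin.cases ?_ (fun k => ?_) k
    · simp only [Fin.cons_zero]
      split_ifs with h1
      · rfl
      · exact h _ h1
    · simp only [Fin.cons_succ]
      split_ifs with h1
      · rfl
      · exact h _ h1

lemma lexHom_le {x y : R.weightLattice} (h : ∀ i ∉ J, b.coord i (x : M) ≤ b.coord i (y : M)) :
    b.lexHom α J x ≤ b.lexHom α J y := by
  classical
  refine Pi.toLex_monotone fun k => ?_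
  refine Fin.cases ?_ (fun k => ?_) k
  · simp only [Fin.cons_zero]
    split_ifs with h1
    · exact le_rfl
    · exact h _ h1
  · simp only [Fin.cons_succ]
    split_ifs with h1
    · exact le_rfl
    · exact h _ h1

/-- This is the purpose of the additional first entry: the top term of an orbit sum has the largest
possible `α`-coordinate. -/
lemma coord_le_of_lexHom_le (hα : α ∉ J) {x y : R.weightLattice}
    (h : b.lexHom α J x ≤ b.lexHom α J y) : b.coord α (x : M) ≤ b.coord α (y : M) := by
  classical
  rcases h.eq_or_lt with h | h
  · exact (lexHom_eq_iff.1 h α hα).le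
  · obtain ⟨k, hk, hlt⟩ := h
    revert hk hlt
    refine Fin.cases (fun hk hlt => ?_) (fun k hk hlt => ?_) k
    · have : (if α ∈ J then (0 : ℝ) else b.coord α (x : M)) <
        if α ∈ J then 0 else b.coord α (y : M) := hlt
      simpa [hα] using this.le
    · have : (if α ∈ J then (0 : ℝ) else b.coord α (x : M)) =
        if α ∈ J then 0 else b.coord α (y : M) := hk 0 (Fin.succ_pos k)
      simpa [hα] using this.le

lemma lexHom_empty_injective : Function.Injective (b.lexHom α ∅) := fun _ _ h =>
  Subtype.ext (b.ext_coord fun i => lexHom_eq_iff.1 h i (Set.notMem_empty i))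

lemma lexHom_eq_iff_exists {β : b.support} {x y : R.weightLattice} :
    b.lexHom α {β} x = b.lexHom α {β} y ↔ ∃ t : ℝ, (x : M) = y - t • R.root β := by
  rw [lexHom_eq_iff]
  constructor
  · intro h
    refine ⟨b.coord β (y : M) - b.coord β (x : M), b.ext_coord fun i => ?_⟩
    by_cases hi : i = β
    · subst hi
      simp [coord_root_self]
    · simp [b.coord_root_of_ne hi, h i hi]
  · rintro ⟨t, ht⟩ i hi
    simp [ht, b.coord_root_of_ne (i := i) (j := β) hi]

lemma vanishesAt_iff {A B : Type*} [CommRing A] [CommRing B] [Algebra A B] {β : b.support} {z : Bˣ}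
    {F : AddMonoidAlgebra A R.weightLattice} :
    R.VanishesAt (β : ι) z F ↔ AddMonoidAlgebra.twist (A := A)
      (AddMonoidAlgebra.powChar z (R.weightCoeffHom β)) (b.lexHom α {β}) F = 0 := by
  refine R.vanishesAt_iff_twist fun x => ?_
  rw [← map_zero (b.lexHom α {β}), lexHom_eq_iff_exists, Submodule.mem_span_singleton]
  constructor
  · rintro ⟨t, ht⟩
    exact ⟨-t, by simp [ht]⟩
  · rintro ⟨t, ht⟩
    exact ⟨-t, by simp [ht]⟩

variable (b) in
lemma twoUniqueSums_weightLattice [Nonempty b.support] : TwoUniqueSums R.weightLattice :=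
  TwoUniqueSums.of_injective_addHom (b.lexHom (Classical.arbitrary _) ∅).toAddHom
    lexHom_empty_injective inferInstance

end Base

end RootPairing

/-- The value `z ^ n - z ^ (-n)`. -/
def Units.antisymmPow {B : Type*} [CommRing B] (z : Bˣ) (n : ℤ) : B :=
  ((z ^ n : Bˣ) : B) - ((z ^ (-n) : Bˣ) : B)

lemma Units.antisymmPow_eq_zero_iff {B : Type*} [CommRing B] {z : Bˣ} {n : ℤ} :
    z.antisymmPow n = 0 ↔ z ^ (2 * n) = 1 := by
  rw [antisymmPow, sub_eq_zero, Units.val_inj, zpow_neg, eq_inv_iff_mul_eq_one, ← zpow_add,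
    two_mul]

/-! ### Leading exponents and leading values of factors of `S(x)` -/

namespace RootPairing.Base

open AddMonoidAlgebra

variable {ι M N : Type*} [Finite ι] [AddCommGroup M] [Module ℝ M] [AddCommGroup N] [Module ℝ N]
  {R : RootPairing ι ℝ M N} [R.IsRootSystem] [R.IsCrystallographic] [R.IsReduced] (b : R.Base)
  {A B : Type*} [CommRing A] [CommRing B] [Algebra A B]

lemma coord_weylAct_le {x : R.weightLattice} (hx : b.DominantRegular x) (w : R.weylGroup)
    (i : b.support) : b.coord i (R.weylAct w x : M) ≤ b.coord i (x : M) :=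
  b.coord_smul_le (b.dominantRegular_iff.1 hx) w i

lemma weylAct_injective_of_dominantRegular {x : R.weightLattice} (hx : b.DominantRegular x)
    {v w : R.weylGroup} (h : R.weylAct v x = R.weylAct w x) : v = w :=
  b.smul_injective_of_dominant (b.dominantRegular_iff.1 hx) (congrArg Subtype.val h)

/-- The coefficients of `S(x)` modulo a simple root. -/
lemma coeff_twist_schurWeyl_singleton {x : R.weightLattice} (hx : b.DominantRegular x)
    (α β : b.support) (v : R.weylGroup) (z : Bˣ) :
    (twist (powChar z (R.weightCoeffHom β)) (b.lexHom α {β}) (R.schurWeyl A x)).coeff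
      (b.lexHom α {β} (R.weylAct v x)) =
      R.weylSign v * z.antisymmPow (R.weightCoeffHom β (R.weylAct v x)) := by
  classical
  let := Fintype.ofFinite R.weylGroup
  have hne : v ≠ R.simpleRefl β * v := by
    intro h
    have h1 := congrArg R.weylSign h
    rw [weylSign_simpleRefl_mul] at h1
    rcases R.weylSign_eq_or v with h2 | h2 <;> rw [h2] at h1 <;> norm_num at h1
  -- Two orbit points in the same class modulo `β` are equal or exchanged by `s_β`, which flips both
  -- the sign and the pairing with `β`.
  have hset : Finset.univ.filter (fun w : R.weylGroup =>
      b.lexHom α {β} (R.weylAct w x) = b.lexHom α {β} (R.weylAct v x)) =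
        {v, R.simpleRefl β * v} := by
    ext w
    simp only [Finset.mem_filter, Finset.mem_univ, true_and, Finset.mem_insert,
      Finset.mem_singleton]
    rw [lexHom_eq_iff_exists]
    constructor
    · rintro ⟨t, ht⟩
      exact b.eq_or_eq_simpleRefl_mul (b.dominantRegular_iff.1 hx) ht
    · rintro (rfl | rfl)
      · exact ⟨0, by simp⟩
      · exact ⟨R.coroot' β (v • (x : M)), by
          rw [weylAct_coe, weylAct_coe, mul_smul, simpleRefl_smul]⟩
  rw [coeff_twist_schurWeyl, hset, Finset.sum_pair hne, weylSign_simpleRefl_mul, powChar_apply,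
    powChar_apply, weylAct_mul, weightCoeffHom_simpleRefl, Units.antisymmPow]
  push_cast
  ring

lemma exists_of_coeff_schurWeyl_ne_zero {x y : R.weightLattice}
    (h : (R.schurWeyl A x).coeff y ≠ 0) : ∃ w, R.weylAct w x = y := by
  classical
  rw [schurWeyl, coeff_sum, Finsupp.finsetSum_apply] at h
  obtain ⟨w, -, hw⟩ := Finset.exists_ne_zero_of_sum_ne_zero h
  refine ⟨w, ?_⟩
  by_contra hne
  rw [coeff_single, Finsupp.single_apply, if_neg hne] at hw
  exact hw rfl

lemma coeff_schurWeyl_self {x : R.weightLattice} (hx : b.DominantRegular x) :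
    (R.schurWeyl A x).coeff x = 1 := by
  classical
  rw [schurWeyl, coeff_sum, Finsupp.finsetSum_apply, Finset.sum_eq_single 1]
  · rw [weylAct_one, coeff_single, Finsupp.single_eq_same, weylSign_one, Int.cast_one]
  · intro w _ hw
    rw [coeff_single, Finsupp.single_apply, if_neg]
    intro h
    exact hw (b.weylAct_injective_of_dominantRegular hx (h.trans (R.weylAct_one x).symm))
  · intro h
    exact absurd (@Finset.mem_univ _ (Fintype.ofFinite _) _) h

lemma isMaxValue_schurWeyl [Nontrivial A] {x : R.weightLattice} (hx : b.DominantRegular x)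
    (α : b.support) (J : Set b.support) :
    IsMaxValue (b.lexHom α J) (R.schurWeyl A x) (b.lexHom α J x) := by
  refine ⟨fun y hy => ?_, x, ?_, rfl⟩
  · obtain ⟨w, rfl⟩ := exists_of_coeff_schurWeyl_ne_zero hy
    exact lexHom_le fun i _ => b.coord_weylAct_le hx w i
  · rw [b.coeff_schurWeyl_self hx]
    exact one_ne_zero

/-- `x` is an exponent of `F` which is maximal for all the orders given by `lexHom`. -/
def IsLeading (α : b.support) (F : AddMonoidAlgebra A R.weightLattice) (x : R.weightLattice) :
    Prop :=
  F.coeff x ≠ 0 ∧ ∀ J, IsMaxValue (b.lexHom α J) F (b.lexHom α J x)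

variable {b} {α : b.support}

lemma IsLeading.unique {F : AddMonoidAlgebra A R.weightLattice} {x y : R.weightLattice}
    (hx : b.IsLeading α F x) (hy : b.IsLeading α F y) : x = y :=
  lexHom_empty_injective ((hx.2 ∅).unique (hy.2 ∅))

lemma coeff_twist_lexHom_empty (χ : Multiplicative R.weightLattice →* B)
    (F : AddMonoidAlgebra A R.weightLattice) (x : R.weightLattice) :
    (twist χ (b.lexHom α ∅) F).coeff (b.lexHom α ∅ x) = F.coeff x • χ (Multiplicative.ofAdd x) := by
  classical
  rw [coeff_twist]
  by_cases h : F.coeff x = 0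
  · rw [h, zero_smul]
    refine Finset.sum_eq_zero fun p hp => ?_
    rw [Finset.mem_filter] at hp
    rw [lexHom_empty_injective hp.2, h, zero_smul]
  · rw [Finset.sum_eq_single_of_mem x]
    · simpa using h
    · intro p hp hpx
      rw [Finset.mem_filter] at hp
      exact absurd (lexHom_empty_injective hp.2) hpx

/-- In a factorization of `S(x)` the leading exponents of the factors add up. -/
lemma exists_isLeading [IsDomain A] (α : b.support) {d : ℕ} (hd : 0 < d) {x : R.weightLattice}
    (hx : b.DominantRegular x) {U V : AddMonoidAlgebra A R.weightLattice}
    (h : U * V * R.schurWeyl A (d • b.rho) = R.schurWeyl A x) :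
    ∃ y y', b.IsLeading α U y ∧ b.IsLeading α V y' ∧ y + y' + d • b.rho = x ∧
      U.coeff y * V.coeff y' = 1 := by
  have : Nonempty b.support := ⟨α⟩
  have := b.twoUniqueSums_weightLattice
  have hne : R.schurWeyl A x ≠ 0 := by
    intro h0
    have := b.coeff_schurWeyl_self (A := A) hx
    rw [h0] at this
    exact zero_ne_one this
  rw [← h] at hne
  have hU : U ≠ 0 := left_ne_zero_of_mul (left_ne_zero_of_mul hne)
  have hV : V ≠ 0 := right_ne_zero_of_mul (left_ne_zero_of_mul hne)
  have hρ := b.dominantRegular_smul_rho hd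
  obtain ⟨y, hy0, hy⟩ := exists_isMaxValue (b.lexHom α ∅) hU
  obtain ⟨y', hy'0, hy'⟩ := exists_isMaxValue (b.lexHom α ∅) hV
  have key : ∀ (J : Set b.support) (a a'), IsMaxValue (b.lexHom α J) U a →
      IsMaxValue (b.lexHom α J) V a' →
      a + a' + b.lexHom α J (d • b.rho) = b.lexHom α J x := by
    intro J a a' ha ha'
    have h1 := (ha.mul ha').mul (b.isMaxValue_schurWeyl hρ α J)
    rw [h] at h1
    exact h1.unique (b.isMaxValue_schurWeyl hx α J)
  have hsum : y + y' + d • b.rho = x := by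
    apply lexHom_empty_injective (b := b) (α := α)
    rw [map_add, map_add]
    exact key ∅ _ _ hy hy'
  -- `y` and `y'` were chosen for `J = ∅`. For other `J` their values are bounded by the two maxima,
  -- and both pairs have the same sum, so equality holds in each.
  have hJ : ∀ J, IsMaxValue (b.lexHom α J) U (b.lexHom α J y) ∧
      IsMaxValue (b.lexHom α J) V (b.lexHom α J y') := by
    intro J
    obtain ⟨t, -, ht⟩ := exists_isMaxValue (b.lexHom α J) hU
    obtain ⟨t', -, ht'⟩ := exists_isMaxValue (b.lexHom α J) hV
    have h1 := key J _ _ ht ht'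
    rw [← hsum, map_add, map_add, add_left_inj] at h1
    have h2 := ht.1 y hy0
    have h3 := ht'.1 y' hy'0
    have h4 : b.lexHom α J t = b.lexHom α J y := by
      refine le_antisymm (le_of_not_gt fun hlt => ?_) h2
      exact (add_lt_add_of_lt_of_le hlt h3).ne h1.symm
    rw [h4, add_right_inj] at h1
    exact ⟨h4 ▸ ht, h1 ▸ ht'⟩
  refine ⟨y, y', ⟨hy0, fun J => (hJ J).1⟩, ⟨hy'0, fun J => (hJ J).2⟩, hsum, ?_⟩
  have h1 := coeff_mul_of_isTop ((hy.isTop_twist (B := A) 1).mul (hy'.isTop_twist (B := A) 1))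
    ((b.isMaxValue_schurWeyl hρ α ∅).isTop_twist (A := A) (B := A) 1)
  rw [coeff_mul_of_isTop (hy.isTop_twist (B := A) 1) (hy'.isTop_twist (B := A) 1), ← map_mul,
    ← map_mul, h, ← map_add, ← map_add, hsum] at h1
  simp only [coeff_twist_lexHom_empty, MonoidHom.one_apply, smul_eq_mul, mul_one] at h1
  rw [b.coeff_schurWeyl_self hx, b.coeff_schurWeyl_self hρ, mul_one] at h1
  exact h1.symm

variable (b) in
/-- The coefficient of the image of `F` modulo the simple root `β` at the class of `x`. -/
def leadingValue (α β : b.support) (z : Bˣ) (F : AddMonoidAlgebra A R.weightLattice)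
    (x : R.weightLattice) : B :=
  (twist (powChar z (R.weightCoeffHom β)) (b.lexHom α {β}) F).coeff (b.lexHom α {β} x)

/-- Both sides are the coefficient of the twisted `S(x)` at its top class modulo `β`, where
coefficients of a product multiply. Thus the leading values of `U` and `V` are complementary factors
of `[m_β(x)] / [d]` as Laurent polynomials in `z`. -/
lemma leadingValue_mul [Nontrivial A] {d : ℕ} (hd : 0 < d) {x y y' : R.weightLattice}
    (hx : b.DominantRegular x) {U V : AddMonoidAlgebra A R.weightLattice}
    (h : U * V * R.schurWeyl A (d • b.rho) = R.schurWeyl A x)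
    (hU : b.IsLeading α U y) (hV : b.IsLeading α V y') (hsum : y + y' + d • b.rho = x)
    (β : b.support) (z : Bˣ) :
    b.leadingValue α β z U y * b.leadingValue α β z V y' * z.antisymmPow d =
      z.antisymmPow (R.weightCoeffHom β x) := by
  have hρ := b.dominantRegular_smul_rho hd
  let χ := powChar z (R.weightCoeffHom β)
  have hU' := (hU.2 {β}).isTop_twist χ
  have hV' := (hV.2 {β}).isTop_twist χ
  have h1 := coeff_mul_of_isTop (hU'.mul hV')
    ((b.isMaxValue_schurWeyl hρ α {β}).isTop_twist (A := A) χ)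
  rw [coeff_mul_of_isTop hU' hV', ← map_mul, ← map_mul, h, ← map_add, ← map_add, hsum] at h1
  have h2 := b.coeff_twist_schurWeyl_singleton (A := A) hx α β 1 z
  have h3 := b.coeff_twist_schurWeyl_singleton (A := A) hρ α β 1 z
  rw [weylAct_one, weylSign_one, Int.cast_one, one_mul] at h2 h3
  rw [b.weightCoeffHom_smul_rho] at h3
  rw [h2, h3] at h1
  exact h1.symm

lemma map_leadingValue {C : Type*} [CommRing C] [Algebra A C] (φ : B →ₐ[A] C) (β : b.support)
    (z : Bˣ) (F : AddMonoidAlgebra A R.weightLattice) (x : R.weightLattice) :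
    φ (b.leadingValue α β z F x) = b.leadingValue α β (Units.map (φ : B →* C) z) F x := by
  have h : (φ : B →* C).comp (powChar z (R.weightCoeffHom β)) =
      powChar (Units.map (φ : B →* C) z) (R.weightCoeffHom β) := by
    refine MonoidHom.ext fun p => ?_
    change φ ((z ^ R.weightCoeffHom β p.toAdd : Bˣ) : B) =
      ((Units.map (φ : B →* C) z ^ R.weightCoeffHom β p.toAdd : Cˣ) : C)
    rw [← map_zpow]
    rfl
  rw [leadingValue, map_coeff_twist, leadingValue, h]

end RootPairing.Base

/-! ### Arithmetic of roots of unity, dual numbers and integrality -/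

section Groups

variable {G : Type*} [CommGroup G]

lemma mem_of_pow_mem_of_pow_mem {H : Subgroup G} {z : G} {m n : ℕ} (hmn : m.Coprime n)
    (hm : z ^ m ∈ H) (hn : z ^ n ∈ H) : z ∈ H := by
  have h := Nat.gcd_eq_gcd_ab m n
  rw [hmn.gcd_eq_one] at h
  have h1 : z = (z ^ m) ^ Nat.gcdA m n * (z ^ n) ^ Nat.gcdB m n := by
    rw [← zpow_natCast, ← zpow_natCast, ← zpow_mul, ← zpow_mul, ← zpow_add, ← h]
    simp
  rw [h1]
  exact mul_mem (zpow_mem hm _) (zpow_mem hn _)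

lemma exists_eq_mul_of_pow_mul_eq_one {z : G} {m n : ℕ} (hmn : m.Coprime n)
    (h : z ^ (m * n) = 1) : ∃ x y, z = x * y ∧ x ^ m = 1 ∧ y ^ n = 1 ∧
      x ∈ Subgroup.zpowers z ∧ y ∈ Subgroup.zpowers z := by
  have hb := Nat.gcd_eq_gcd_ab m n
  rw [hmn.gcd_eq_one] at hb
  refine ⟨z ^ ((n : ℤ) * Nat.gcdB m n), z ^ ((m : ℤ) * Nat.gcdA m n), ?_, ?_, ?_,
    ⟨_, rfl⟩, ⟨_, rfl⟩⟩
  · rw [← zpow_add, add_comm, ← hb]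
    simp
  · rw [← zpow_natCast, ← zpow_mul, show (n : ℤ) * Nat.gcdB m n * m =
      ((m * n : ℕ) : ℤ) * Nat.gcdB m n by push_cast; ring, zpow_mul, zpow_natCast, h, one_zpow]
  · rw [← zpow_natCast, ← zpow_mul, show (m : ℤ) * Nat.gcdA m n * n =
      ((m * n : ℕ) : ℤ) * Nat.gcdA m n by push_cast; ring, zpow_mul, zpow_natCast, h, one_zpow]

/-- A property of the elements of order dividing `N` outside of a subgroup which is invariant under
multiplication with elements of prime power order is constant. -/
lemma forall_of_primePow_step {N : ℕ} (hN : 0 < N) (H : Subgroup G) (S : G → Prop)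
    (hS : ∀ z z', z ^ N = 1 → z' ^ N = 1 → z ∉ H → z' ∉ H →
      (∃ p k : ℕ, p.Prime ∧ (z⁻¹ * z') ^ p ^ k = 1) → S z → S z')
    {z z' : G} (hz : z ^ N = 1) (hz' : z' ^ N = 1) (hzH : z ∉ H) (hzH' : z' ∉ H) (h : S z) :
    S z' := by
  have hS' : ∀ z z', z ^ N = 1 → z' ^ N = 1 → z ∉ H → z' ∉ H →
      (∃ p k : ℕ, p.Prime ∧ (z⁻¹ * z') ^ p ^ k = 1) → (S z ↔ S z') := by
    rintro z z' h1 h2 h3 h4 ⟨p, k, hp, hk⟩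
    refine ⟨hS z z' h1 h2 h3 h4 ⟨p, k, hp, hk⟩, hS z' z h2 h1 h4 h3 ⟨p, k, hp, ?_⟩⟩
    rw [← inv_inj, ← inv_pow, mul_inv_rev, inv_inv, hk, inv_one]
  -- Every `z ∉ H` is linked to an element of prime power order. Split off the `p`-part: `z = x y`.
  -- If `y ∉ H`, pass to `y`. If `y ∈ H`, remove from `z` another primary part `s` of `y`; being a
  -- power of `y` it lies in `H`, so the walk stays outside `H`.
  have key : ∀ n : ℕ, 0 < n → ∀ z : G, z ^ n = 1 → z ^ N = 1 → z ∉ H →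
      ∃ t, t ^ N = 1 ∧ t ∉ H ∧ (∃ p k : ℕ, p.Prime ∧ t ^ p ^ k = 1) ∧ (S z ↔ S t) := by
    intro n
    induction n using Nat.strong_induction_on with
    | _ n ih =>
    intro hn z hzn hzN hzH
    have hn1 : n ≠ 1 := by
      rintro rfl
      rw [pow_one] at hzn
      exact hzH (hzn ▸ one_mem H)
    have hp := Nat.minFac_prime hn1
    set p := n.minFac with hpdef
    obtain ⟨k, a, ha, hna⟩ := Nat.exists_eq_pow_mul_and_not_dvd hn.ne' p hp.ne_one
    have hk : k ≠ 0 := by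
      rintro rfl
      rw [pow_zero, one_mul] at hna
      exact ha (hna ▸ n.minFac_dvd)
    have ha0 : 0 < a := Nat.pos_of_ne_zero fun h => ha (h ▸ dvd_zero p)
    have hpk : 1 < p ^ k := Nat.one_lt_pow hk hp.one_lt
    by_cases ha1 : a = 1
    · exact ⟨z, hzN, hzH, ⟨p, k, hp, by rw [← hzn, hna, ha1, mul_one]⟩, Iff.rfl⟩
    have hcop : (p ^ k).Coprime a := Nat.Coprime.pow_left k ((Nat.Prime.coprime_iff_not_dvd hp).2 ha)
    obtain ⟨x, y, hxy, hx, hy, hxz, hyz⟩ := exists_eq_mul_of_pow_mul_eq_one hcop (hna ▸ hzn)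
    have hpowN : ∀ w : G, ∀ u ∈ Subgroup.zpowers w, w ^ N = 1 → u ^ N = 1 := by
      rintro w _ ⟨j, rfl⟩ hw
      rw [← zpow_natCast, ← zpow_mul, mul_comm, zpow_mul, zpow_natCast, hw, one_zpow]
    have hyN := hpowN z y hyz hzN
    by_cases hyH : y ∈ H
    · have hq := Nat.minFac_prime ha1
      set q := a.minFac with hqdef
      obtain ⟨l, c, hc, hac⟩ := Nat.exists_eq_pow_mul_and_not_dvd ha0.ne' q hq.ne_one
      have hl : l ≠ 0 := by
        rintro rfl
        rw [pow_zero, one_mul] at hac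
        exact hc (hac ▸ a.minFac_dvd)
      have hc0 : 0 < c := Nat.pos_of_ne_zero fun h => hc (h ▸ dvd_zero q)
      have hql : 1 < q ^ l := Nat.one_lt_pow hl hq.one_lt
      have hcop' : (q ^ l).Coprime c :=
        Nat.Coprime.pow_left l ((Nat.Prime.coprime_iff_not_dvd hq).2 hc)
      obtain ⟨s, t, hst, hs, ht, hsy, -⟩ := exists_eq_mul_of_pow_mul_eq_one hcop' (hac ▸ hy)
      have hsH : s ∈ H := (Subgroup.zpowers_le.2 hyH) hsy
      have hsN := hpowN y s hsy hyN
      have hz' : z * s⁻¹ ∉ H := fun h => hzH (by simpa using mul_mem h hsH)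
      have hz'N : (z * s⁻¹) ^ N = 1 := by rw [mul_pow, inv_pow, hzN, hsN]; simp
      have hz'n : (z * s⁻¹) ^ (p ^ k * c) = 1 := by
        have : z * s⁻¹ = x * t := by rw [hxy, hst]; rw [mul_comm s t]; group
        rw [this, mul_pow, pow_mul, hx, one_pow, one_mul, mul_comm, pow_mul, ht, one_pow]
      have hlt : p ^ k * c < n := by
        rw [hna, hac]
        exact Nat.mul_lt_mul_of_pos_left (by nlinarith) (by positivity)
      obtain ⟨t', h1, h2, h3, h4⟩ := ih _ hlt (by positivity) _ hz'n hz'N hz'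
      refine ⟨t', h1, h2, h3, Iff.trans (hS' _ _ hzN hz'N hzH hz' ⟨q, l, hq, ?_⟩) h4⟩
      rw [inv_mul_cancel_left, inv_pow, hs, inv_one]
    · have hlt : a < n := by
        rw [hna]
        nlinarith
      obtain ⟨t', h1, h2, h3, h4⟩ := ih _ hlt ha0 _ hy hyN hyH
      refine ⟨t', h1, h2, h3, Iff.trans (hS' _ _ hzN hyN hzH hyH ⟨p, k, hp, ?_⟩) h4⟩
      rw [hxy, mul_inv_rev, mul_right_comm, inv_mul_cancel, one_mul, inv_pow, hx, inv_one]
  obtain ⟨t, htN, htH, ⟨p, k, hp, ht⟩, hzt⟩ := key N hN z hz hz hzH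
  obtain ⟨t', htN', htH', ⟨q, l, hq, ht'⟩, hzt'⟩ := key N hN z' hz' hz' hzH'
  rw [hzt']
  rw [hzt] at h
  by_cases hpq : p = q
  · subst hpq
    refine hS _ _ htN htN' htH htH' ⟨p, k + l, hp, ?_⟩ h
    rw [mul_pow, inv_pow, pow_add, pow_mul, ht, pow_mul', ht']
    simp
  -- For different primes the walk passes through `t t'`. Were it in `H`, then `t ^ q ^ l ∈ H`
  -- together with `t ^ p ^ k = 1` would give `t ∈ H`.
  · have hmem : t * t' ∉ H := by
      intro hmem
      refine htH (mem_of_pow_mem_of_pow_mem (m := p ^ k) (n := q ^ l) ?_ ?_ ?_)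
      · exact Nat.Coprime.pow _ _ ((Nat.coprime_primes hp hq).2 hpq)
      · rw [ht]
        exact one_mem H
      · have := pow_mem hmem (q ^ l)
        rwa [mul_pow, ht', mul_one] at this
    have hN' : (t * t') ^ N = 1 := by rw [mul_pow, htN, htN', one_mul]
    have h1 : S (t * t') := hS _ _ htN hN' htH hmem ⟨q, l, hq, by rw [inv_mul_cancel_left, ht']⟩ h
    refine hS _ _ hN' htN' hmem htH' ⟨p, k, hp, ?_⟩ h1
    rw [mul_inv_rev, mul_right_comm, inv_mul_cancel, one_mul, inv_pow, ht, inv_one]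

lemma zpow_two_mul_ne_one {z : G} {d e n : ℤ} (he : z ^ (2 * e) = 1) (hd : z ^ (2 * d) ≠ 1)
    (hn : (Int.gcd n e : ℤ) ∣ d) : z ^ (2 * n) ≠ 1 := by
  intro h
  obtain ⟨k, rfl⟩ := hn
  apply hd
  rw [Int.gcd_eq_gcd_ab, show 2 * ((n * Int.gcdA n e + e * Int.gcdB n e) * k) =
    2 * n * (Int.gcdA n e * k) + 2 * e * (Int.gcdB n e * k) by ring, zpow_add, zpow_mul z (2 * n), h,
    zpow_mul z (2 * e), he, one_zpow, one_zpow, one_mul]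

end Groups

section AntisymmPow

variable {B : Type*} [CommRing B]

lemma Units.antisymmPow_neg (z : Bˣ) (n : ℤ) : z.antisymmPow (-n) = -z.antisymmPow n := by
  simp [antisymmPow]

/-- The quotient is built from powers of `z` and so stays in any subring containing them; the
integral closure is the intended one. -/
lemma Units.exists_antisymmPow_mul (S : Subring B) {z : Bˣ} (hz : ∀ n : ℤ, ((z ^ n : Bˣ) : B) ∈ S)
    (n k : ℤ) : ∃ y ∈ S, z.antisymmPow (n * k) = z.antisymmPow n * y := by
  have key : ∀ k : ℕ, ∃ y ∈ S, z.antisymmPow (n * k) = z.antisymmPow n * y := by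
    intro k
    induction k with
    | zero => exact ⟨0, zero_mem S, by simp [antisymmPow]⟩
    | succ k ih =>
      obtain ⟨y, hy, h⟩ := ih
      refine ⟨y * ((z ^ n : Bˣ) : B) + ((z ^ (-(n * k)) : Bˣ) : B),
        add_mem (mul_mem hy (hz _)) (hz _), ?_⟩
      rw [mul_add, ← mul_assoc, ← h]
      simp only [antisymmPow, sub_mul, ← Units.val_mul, ← zpow_add]
      push_cast
      rw [show -(n * (k : ℤ)) + n = n + -(n * k) by ring,
        show n * (k : ℤ) + n = n * (k + 1) by ring,
        show -n + -(n * (k : ℤ)) = -(n * (k + 1)) by ring]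
      ring
  obtain ⟨m, rfl | rfl⟩ := k.eq_nat_or_neg
  · exact key m
  · obtain ⟨y, hy, h⟩ := key m
    exact ⟨-y, neg_mem hy, by rw [mul_neg, antisymmPow_neg, h, mul_neg]⟩

/-- For roots of unity `z` of order dividing `2e`, the value `z ^ n - z ^ (-n)` depends up to
divisibility only on the greatest common divisor of `n` and `e`. -/
lemma Units.antisymmPow_dvd_of_gcd (S : Subring B) {z : Bˣ} (hz : ∀ n : ℤ, ((z ^ n : Bˣ) : B) ∈ S)
    {n e : ℤ} (he : z ^ (2 * e) = 1) :
    ∃ y ∈ S, z.antisymmPow (Int.gcd n e) = z.antisymmPow n * y := by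
  obtain ⟨y, hy, h⟩ := exists_antisymmPow_mul S hz n (Int.gcdA n e)
  refine ⟨y * ((z ^ (e * Int.gcdB n e) : Bˣ) : B), mul_mem hy (hz _), ?_⟩
  -- Since `z ^ (2 * e) = 1`, the power `z ^ (e * gcdB)` is its own inverse and factors out of the
  -- antisymmetric difference in Bézout's identity.
  have h2 : z ^ (-(e * Int.gcdB n e)) = z ^ (e * Int.gcdB n e) := by
    rw [zpow_neg, inv_eq_iff_mul_eq_one, ← zpow_add, ← two_mul, ← mul_assoc, zpow_mul, he,
      one_zpow]
  rw [← mul_assoc, ← h, Int.gcd_eq_gcd_ab]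
  simp only [antisymmPow, neg_add, zpow_add, h2, Units.val_mul, sub_mul]

lemma Units.antisymmPow_add_mul {z : Bˣ} {e : ℤ} (he : z ^ (2 * e) = 1) (n k : ℤ) :
    z.antisymmPow (n + 2 * e * k) = z.antisymmPow n := by
  simp only [antisymmPow, neg_add, zpow_add, ← mul_neg, zpow_mul (n := k), zpow_mul (n := -k), he,
    one_zpow, mul_one]

end AntisymmPow

section DualNumbers

open TrivSqZeroExt

variable {K : Type*} [Field K]

/-- The unit `z (1 + ε)` of the dual numbers. -/
def DualNumber.tangentUnit (z : Kˣ) : (DualNumber K)ˣ where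
  val := inl (z : K) + inr (z : K)
  inv := inl (z⁻¹ : K) - inr (z⁻¹ : K)
  val_inv := by ext <;> simp
  inv_val := by ext <;> simp

lemma DualNumber.tangentUnit_zpow (z : Kˣ) (n : ℤ) :
    ((DualNumber.tangentUnit z ^ n : (DualNumber K)ˣ) : DualNumber K) =
      inl ((z ^ n : Kˣ) : K) + inr (n * ((z ^ n : Kˣ) : K)) := by
  have hval : ((tangentUnit z : (DualNumber K)ˣ) : DualNumber K) = inl (z : K) + inr (z : K) := rfl
  have hinv : (((tangentUnit z)⁻¹ : (DualNumber K)ˣ) : DualNumber K) =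
    inl (z⁻¹ : K) - inr (z⁻¹ : K) := rfl
  induction n using Int.induction_on with
  | zero => simp
  | succ n ih =>
    rw [zpow_add_one, Units.val_mul, ih, hval]
    ext
    · simp [zpow_add_one₀]
    · simp [zpow_add_one₀]
      ring
  | pred n ih =>
    rw [zpow_sub_one, Units.val_mul, ih, hinv]
    ext
    · simp [zpow_sub_one₀]
    · simp [zpow_sub_one₀]
      ring

lemma DualNumber.mul_eq_zero_of_fst {x y : DualNumber K} (hx : x.fst = 0) (hy : y.fst = 0) :
    x * y = 0 := by
  ext <;> simp [hx, hy]

/-- Evaluation at `z (1 + ε)` records the first derivative, so this says that `z^n - z^(-n)` has no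
multiple zeros: the `ε`-part of `z^(2n) (1 + ε)^(2n)` is `2n z^(2n) ≠ 0`. -/
lemma DualNumber.antisymmPow_tangentUnit_ne_zero [CharZero K] (z : Kˣ) {n : ℤ} (hn : n ≠ 0) :
    (DualNumber.tangentUnit z).antisymmPow n ≠ 0 := by
  rw [Ne, Units.antisymmPow_eq_zero_iff]
  intro h
  have h1 := congrArg (fun u : (DualNumber K)ˣ => (u : DualNumber K).snd) h
  simp only [DualNumber.tangentUnit_zpow] at h1
  simp only [snd_add, snd_inl, snd_inr, zero_add, Units.val_one, snd_one, mul_eq_zero] at h1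
  rcases h1 with h1 | h1
  · exact hn (by exact_mod_cast (by simpa using h1 : (n : K) = 0))
  · exact Units.ne_zero _ h1

end DualNumbers

section Integrality

variable {A K : Type*} [CommRing A] [Field K] [Algebra A K]

lemma isIntegral_of_pow_eq_one {x : K} {n : ℕ} (hn : 0 < n) (h : x ^ n = 1) : IsIntegral A x :=
  IsIntegral.of_pow hn (h ▸ isIntegral_one)

lemma isIntegral_zpow_of_zpow_eq_one {z : Kˣ} {n : ℤ} (hn : n ≠ 0) (h : z ^ n = 1) (k : ℤ) :
    IsIntegral A ((z ^ k : Kˣ) : K) := by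
  have h1 : z ^ n.natAbs = 1 := by
    rcases n.natAbs_eq with h' | h'
    · rwa [h', zpow_natCast] at h
    · rwa [h', zpow_neg, inv_eq_one, zpow_natCast] at h
  refine isIntegral_of_pow_eq_one (n := n.natAbs) (by omega) ?_
  rw [← Units.val_pow_eq_pow_val, ← zpow_natCast, ← zpow_mul, mul_comm, zpow_mul, zpow_natCast, h1]
  simp

/-- A prime which is not a unit in `A` has no multiple by an integral element equal to a unit:
if `1 - ξ` divides `1` for a root of unity `ξ` of `p`-power order, then `p` is a unit. -/
lemma isUnit_natCast_of_one_sub_mul [FaithfulSMul A K] {p k : ℕ} (hp : p.Prime) {ξ r : K}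
    (hξ : ξ ^ p ^ k = 1) (hr : IsIntegral A r) (h : (1 - ξ) * r = 1) : IsUnit (p : A) := by
  have hξ' : IsIntegral A ξ := isIntegral_of_pow_eq_one (pow_pos hp.pos k) hξ
  let x : integralClosure A K := ⟨ξ, hξ'⟩
  let s : integralClosure A K := ⟨r, hr⟩
  have hx : x ^ p ^ k = 1 := Subtype.ext hξ
  have hxs : (1 - x) * s = 1 := Subtype.ext h
  -- Expanding `((1 - x) + x) ^ p ^ k` modulo `p` shows that `p` divides `(1 - x) ^ p ^ k`.
  obtain ⟨t, ht⟩ := exists_add_pow_prime_pow_eq hp (1 - x) x k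
  rw [sub_add_cancel, one_pow, hx] at ht
  have h1 : (1 : integralClosure A K) = p * (-((1 - x) * x * t) * s ^ p ^ k) := by
    have h2 : (1 - x) ^ p ^ k = p * (-((1 - x) * x * t)) := by linear_combination -ht
    rw [← mul_assoc, ← h2, ← mul_pow, hxs, one_pow]
  have h3 : IsUnit (algebraMap A (integralClosure A K) p) := by
    rw [map_natCast]
    exact IsUnit.of_mul_eq_one _ h1.symm
  have : FaithfulSMul A (integralClosure A K) := by
    rw [faithfulSMul_iff_algebraMap_injective]
    intro a b hab
    exact FaithfulSMul.algebraMap_injective A K (congrArg Subtype.val hab)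
  -- An element of `A` that is invertible in an integral extension is already invertible in `A`.
  exact h3.of_map (algebraMap A (integralClosure A K)) _

end Integrality

section Polynomials

open Polynomial

/-- Having no root except possibly `0`, the polynomial splits as a constant times a power of `X`. -/
lemma Polynomial.natDegree_eq_of_coeff_ne_zero_of_no_root {K : Type*} [Field K] [IsAlgClosed K]
    {p : K[X]} (hp : ∀ x : K, x ≠ 0 → p.eval x ≠ 0) {n : ℕ} (hn : p.coeff n ≠ 0) :
    n = p.natDegree := by
  have h := (IsAlgClosed.splits p).eq_prod_roots
  have hroots : p.roots = Multiset.replicate (Multiset.card p.roots) 0 := by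
    refine Multiset.eq_replicate_card.2 fun x hx => ?_
    by_contra hx0
    exact hp x hx0 (isRoot_of_mem_roots hx)
  rw [hroots] at h
  simp only [Multiset.map_replicate, map_zero, sub_zero, Multiset.prod_replicate] at h
  have hlead : p.leadingCoeff ≠ 0 := by
    rw [leadingCoeff_ne_zero]
    rintro rfl
    simp at hn
  have hdeg : p.natDegree = Multiset.card p.roots := by
    conv_lhs => rw [h]
    exact natDegree_C_mul_X_pow _ _ hlead
  rw [h, coeff_C_mul, coeff_X_pow] at hn
  rw [hdeg]
  by_contra hne
  rw [if_neg hne, mul_zero] at hn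
  exact hn rfl

end Polynomials

/-! ### Zeros of the leading values -/

namespace RootPairing.Base

open AddMonoidAlgebra

variable {ι M N : Type*} [Finite ι] [AddCommGroup M] [Module ℝ M] [AddCommGroup N] [Module ℝ N]
  {R : RootPairing ι ℝ M N} [R.IsRootSystem] [R.IsCrystallographic] [R.IsReduced] {b : R.Base}

lemma dvd_weightCoeffHom_weylAct {n : ℤ} {x : R.weightLattice}
    (h : ∀ i ∈ b.support, n ∣ R.weightCoeff i x) (w : R.weylGroup) (i : ι) :
    n ∣ R.weightCoeffHom i (R.weylAct w x) := by
  have h1 := R.weightCoeffHom_perm_weylAct w (R.weylGroupToPerm w⁻¹ i) x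
  rw [← Equiv.Perm.mul_apply, ← map_mul, mul_inv_cancel, map_one, Equiv.Perm.one_apply] at h1
  rw [h1]
  exact b.dvd_weightCoeff h _

lemma zpow_neg_eq_of_dvd {G : Type*} [Group G] {z : G} {e n : ℤ} (hz : z ^ (2 * e) = 1)
    (h : e ∣ n) : z ^ (-n) = z ^ n := by
  obtain ⟨k, rfl⟩ := h
  rw [zpow_neg, inv_eq_iff_mul_eq_one, ← zpow_add, ← two_mul, ← mul_assoc, zpow_mul, hz, one_zpow]

lemma antisymmPow_eq_zero_of_dvd {B : Type*} [CommRing B] {z : Bˣ} {e n : ℤ}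
    (hz : z ^ (2 * e) = 1) (h : e ∣ n) : z.antisymmPow n = 0 := by
  rw [Units.antisymmPow, zpow_neg_eq_of_dvd hz h, sub_self]

lemma lexHom_simpleRefl (α β : b.support) (x : R.weightLattice) :
    b.lexHom α {β} (R.weylAct (R.simpleRefl β) x) = b.lexHom α {β} x :=
  lexHom_eq_iff_exists.2 ⟨_, R.simpleRefl_smul β (x : M)⟩

/-- All orbit points of `x` pair with `β` in multiples of `e`. So `s_β` does not change their
characters, and the terms of `w` and `s_β w` cancel. -/
lemma twist_schurWeyl_eq_zero_of_dvd {A B : Type*} [CommRing A] [CommRing B] [Algebra A B]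
    {e : ℤ} {x : R.weightLattice} (hx : ∀ i ∈ b.support, e ∣ R.weightCoeff i x) (α β : b.support)
    {z : Bˣ} (hz : z ^ (2 * e) = 1) :
    twist (powChar z (R.weightCoeffHom β)) (b.lexHom α {β}) (R.schurWeyl A x) = 0 := by
  refine R.twist_schurWeyl_eq_zero β (fun w => ?_) (lexHom_simpleRefl α β)
  rw [powChar_apply, powChar_apply, weightCoeffHom_simpleRefl,
    zpow_neg_eq_of_dvd hz (dvd_weightCoeffHom_weylAct hx w β)]

variable {A K : Type*} [CommRing A] [Field K] [CharZero K] [Algebra A K] {α β : b.support}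

section Factorization

variable {d : ℕ} {x y y' : R.weightLattice} {U V : AddMonoidAlgebra A R.weightLattice}

lemma fst_leadingValue_tangentUnit (z : Kˣ) (F : AddMonoidAlgebra A R.weightLattice) :
    (b.leadingValue α β (DualNumber.tangentUnit z) F y).fst = b.leadingValue α β z F y := by
  have h := map_leadingValue (α := α) (TrivSqZeroExt.fstHom A K K) β (DualNumber.tangentUnit z) F y
  have hz : Units.map ((TrivSqZeroExt.fstHom A K K : DualNumber K →ₐ[A] K) : DualNumber K →* K)
      (DualNumber.tangentUnit z) = z := by
    ext
    simp [DualNumber.tangentUnit]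
  rw [hz] at h
  exact h

variable [Nontrivial A] (hd : 0 < d) (hx : b.DominantRegular x)
  (h : U * V * R.schurWeyl A (d • b.rho) = R.schurWeyl A x)
  (hU : b.IsLeading α U y) (hV : b.IsLeading α V y') (hsum : y + y' + d • b.rho = x)
include hd hx h hU hV hsum

/-- The zeros of the leading values of the factors of `S(x)` are simple and distinct. -/
lemma leadingValue_ne_zero_of_eq_zero {z : Kˣ} (hz : b.leadingValue α β z U y = 0) :
    b.leadingValue α β z V y' ≠ 0 ∧ z.antisymmPow d ≠ 0 := by
  have hx0 : R.weightCoeffHom β x ≠ 0 := (hx β β.2).ne'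
  -- The product formula is evaluated at `z (1 + ε)`. Two factors vanishing at `z` would make the
  -- product zero, but the right side is not.
  have hmul := leadingValue_mul hd hx h hU hV hsum β (DualNumber.tangentUnit z)
  have hne := DualNumber.antisymmPow_tangentUnit_ne_zero z hx0
  rw [← hmul] at hne
  have hfst := fst_leadingValue_tangentUnit (b := b) (α := α) (β := β) (y := y) z U
  rw [hz] at hfst
  constructor
  · intro hz'
    have hfst' := fst_leadingValue_tangentUnit (b := b) (α := α) (β := β) (y := y') z V
    rw [hz'] at hfst'
    rw [DualNumber.mul_eq_zero_of_fst hfst hfst', zero_mul] at hne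
    exact hne rfl
  · intro hz'
    have hz'' : ((DualNumber.tangentUnit z).antisymmPow (d : ℤ)).fst = 0 := by
      rw [← hz']
      simp only [Units.antisymmPow, DualNumber.tangentUnit_zpow]
      simp
    rw [mul_right_comm, DualNumber.mul_eq_zero_of_fst hfst hz'', zero_mul] at hne
    exact hne rfl

/-- If the leading value of the factor `V` of `S(x)` does not vanish, then `U` vanishes. -/
lemma vanishesAt_of_leadingValue_ne_zero {e : ℤ} (hex : ∀ i ∈ b.support, e ∣ R.weightCoeff i x)
    {z : Kˣ} (hze : z ^ (2 * e) = 1) (hzd : z.antisymmPow d ≠ 0)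
    (hz : b.leadingValue α β z V y' ≠ 0) : R.VanishesAt (β : ι) z U := by
  -- The twist of `S(x)` is zero in a domain, while neither `S(dρ)` nor `V` twists to zero.
  have h0 := twist_schurWeyl_eq_zero_of_dvd (A := A) hex α β hze
  rw [← h, map_mul, map_mul] at h0
  have hρ : twist (powChar z (R.weightCoeffHom β)) (b.lexHom α {β})
      (R.schurWeyl A (d • b.rho)) ≠ 0 := by
    intro h1
    have h2 := b.coeff_twist_schurWeyl_singleton (A := A) (b.dominantRegular_smul_rho hd) α β 1 z
    rw [weylAct_one, h1, weylSign_one, b.weightCoeffHom_smul_rho, Int.cast_one, one_mul] at h2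
    exact hzd h2.symm
  have hV0 : twist (powChar z (R.weightCoeffHom β)) (b.lexHom α {β}) V ≠ 0 := by
    intro h1
    rw [leadingValue, h1] at hz
    exact hz rfl
  rw [vanishesAt_iff (α := α)]
  exact (mul_eq_zero.1 ((mul_eq_zero.1 h0).resolve_right hρ)).resolve_right hV0

lemma leadingValue_eq_zero_or {z : Kˣ} (hzx : z ^ (2 * R.weightCoeffHom β x) = 1)
    (hzd : z.antisymmPow d ≠ 0) :
    b.leadingValue α β z U y = 0 ∨ b.leadingValue α β z V y' = 0 := by
  have hmul := leadingValue_mul hd hx h hU hV hsum β z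
  rw [Units.antisymmPow_eq_zero_iff.2 hzx] at hmul
  exact mul_eq_zero.1 ((mul_eq_zero.1 hmul).resolve_right hzd)

lemma zpow_eq_one_of_leadingValue_eq_zero {z : Kˣ} (hz : b.leadingValue α β z U y = 0) :
    z ^ (2 * R.weightCoeffHom β x) = 1 := by
  have hmul := leadingValue_mul hd hx h hU hV hsum β z
  rw [hz, zero_mul, zero_mul] at hmul
  exact Units.antisymmPow_eq_zero_iff.1 hmul.symm

end Factorization

section LeadingValue

variable {y : R.weightLattice} {F : AddMonoidAlgebra A R.weightLattice}

lemma leadingValue_eq_sum [DecidableEq R.weightLattice]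
    [DecidableEq (Lex (Fin (Fintype.card b.support + 1) → ℝ))] (z : Kˣ) :
    b.leadingValue α β z F y =
      ∑ p ∈ F.coeff.support with b.lexHom α {β} p = b.lexHom α {β} y,
        F.coeff p • ((z ^ R.weightCoeffHom β p : Kˣ) : K) := by
  rw [leadingValue, coeff_twist]
  rfl

/-- A leading value without zeros is a monomial. -/
lemma weightCoeffHom_eq_zero_of_leadingValue_ne_zero [IsAlgClosed K] [FaithfulSMul A K]
    (hF : F ∈ R.weylInvariants A) (hy : F.coeff y ≠ 0)
    (h : ∀ z : Kˣ, b.leadingValue α β z F y ≠ 0) : R.weightCoeffHom β y = 0 := by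
  classical
  let T := F.coeff.support.filter fun p => b.lexHom α {β} p = b.lexHom α {β} y
  let f := R.weightCoeffHom (β : ι)
  let n : ℕ := ∑ p ∈ T, (f p).natAbs
  have hn : ∀ p ∈ T, 0 ≤ f p + n := by
    intro p hp
    have h1 : (f p).natAbs ≤ n :=
      Finset.single_le_sum (f := fun p => (f p).natAbs) (fun _ _ => Nat.zero_le _) hp
    omega
  -- Within one class modulo `β` the pairing with `β` determines the weight, so no two exponents of
  -- the Laurent polynomial collide. Shifting by `n` turns it into a polynomial.
  have hinj : ∀ p ∈ T, ∀ q ∈ T, f p = f q → p = q := by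
    intro p hp q hq hpq
    have h1 : b.lexHom α {β} p = b.lexHom α {β} q :=
      ((Finset.mem_filter.1 hp).2).trans (Finset.mem_filter.1 hq).2.symm
    obtain ⟨t, ht⟩ := lexHom_eq_iff_exists.1 h1
    have h2 := congrArg (R.coroot' β) ht
    rw [map_sub, (R.coroot' β).map_smul, R.root_coroot'_eq_pairing, R.pairing_same,
      ← weightCoeffHom_cast, ← weightCoeffHom_cast, show R.weightCoeffHom β p =
      R.weightCoeffHom β q from hpq, smul_eq_mul] at h2
    have ht0 : t = 0 := by linarith
    rw [ht0, zero_smul, sub_zero] at ht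
    exact Subtype.ext ht
  let P : Polynomial K := ∑ p ∈ T, Polynomial.monomial (f p + n).toNat (algebraMap A K (F.coeff p))
  have hroot : ∀ x : K, x ≠ 0 → P.eval x ≠ 0 := by
    intro x hx h0
    apply h (Units.mk0 x hx)
    have h1 : P.eval x = x ^ n * b.leadingValue α β (Units.mk0 x hx) F y := by
      rw [leadingValue_eq_sum, Finset.mul_sum, Polynomial.eval_finsetSum]
      refine Finset.sum_congr rfl fun p hp => ?_
      have h2 : x ^ (f p + n).toNat = x ^ n * x ^ f p := by
        rw [← zpow_natCast, Int.toNat_of_nonneg (hn p hp), zpow_add₀ hx, zpow_natCast, mul_comm]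
      rw [Polynomial.eval_monomial, h2, Algebra.smul_def]
      simp only [Units.val_zpow_eq_zpow_val, Units.val_mk0]
      change _ = x ^ n * (_ * x ^ f p)
      ring
    rw [h0] at h1
    exact (mul_eq_zero.1 h1.symm).resolve_left (pow_ne_zero _ hx)
  have hcoeff : ∀ p ∈ T, P.coeff (f p + n).toNat ≠ 0 := by
    intro p hp
    rw [Polynomial.finsetSum_coeff, Finset.sum_eq_single_of_mem p hp]
    · rw [Polynomial.coeff_monomial, if_pos rfl]
      have := Finsupp.mem_support_iff.1 (Finset.mem_filter.1 hp).1
      exact fun h0 => this (FaithfulSMul.algebraMap_injective A K (h0.trans (map_zero _).symm))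
    · intro q hq hqp
      rw [Polynomial.coeff_monomial, if_neg]
      intro heq
      refine hqp (hinj q hq p hp ?_)
      have := hn p hp
      have := hn q hq
      omega
  have hyT : y ∈ T := Finset.mem_filter.2 ⟨Finsupp.mem_support_iff.2 hy, rfl⟩
  -- By invariance `s_β y` also occurs, with the opposite exponent. A monomial has only one
  -- exponent, so it equals its negative.
  have hyT' : R.weylAct (R.simpleRefl β) y ∈ T := by
    refine Finset.mem_filter.2 ⟨Finsupp.mem_support_iff.2 ?_, lexHom_simpleRefl α β y⟩
    rwa [R.coeff_weylAct hF]
  have h1 := Polynomial.natDegree_eq_of_coeff_ne_zero_of_no_root hroot (hcoeff y hyT)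
  have h2 := Polynomial.natDegree_eq_of_coeff_ne_zero_of_no_root hroot (hcoeff _ hyT')
  have h3 := hn _ hyT
  have h4 := hn _ hyT'
  have h5 : f (R.weylAct (R.simpleRefl β) y) = -f y := R.weightCoeffHom_simpleRefl β y
  rw [h5] at h2 h4
  have : f y = 0 := by omega
  exact this

/-- The leading values at two roots of unity differ by a multiple of `1 - ξ`, where `ξ` is the
quotient. -/
lemma exists_leadingValue_sub_eq {z ξ : Kˣ} {n : ℤ} (hn : n ≠ 0) (hz : z ^ n = 1)
    (hξ : ξ ^ n = 1) : ∃ r, IsIntegral A r ∧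
      b.leadingValue α β z F y - b.leadingValue α β (z * ξ) F y = (1 - (ξ : K)) * r := by
  classical
  have key : ∀ k : ℤ, ∃ r, IsIntegral A r ∧ 1 - ((ξ ^ k : Kˣ) : K) = (1 - (ξ : K)) * r := by
    have hnat : ∀ k : ℕ, ∃ r, IsIntegral A r ∧ 1 - (ξ : K) ^ k = (1 - (ξ : K)) * r := by
      intro k
      refine ⟨∑ i ∈ Finset.range k, (ξ : K) ^ i, IsIntegral.sum _ fun i _ => ?_, ?_⟩
      · have := isIntegral_zpow_of_zpow_eq_one (A := A) hn hξ i
        simpa using this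
      · rw [mul_comm, ← neg_sub (ξ : K) 1, mul_neg, geom_sum_mul, neg_sub]
    intro k
    obtain ⟨m, rfl | rfl⟩ := k.eq_nat_or_neg
    · simpa using hnat m
    · obtain ⟨r, hr, h⟩ := hnat m
      refine ⟨-((ξ ^ (-(m : ℤ)) : Kˣ) : K) * r,
        ((isIntegral_zpow_of_zpow_eq_one (A := A) hn hξ _).neg).mul hr, ?_⟩
      have h0 : (ξ : K) ^ m ≠ 0 := pow_ne_zero _ ξ.ne_zero
      have h1 : ((ξ ^ (-(m : ℤ)) : Kˣ) : K) * (ξ : K) ^ m = 1 := by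
        simp [h0]
      linear_combination (-((ξ ^ (-(m : ℤ)) : Kˣ) : K)) * h - h1
  choose r hr hr' using key
  rw [leadingValue_eq_sum, leadingValue_eq_sum, ← Finset.sum_sub_distrib]
  refine ⟨∑ p ∈ F.coeff.support with b.lexHom α {β} p = b.lexHom α {β} y,
    F.coeff p • (((z ^ R.weightCoeffHom β p : Kˣ) : K) * r (R.weightCoeffHom β p)),
    IsIntegral.sum _ fun p _ => ((isIntegral_zpow_of_zpow_eq_one hn hz _).mul (hr _)).smul _, ?_⟩
  rw [Finset.mul_sum]
  refine Finset.sum_congr rfl fun p _ => ?_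
  rw [mul_zpow, Units.val_mul, ← smul_sub, mul_smul_comm]
  congr 1
  linear_combination ((z ^ R.weightCoeffHom β p : Kˣ) : K) * hr' (R.weightCoeffHom β p)

end LeadingValue

end RootPairing.Base

lemma Int.gcd_eq_gcd_of_dvd_sub {n m e : ℤ} (h : e ∣ n - m) : Int.gcd n e = Int.gcd m e := by
  obtain ⟨k, hk⟩ := h
  obtain rfl : n = m + e * k := by linarith
  simp

/-! ### The orbit of `η` modulo `e` and the top term of `S(η)` -/

namespace RootPairing.Base

open AddMonoidAlgebra

variable {ι M N : Type*} [Finite ι] [AddCommGroup M] [Module ℝ M] [AddCommGroup N] [Module ℝ N]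
  {R : RootPairing ι ℝ M N} [R.IsRootSystem] [R.IsCrystallographic] [R.IsReduced] {b : R.Base}

lemma coroot'_smul_root (w : R.weylGroup) (i j : ι) :
    R.coroot' i (w • R.root j) = ((R.pairingIn ℤ (R.weylGroupToPerm w j) i : ℤ) : ℝ) := by
  rw [← weyl_smul_root, R.root_coroot'_eq_pairing, ← R.algebraMap_pairingIn ℤ]
  simp

variable {μ η : R.weightLattice} {α : b.support} {c : ℕ}

lemma dominantRegular_add_smul_fundamentalWeight (hμ : b.DominantRegular μ)
    (hη : η = μ + c • b.fundamentalWeight α) : b.DominantRegular η := by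
  classical
  intro i hi
  have h := hμ i hi
  rw [← weightCoeffHom_apply] at h ⊢
  rw [hη, map_add, map_nsmul, b.weightCoeffHom_fundamentalWeight α ⟨i, hi⟩]
  split_ifs <;> simp <;> omega

/-- The pairings of the elements of the orbit of `η` modulo `e`. -/
lemma dvd_weightCoeffHom_sub {e : ℤ} (heμ : ∀ i ∈ b.support, e ∣ R.weightCoeff i μ)
    (hη : η = μ + c • b.fundamentalWeight α) (w : R.weylGroup) (i : ι) {n : ℤ}
    (hn : R.coroot' i (w • (b.fundamentalWeight α : M)) = n) :
    e ∣ R.weightCoeffHom i (R.weylAct w η) - n * c := by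
  have h1 : R.weightCoeffHom i (R.weylAct w (b.fundamentalWeight α)) = n := by
    rw [weightCoeffHom_eq_iff]
    exact hn
  rw [hη, map_add, map_add, map_nsmul, map_nsmul, h1, nsmul_eq_mul, mul_comm, add_sub_cancel_right]
  exact dvd_weightCoeffHom_weylAct heμ w i

variable (b) in
/-- All nonzero multiples of `c` by pairings of roots in the orbit of `α` with non-proportional
roots have greatest common divisor `d` with `e`. -/
def GcdCondition (α : b.support) (c e d : ℕ) : Prop :=
  ∀ (w : R.weylGroup) (i : ι), R.root i ≠ w • R.root α → R.root i ≠ -(w • R.root α) →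
    R.pairingIn ℤ (R.weylGroupToPerm w α) i ≠ 0 →
      Int.gcd (R.pairingIn ℤ (R.weylGroupToPerm w α) i * c) e = d

variable {A K : Type*} [CommRing A] [Field K] [CharZero K] [Algebra A K]

section Top

variable [R.IsIrreducible] {d e : ℕ} (hμ : b.DominantRegular μ)
  (heμ : ∀ i ∈ b.support, (e : ℤ) ∣ R.weightCoeff i μ)
  (hη : η = μ + c • b.fundamentalWeight α) (hce : Int.gcd c e = d) (hgood : b.GcdCondition α c e d)
include hμ heμ hη hce hgood

/-- For `β = α` the top point is `η`, with pairing congruent to `c`. For `β ≠ α`, orbit points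
keeping the `α`-coordinate of `η` come from elements fixing `ω_α`, so `e` divides their pairing with
`β` and their coefficient is zero. At the next possible `α`-coordinate the element sends `ω_α` to
`ω_α` minus a root in the orbit of `α`, and `GcdCondition` controls the pairing. -/
lemma exists_isTop_twist_schurWeyl (β : b.support) {z : Kˣ} (hze : z ^ (2 * (e : ℤ)) = 1)
    (hzd : z.antisymmPow d ≠ 0) : ∃ a n,
      (twist (powChar z (R.weightCoeffHom β)) (b.lexHom α {β}) (R.schurWeyl A η)).IsTop a ∧
      ((twist (powChar z (R.weightCoeffHom β)) (b.lexHom α {β}) (R.schurWeyl A η)).coeff a =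
        z.antisymmPow n ∨
      (twist (powChar z (R.weightCoeffHom β)) (b.lexHom α {β}) (R.schurWeyl A η)).coeff a =
        -z.antisymmPow n) ∧ Int.gcd n e = d := by
  classical
  have hηd := dominantRegular_add_smul_fundamentalWeight hμ hη
  have hηd' := b.dominantRegular_iff.1 hηd
  set χ := powChar z (R.weightCoeffHom β) with hχ
  set F := twist χ (b.lexHom α {β}) (R.schurWeyl A η) with hF
  have hzd' : z ^ (2 * (d : ℤ)) ≠ 1 := fun h => hzd (Units.antisymmPow_eq_zero_iff.2 h)
  have hcoeff : ∀ v : R.weylGroup, F.coeff (b.lexHom α {β} (R.weylAct v η)) =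
      R.weylSign v * z.antisymmPow (R.weightCoeffHom β (R.weylAct v η)) := fun v =>
    b.coeff_twist_schurWeyl_singleton hηd α β v z
  have hsign : ∀ v : R.weylGroup, (R.weylSign v : K) = 1 ∨ (R.weylSign v : K) = -1 := by
    intro v
    rcases R.weylSign_eq_or v with h | h <;> simp [h]
  have hcoeff' : ∀ v : R.weylGroup,
      F.coeff (b.lexHom α {β} (R.weylAct v η)) =
        z.antisymmPow (R.weightCoeffHom β (R.weylAct v η)) ∨
      F.coeff (b.lexHom α {β} (R.weylAct v η)) =
        -z.antisymmPow (R.weightCoeffHom β (R.weylAct v η)) := by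
    intro v
    rw [hcoeff]
    rcases hsign v with h | h <;> simp [h]
  have htop : ∀ x, F.coeff x ≠ 0 → ∃ v, b.lexHom α {β} (R.weylAct v η) = x := fun x hx =>
    R.exists_of_coeff_twist_schurWeyl_ne_zero hx
  by_cases hβ : β = α
  · refine ⟨b.lexHom α {β} (R.weylAct 1 η), R.weightCoeffHom β (R.weylAct 1 η), ?_, hcoeff' 1, ?_⟩
    · intro x hx
      obtain ⟨v, rfl⟩ := htop x hx
      rw [weylAct_one]
      exact lexHom_le fun i _ => b.coord_weylAct_le hηd v i
    · rw [← hce]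
      refine Int.gcd_eq_gcd_of_dvd_sub ?_
      have := dvd_weightCoeffHom_sub heμ hη 1 β (n := 1) (by
        rw [one_smul, hβ, b.coroot'_fundamentalWeight_self, Int.cast_one])
      rwa [one_mul] at this
  -- for orbit elements obtained from `ω_α` by subtracting a root, the pairings are controlled
  have hpair : ∀ v w : R.weylGroup,
      v • (b.fundamentalWeight α : M) = b.fundamentalWeight α - w • R.root α →
      (e : ℤ) ∣ R.weightCoeffHom β (R.weylAct v η) -
        -(R.pairingIn ℤ (R.weylGroupToPerm w α) β * c) := by
    intro v w h
    have := dvd_weightCoeffHom_sub heμ hη v β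
      (n := -R.pairingIn ℤ (R.weylGroupToPerm w α) β) (by
        rw [h, map_sub, b.coroot'_fundamentalWeight_of_ne (Ne.symm hβ), coroot'_smul_root, zero_sub,
          Int.cast_neg])
    rwa [neg_mul] at this
  have hgcd : ∀ v w : R.weylGroup,
      v • (b.fundamentalWeight α : M) = b.fundamentalWeight α - w • R.root α →
      b.coord α (w • R.root α) = 1 → R.pairingIn ℤ (R.weylGroupToPerm w α) β ≠ 0 →
      Int.gcd (R.weightCoeffHom β (R.weylAct v η)) e = d := by
    intro v w h hw h0
    have hβα : b.coord α (R.root β) = 0 := b.coord_root_of_ne (Ne.symm hβ)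
    rw [Int.gcd_eq_gcd_of_dvd_sub (hpair v w h), Int.neg_gcd]
    refine hgood w β (fun h1 => ?_) (fun h1 => ?_) h0
    · rw [← h1, hβα] at hw
      exact zero_ne_one hw
    · rw [h1, map_neg, hw] at hβα
      norm_num at hβα
  obtain ⟨-, u, w, -, -, huα, hwα, huc, -, ⟨j, hj, hneg⟩⟩ :=
    b.exists_isAdapted α {β} ⟨β, rfl⟩ (fun h => hβ h.symm)
  obtain rfl : j = β := hj
  have hu0 : F.coeff (b.lexHom α {j} (R.weylAct u η)) ≠ 0 := by
    have h1 : Int.gcd (R.weightCoeffHom j (R.weylAct u η)) e = d := by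
      refine hgcd u w huα hwα fun h0 => ?_
      rw [coroot'_smul_root, h0] at hneg
      simp at hneg
    have h2 : z.antisymmPow (R.weightCoeffHom j (R.weylAct u η)) ≠ 0 := fun h =>
      zpow_two_mul_ne_one hze hzd' (by rw [h1]) (Units.antisymmPow_eq_zero_iff.1 h)
    rcases hcoeff' u with h | h <;> rw [h]
    · exact h2
    · exact neg_ne_zero.2 h2
  obtain ⟨a, ha, ha0⟩ := exists_isTop (F := F) (by
    intro h
    rw [h] at hu0
    exact hu0 rfl)
  obtain ⟨v, rfl⟩ := htop a ha0
  refine ⟨_, R.weightCoeffHom j (R.weylAct v η), ha, hcoeff' v, ?_⟩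
  have hv0 : ¬ (e : ℤ) ∣ R.weightCoeffHom j (R.weylAct v η) := by
    intro h
    have := antisymmPow_eq_zero_of_dvd hze h
    rcases hcoeff' v with h1 | h1 <;> rw [this] at h1 <;> simp [h1] at ha0
  -- The nonzero coefficient at `u η` bounds the `α`-coordinate of the top point from below, which
  -- leaves only the two cases of the dichotomy.
  have hle := coord_le_of_lexHom_le (α := α) (J := {j})
    (fun h => hβ (Set.mem_singleton_iff.1 h).symm) (ha _ hu0)
  rw [weylAct_coe, huc, weylAct_coe] at hle
  rcases b.coord_smul_dichotomy ∅ (w := v) (by simp) (fun k _ => hηd' k) α with h1 | h1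
  · exfalso
    apply hv0
    have h2 := b.smul_fundamentalWeight_of_coord_fixed h1
    have := dvd_weightCoeffHom_sub heμ hη v j (n := 0) (by
      rw [h2, b.coroot'_fundamentalWeight_of_ne (Ne.symm hβ), Int.cast_zero])
    rwa [zero_mul, sub_zero] at this
  · have h2 := h1.2 (le_antisymm h1.1 hle)
    have hvs : ∀ y : M, b.coord α ((v * R.simpleRefl α) • y) = b.coord α y := by
      intro y
      rw [mul_smul, h2, ← mul_smul, simpleRefl_mul_self, one_smul]
    have h3 := b.smul_fundamentalWeight_of_coord_fixed hvs
    have h4 : v • (b.fundamentalWeight α : M) =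
        b.fundamentalWeight α - (v * R.simpleRefl α) • R.root α := by
      have h5 : v • (b.fundamentalWeight α : M) =
          (v * R.simpleRefl α) • R.simpleRefl α • (b.fundamentalWeight α : M) := by
        rw [← mul_smul, mul_assoc, simpleRefl_mul_self, mul_one]
      rw [h5, b.simpleRefl_fundamentalWeight_self, smul_sub, h3]
    refine hgcd v _ h4 (by rw [hvs, coord_root_self]) fun h0 => hv0 ?_
    have := hpair v _ h4
    rwa [h0, zero_mul, neg_zero, sub_zero] at this

/-- At a root of unity where `V` vanishes, the leading value of `U` is a unit of the integral
closure. -/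
lemma exists_leadingValue_mul_eq_one [IsDomain A] (hd : 0 < d) (he : 0 < e)
    {U V X Y : AddMonoidAlgebra A R.weightLattice} {y : R.weightLattice}
    (hUV : (U * X + V * Y) * R.schurWeyl A (d • b.rho) = R.schurWeyl A η)
    (hU : b.IsLeading α U y) (β : b.support) {z : Kˣ} (hze : z ^ (2 * (e : ℤ)) = 1)
    (hzd : z.antisymmPow d ≠ 0) (hV : R.VanishesAt (β : ι) z V)
    (hy : b.leadingValue α β z U y ≠ 0) :
    ∃ s, IsIntegral A s ∧ b.leadingValue α β z U y * s = 1 := by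
  obtain ⟨a, n, ha, ha', hn⟩ :=
    exists_isTop_twist_schurWeyl (A := A) hμ heμ hη hce hgood β hze hzd
  have hzd' : z ^ (2 * (d : ℤ)) ≠ 1 := fun h => hzd (Units.antisymmPow_eq_zero_iff.2 h)
  have hn0 : z.antisymmPow n ≠ 0 := fun h =>
      zpow_two_mul_ne_one hze hzd' (by rw [hn]) (Units.antisymmPow_eq_zero_iff.1 h)
  have hint : ∀ k : ℤ, IsIntegral A ((z ^ k : Kˣ) : K) :=
    isIntegral_zpow_of_zpow_eq_one (by omega) hze
  -- As `gcd(n, e) = d`, this gives `[d] = [n] r` with `r` integral.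
  obtain ⟨r, hr, hr'⟩ := Units.antisymmPow_dvd_of_gcd (integralClosure A K).toSubring hint
    (n := n) hze
  rw [hn] at hr'
  rw [vanishesAt_iff (α := α)] at hV
  have hX := congrArg (twist (powChar z (R.weightCoeffHom β)) (b.lexHom α {β})) hUV
  -- `V` twists to zero, so the twist of `U X S(dρ)` is that of `S(η)`. Its top coefficient is `u x
  -- [d] = u x r [n]` on one side and `±[n]` on the other; cancelling `[n]` inverts `u`.
  rw [map_mul, map_add, map_mul, map_mul, hV, zero_mul, add_zero] at hX
  rw [← hX] at ha ha'
  have hX0 : twist (powChar z (R.weightCoeffHom β)) (b.lexHom α {β}) X ≠ 0 := by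
    intro h
    rw [h, mul_zero, zero_mul] at ha'
    rcases ha' with h1 | h1
    · exact hn0 h1.symm
    · exact hn0 (neg_eq_zero.1 h1.symm)
  obtain ⟨a', htX, hX0'⟩ := exists_isTop hX0
  have hρ := b.dominantRegular_smul_rho hd
  have htU := (hU.2 {β}).isTop_twist (powChar z (R.weightCoeffHom β))
  have htD := (b.isMaxValue_schurWeyl (A := A) hρ α {β}).isTop_twist
    (powChar z (R.weightCoeffHom β))
  have htop := (htU.mul htX).mul htD
  have hval := coeff_mul_of_isTop (htU.mul htX) htD
  rw [coeff_mul_of_isTop htU htX] at hval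
  have hD := b.coeff_twist_schurWeyl_singleton (A := A) hρ α β 1 z
  rw [weylAct_one, weylSign_one, Int.cast_one, one_mul, b.weightCoeffHom_smul_rho] at hD
  rw [hD] at hval
  have hne := mul_ne_zero (mul_ne_zero hy hX0') hzd
  have haa' : a = _ := ha.eq_of_ne_zero htop (by
    rcases ha' with h1 | h1 <;> rw [h1]
    · exact hn0
    · exact neg_ne_zero.2 hn0) (by
    rw [hval]
    exact hne)
  rw [← haa', hr'] at hval
  set x := (twist (powChar z (R.weightCoeffHom β)) (b.lexHom α {β}) X).coeff a' with hx
  have hxint : IsIntegral A x := isIntegral_coeff_twist (fun p => hint _) _ _ _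
  have hval' : (b.leadingValue α β z U y * (x * r) = 1) ∨
      (b.leadingValue α β z U y * (x * r) = -1) := by
    rcases ha' with h1 | h1
    · left
      rw [h1] at hval
      refine mul_left_cancel₀ hn0 ?_
      rw [leadingValue]
      linear_combination -hval
    · right
      rw [h1] at hval
      refine mul_left_cancel₀ hn0 ?_
      rw [leadingValue]
      linear_combination -hval
  rcases hval' with h | h
  · exact ⟨x * r, hxint.mul hr, h⟩
  · exact ⟨-(x * r), (hxint.mul hr).neg, by rw [mul_neg, h, neg_neg]⟩

end Top

end RootPairing.Base

/-! ### The dichotomy at each simple root -/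

namespace RootPairing.Base

open AddMonoidAlgebra

variable {ι M N : Type*} [Finite ι] [AddCommGroup M] [Module ℝ M] [AddCommGroup N] [Module ℝ N]
  {R : RootPairing ι ℝ M N} [R.IsRootSystem] [R.IsCrystallographic] [R.IsReduced] {b : R.Base}
  {μ η : R.weightLattice} {α : b.support} {c d e : ℕ}
  {A : Type*} [CommRing A] [IsDomain A]

lemma sum_weylAct_eq_zero [Fintype R.weylGroup] (x : R.weightLattice) :
    ∑ w : R.weylGroup, R.weylAct w x = 0 := by
  have hinv : ∀ i, R.weylAct (R.simpleRefl i) (∑ w : R.weylGroup, R.weylAct w x) =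
      ∑ w : R.weylGroup, R.weylAct w x := by
    intro i
    rw [map_sum]
    simp_rw [← weylAct_mul]
    exact Fintype.sum_equiv (Equiv.mulLeft (R.simpleRefl i)) _ _ fun w => rfl
  refine Subtype.ext ((R.eq_zero_iff_forall_coroot'_eq_zero).2 fun i => ?_)
  have h := R.weightCoeffHom_simpleRefl i (∑ w : R.weylGroup, R.weylAct w x)
  rw [hinv] at h
  rw [← weightCoeffHom_cast]
  have : R.weightCoeffHom i (∑ w : R.weylGroup, R.weylAct w x) = 0 := by omega
  rw [this, Int.cast_zero]

/-- Weyl group invariants whose leading exponent is zero are constant. -/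
lemma eq_single_of_isLeading_zero {F : AddMonoidAlgebra A R.weightLattice}
    (hF : F ∈ R.weylInvariants A) (h : b.IsLeading α F 0) : F = single 0 (F.coeff 0) := by
  classical
  let := Fintype.ofFinite R.weylGroup
  have hsupp : ∀ p, F.coeff p ≠ 0 → p = 0 := by
    intro p hp
    -- Each Weyl orbit has sum zero. If no orbit point of an exponent exceeds `0`, all of them are
    -- `0`.
    have h1 : ∀ w ∈ (Finset.univ : Finset R.weylGroup), b.lexHom α ∅ (R.weylAct w p) ≤ 0 := by
      intro w _
      rw [← map_zero (b.lexHom α ∅)]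
      refine (h.2 ∅).1 _ ?_
      rwa [R.coeff_weylAct hF]
    have h2 : ∑ w : R.weylGroup, b.lexHom α ∅ (R.weylAct w p) = 0 := by
      rw [← map_sum, sum_weylAct_eq_zero, map_zero]
    have h3 := (Finset.sum_eq_zero_iff_of_nonpos h1).1 h2 1 (Finset.mem_univ _)
    rw [weylAct_one, ← map_zero (b.lexHom α ∅)] at h3
    exact lexHom_empty_injective h3
  ext p
  rw [coeff_single, Finsupp.single_apply]
  split_ifs with h0
  · rw [← h0]
  · by_contra hp
    exact h0 (hsupp p hp).symm

lemma isUnit_of_isLeading_zero {U : R.weylInvariants A}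
    (h : b.IsLeading α (U : AddMonoidAlgebra A R.weightLattice) 0) {v : A}
    (hv : (U : AddMonoidAlgebra A R.weightLattice).coeff 0 * v = 1) : IsUnit U := by
  have hmem : (single 0 v : AddMonoidAlgebra A R.weightLattice) ∈ R.weylInvariants A := by
    simp only [weylInvariants, Subring.mem_iInf]
    intro w
    change mapDomainRingHom A (R.weylAct w) (single 0 v) = single 0 v
    simp [mapDomainRingHom]
  refine IsUnit.of_mul_eq_one ⟨_, hmem⟩ (Subtype.ext ?_)
  change (U : AddMonoidAlgebra A R.weightLattice) * single 0 v = 1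
  rw [eq_single_of_isLeading_zero U.2 h, single_mul_single, add_zero, hv]
  rfl

variable {K : Type*} [Field K] [CharZero K] [Algebra A K] [IsAlgClosed K] [FaithfulSMul A K]
  [R.IsIrreducible]
  {U V X Y Z : AddMonoidAlgebra A R.weightLattice} {y y' : R.weightLattice}

/-- A primitive `2e`-th root of unity works, because the proper divisor `d` of `e` is not a multiple
of `e`. -/
lemma exists_zpow_eq_one_of_dvd (hde : d ∣ e) (hne : e ≠ d) (he : 0 < e) :
    ∃ z : Kˣ, z ^ (2 * (e : ℤ)) = 1 ∧ z.antisymmPow d ≠ 0 := by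
  have : NeZero ((2 * e : ℕ) : K) := ⟨by exact_mod_cast (by omega : 2 * e ≠ 0)⟩
  obtain ⟨x, hx⟩ := HasEnoughRootsOfUnity.exists_primitiveRoot K (2 * e)
  have hx0 : x ≠ 0 := hx.ne_zero (by omega)
  refine ⟨Units.mk0 x hx0, Units.ext ?_, fun h => ?_⟩
  · rw [Units.val_zpow_eq_zpow_val, Units.val_mk0, Units.val_one]
    have := hx.pow_eq_one
    exact_mod_cast this
  · have h1 := congrArg Units.val (Units.antisymmPow_eq_zero_iff.1 h)
    rw [Units.val_zpow_eq_zpow_val, Units.val_mk0, Units.val_one] at h1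
    have h2 : x ^ (2 * d) = 1 := by exact_mod_cast h1
    have h3 := hx.dvd_of_pow_eq_one _ h2
    have h4 : e ∣ d := (Nat.mul_dvd_mul_iff_left two_pos).1 h3
    exact hne (Nat.dvd_antisymm h4 hde)

section Dichotomy

variable (hd : 0 < d) (he : 0 < e) (hμ : b.DominantRegular μ)
  (heμ : ∀ i ∈ b.support, (e : ℤ) ∣ R.weightCoeff i μ)
  (hη : η = μ + c • b.fundamentalWeight α) (hce : Int.gcd c e = d) (hgood : b.GcdCondition α c e d)
  (hUV : U * V * R.schurWeyl A (d • b.rho) = R.schurWeyl A μ)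
  (hVZ : V * Z * R.schurWeyl A (d • b.rho) = R.schurWeyl A (e • b.rho))
  (hXY : (U * X + V * Y) * R.schurWeyl A (d • b.rho) = R.schurWeyl A η)
  (hU : b.IsLeading α U y) (hV : b.IsLeading α V y') (hsum : y + y' + d • b.rho = μ)
include hd he hμ heμ hη hce hgood hUV hVZ hXY hU hV hsum

/-- At most one of the leading values of `U` and `V` has zeros. -/
lemma leadingValue_ne_zero_or (β : b.support)
    (hprime : ∀ p : ℕ, p.Prime → (p : ℤ) ≤ 2 * R.weightCoeff β μ → ¬ IsUnit (p : A)) :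
    (∀ z : Kˣ, b.leadingValue α β z U y ≠ 0) ∨ ∀ z : Kˣ, b.leadingValue α β z V y' ≠ 0 := by
  by_contra! hcon
  obtain ⟨⟨z₁, hz₁⟩, z₂, hz₂⟩ := hcon
  have hVU : V * U * R.schurWeyl A (d • b.rho) = R.schurWeyl A μ := by rw [mul_comm V, hUV]
  have hsum' : y' + y + d • b.rho = μ := by rw [add_comm y', hsum]
  obtain ⟨m, hm⟩ : ∃ m : ℕ, R.weightCoeffHom β μ = m :=
    Int.eq_ofNat_of_zero_le (hμ β β.2).le
  have hm0 : 0 < m := by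
    have := hμ β β.2
    rw [← weightCoeffHom_apply, hm] at this
    exact_mod_cast this
  have hN : ∀ {z : Kˣ}, z ^ (2 * R.weightCoeffHom β μ) = 1 ↔ z ^ (2 * m) = 1 := by
    intro z
    rw [hm, ← zpow_natCast]
    push_cast
    rfl
  let H : Subgroup Kˣ := (powMonoidHom (2 * d)).ker
  have hH : ∀ {z : Kˣ}, z.antisymmPow d ≠ 0 ↔ z ∉ H := by
    intro z
    rw [Ne, Units.antisymmPow_eq_zero_iff, MonoidHom.mem_ker, powMonoidHom_apply, ← zpow_natCast]
    push_cast
    rfl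
  have hUz := fun {z : Kˣ} => leadingValue_ne_zero_of_eq_zero (K := K) (β := β) (z := z)
    hd hμ hUV hU hV hsum
  have hVz := fun {z : Kˣ} => leadingValue_ne_zero_of_eq_zero (K := K) (β := β) (z := z)
    hd hμ hVU hV hU hsum'
  -- If each prime power step preserved the zeros of the `V`-value, they would propagate from `z₂`
  -- to `z₁`, where the `U`-value already vanishes. It remains to exclude a step from a zero `z` of
  -- the `V`-value to a nonzero.
  refine (hUz hz₁).1 (forall_of_primePow_step (N := 2 * m) (by omega) H
    (fun z => b.leadingValue α β z V y' = 0) ?_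
    (hN.1 (zpow_eq_one_of_leadingValue_eq_zero hd hμ hVU hV hU hsum' hz₂))
    (hN.1 (zpow_eq_one_of_leadingValue_eq_zero hd hμ hUV hU hV hsum hz₁))
    (hH.1 (hVz hz₂).2) (hH.1 (hUz hz₁).2) hz₂)
  rintro z z' hz hz' - hzH' ⟨p, k, hp, hk⟩ hzV
  by_contra hzV'
  set ξ := z⁻¹ * z' with hξ
  have hξz : z * ξ = z' := mul_inv_cancel_left z z'
  have hξN : ξ ^ (2 * m) = 1 := by rw [hξ, mul_pow, inv_pow, hz, hz']; simp
  have hpN : p ∣ 2 * m := by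
    by_contra hpN
    have h1 : ξ ∈ (⊥ : Subgroup Kˣ) := mem_of_pow_mem_of_pow_mem
      (Nat.Coprime.pow_left k ((Nat.Prime.coprime_iff_not_dvd hp).2 hpN)) (by simp [hk])
      (by simp [hξN])
    rw [Subgroup.mem_bot] at h1
    rw [h1, mul_one] at hξz
    rw [← hξz] at hzV'
    exact hzV' hzV
  have hzU' : b.leadingValue α β z' U y = 0 :=
    (leadingValue_eq_zero_or hd hμ hUV hU hV hsum (hN.2 hz') (hH.2 hzH')).resolve_right hzV'
  -- Here the divisibility of `C(eρ, d)` by `V` enters: the `V`-value divides `[e] / [d]`.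
  have hze : z ^ (2 * (e : ℤ)) = 1 := by
    obtain ⟨x, x', hx, hx', hxx', -⟩ :=
      exists_isLeading α hd (b.dominantRegular_smul_rho he) hVZ
    obtain rfl := hx.unique hV
    have := zpow_eq_one_of_leadingValue_eq_zero hd (b.dominantRegular_smul_rho he) hVZ hx hx' hxx'
      hzV
    rwa [b.weightCoeffHom_smul_rho] at this
  obtain ⟨hzU, hzd⟩ := hVz hzV
  have hvan := vanishesAt_of_leadingValue_ne_zero hd hμ hVU hV hU hsum' heμ hze hzd hzU
  obtain ⟨s, hs, hs1⟩ := exists_leadingValue_mul_eq_one hμ heμ hη hce hgood hd he hXY hU β hze hzd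
    hvan hzU
  obtain ⟨r, hr, hr1⟩ := exists_leadingValue_sub_eq (A := A) (b := b) (α := α) (β := β) (y := y)
    (F := U) (n := ((2 * m : ℕ) : ℤ)) (by omega) ((zpow_natCast z _).trans hz)
    ((zpow_natCast ξ _).trans hξN)
  -- The `U`-value vanishes at `z'`, so at `z` it is a multiple of `1 - ξ`. It is also a unit in the
  -- integral closure, hence so is `1 - ξ`.
  rw [hξz, hzU', sub_zero] at hr1
  refine hprime p hp ?_ (isUnit_natCast_of_one_sub_mul (A := A) (K := K) hp (ξ := ξ) (r := r * s)
    (k := k) ?_ (hr.mul hs) ?_)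
  · rw [← weightCoeffHom_apply, hm]
    exact_mod_cast Nat.le_of_dvd (by omega) hpN
  · rw [← Units.val_pow_eq_pow_val, hk, Units.val_one]
  · rw [← mul_assoc, ← hr1, hs1]

/-- For each simple root, one of `U` and `V` vanishes at the roots of unity of order dividing `2e`
but not `2d`, and the leading exponent of the other one is orthogonal to the root. -/
lemma vanishesAt_dichotomy (β : b.support)
    (hprime : ∀ p : ℕ, p.Prime → (p : ℤ) ≤ 2 * R.weightCoeff β μ → ¬ IsUnit (p : A))
    (hUinv : U ∈ R.weylInvariants A) (hVinv : V ∈ R.weylInvariants A) :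
    (R.weightCoeffHom β y = 0 ∧ ∀ z : Kˣ, z ^ (2 * (e : ℤ)) = 1 → z.antisymmPow d ≠ 0 →
      R.VanishesAt (β : ι) z V ∧ ¬ R.VanishesAt (β : ι) z U) ∨
    (R.weightCoeffHom β y' = 0 ∧ ∀ z : Kˣ, z ^ (2 * (e : ℤ)) = 1 → z.antisymmPow d ≠ 0 →
      R.VanishesAt (β : ι) z U ∧ ¬ R.VanishesAt (β : ι) z V) := by
  have hVU : V * U * R.schurWeyl A (d • b.rho) = R.schurWeyl A μ := by rw [mul_comm V, hUV]
  have hsum' : y' + y + d • b.rho = μ := by rw [add_comm y', hsum]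
  have hnot : ∀ (F : AddMonoidAlgebra A R.weightLattice) (x : R.weightLattice) (z : Kˣ),
      b.leadingValue α β z F x ≠ 0 → ¬ R.VanishesAt (β : ι) z F := by
    intro F x z h h'
    rw [vanishesAt_iff (α := α)] at h'
    rw [leadingValue, h'] at h
    exact h rfl
  rcases leadingValue_ne_zero_or (K := K) hd he hμ heμ hη hce hgood hUV hVZ hXY hU hV hsum β hprime
    with h | h
  · exact Or.inl ⟨weightCoeffHom_eq_zero_of_leadingValue_ne_zero hUinv hU.1 h, fun z hze hzd =>
      ⟨vanishesAt_of_leadingValue_ne_zero hd hμ hVU hV hU hsum' heμ hze hzd (h z),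
        hnot _ _ _ (h z)⟩⟩
  · exact Or.inr ⟨weightCoeffHom_eq_zero_of_leadingValue_ne_zero hVinv hV.1 h, fun z hze hzd =>
      ⟨vanishesAt_of_leadingValue_ne_zero hd hμ hUV hU hV hsum heμ hze hzd (h z),
        hnot _ _ _ (h z)⟩⟩

end Dichotomy

end RootPairing.Base

/-! ### Rank two: a double bond treated over the dual numbers -/

lemma AddMonoidAlgebra.mul_eq_zero_of_fst {K G : Type*} [Field K] [AddCommGroup G]
    {F₁ F₂ : AddMonoidAlgebra (DualNumber K) G} (h₁ : ∀ x, (F₁.coeff x).fst = 0)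
    (h₂ : ∀ x, (F₂.coeff x).fst = 0) : F₁ * F₂ = 0 := by
  rw [mul_def]
  refine Finset.sum_eq_zero fun x _ => Finset.sum_eq_zero fun y _ => ?_
  change single (x + y) (F₁.coeff x * F₂.coeff y) = 0
  rw [DualNumber.mul_eq_zero_of_fst (h₁ x) (h₂ y), single_zero]

namespace RootPairing.Base

open AddMonoidAlgebra

variable {ι M N : Type*} [Finite ι] [AddCommGroup M] [Module ℝ M] [AddCommGroup N] [Module ℝ N]
  {R : RootPairing ι ℝ M N} [R.IsRootSystem] [R.IsCrystallographic] [R.IsReduced] {b : R.Base}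
  {α β δ : b.support}

lemma lexHom_simpleRefl_of_mem {J : Set b.support} (hβ : β ∈ J) (x : R.weightLattice) :
    b.lexHom α J (R.weylAct (R.simpleRefl β) x) = b.lexHom α J x :=
  lexHom_eq_iff.2 fun i hi => b.coord_simpleRefl_of_ne (fun h : i = β => hi (h ▸ hβ)) _

section RankTwo

variable (hβδ : R.pairing β δ = -2) (hδβ : R.pairing δ β = -1)

include hβδ in
lemma weightCoeffHom_simpleRefl_long (x : R.weightLattice) :
    R.weightCoeffHom δ (R.weylAct (R.simpleRefl β) x) =
      R.weightCoeffHom δ x + 2 * R.weightCoeffHom β x := by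
  rw [weightCoeffHom_eq_iff, weylAct_coe, simpleRefl_smul, map_sub, (R.coroot' δ).map_smul,
    R.root_coroot'_eq_pairing, hβδ]
  push_cast
  rw [weightCoeffHom_cast, weightCoeffHom_cast, smul_eq_mul]
  ring

include hδβ in
lemma weightCoeffHom_simpleRefl_short (x : R.weightLattice) :
    R.weightCoeffHom β (R.weylAct (R.simpleRefl δ) x) =
      R.weightCoeffHom β x + R.weightCoeffHom δ x := by
  rw [weightCoeffHom_eq_iff, weylAct_coe, simpleRefl_smul, map_sub, (R.coroot' β).map_smul,
    R.root_coroot'_eq_pairing, hδβ]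
  push_cast
  rw [weightCoeffHom_cast, weightCoeffHom_cast, smul_eq_mul]
  ring

include hβδ in
lemma weightCoeffHom_perm_long (x : R.weightLattice) :
    R.weightCoeffHom (R.weylGroupToPerm (R.simpleRefl β) δ) x =
      R.weightCoeffHom δ x + 2 * R.weightCoeffHom β x := by
  have h := R.weightCoeffHom_perm_weylAct (R.simpleRefl β) δ (R.weylAct (R.simpleRefl β) x)
  rw [← weylAct_mul, simpleRefl_mul_self, weylAct_one] at h
  rw [h, weightCoeffHom_simpleRefl_long hβδ]

variable {e : ℤ} {A K : Type*} [CommRing A] [Field K] [CharZero K] [Algebra A K] {z : Kˣ}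

include hβδ in
/-- Invariants which vanish at the long root vanish modulo both roots. -/
lemma twist_eq_zero_of_vanishesAt_long {F : AddMonoidAlgebra A R.weightLattice}
    (hF : R.VanishesAt (β : ι) z F) :
    twist (powChar z (R.weightCoeffHom (R.weylGroupToPerm (R.simpleRefl β) δ)))
      (b.lexHom α {β, δ}) F = 0 := by
  refine twist_eq_zero_of_factor (fun p hp => ?_) hF
  have hp' : (p : M) ∈ Submodule.span ℝ {R.root β} := by simpa using hp
  obtain ⟨a, ha⟩ := Submodule.mem_span_singleton.1 hp'
  constructor
  · rw [powChar_apply, powChar_apply, weightCoeffHom_perm_long hβδ]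
    congr 2
    -- On the line of `β` the pairings with `β` and with `s_β δ` agree: both are `2a` at `a β`. So
    -- the character factors through vanishing at `β`.
    have h : ((R.weightCoeffHom δ p + R.weightCoeffHom β p : ℤ) : ℝ) = 0 := by
      push_cast
      rw [weightCoeffHom_cast, weightCoeffHom_cast, ← ha, (R.coroot' δ).map_smul,
        (R.coroot' β).map_smul, R.root_coroot'_eq_pairing, R.root_coroot'_eq_pairing, hβδ,
        R.pairing_same, smul_eq_mul, smul_eq_mul]
      ring
    have h' : R.weightCoeffHom δ p + R.weightCoeffHom β p = 0 := by exact_mod_cast h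
    linarith
  · rw [← map_zero (b.lexHom α {β, δ}), lexHom_eq_iff]
    intro i hi
    rw [← ha, map_smul, b.coord_root_of_ne fun h : i = β => hi (h ▸ Set.mem_insert _ _)]
    simp

include hδβ in
/-- Invariants which vanish at the short root vanish modulo both roots. -/
lemma twist_eq_zero_of_vanishesAt_short {F : AddMonoidAlgebra A R.weightLattice}
    (hFinv : F ∈ R.weylInvariants A) (hF : R.VanishesAt (δ : ι) z F) :
    twist (powChar z (R.weightCoeffHom (R.weylGroupToPerm (R.simpleRefl β) δ)))
      (b.lexHom α {β, δ}) F = 0 := by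
  refine twist_eq_zero_of_factor (fun p hp => ⟨rfl, ?_⟩) (hF.perm hFinv (R.simpleRefl β))
  have hp' : (p : M) ∈ Submodule.span ℝ {R.root (R.weylGroupToPerm (R.simpleRefl β) δ)} :=
    (Submodule.Quotient.mk_eq_zero _).1 hp
  obtain ⟨a, ha⟩ := Submodule.mem_span_singleton.1 hp'
  rw [← map_zero (b.lexHom α {β, δ}), lexHom_eq_iff]
  intro i hi
  rw [← ha, map_smul, weyl_smul_root, b.coord_simpleRefl_of_ne
    fun h : i = β => hi (h ▸ Set.mem_insert _ _),
    b.coord_root_of_ne fun h : i = δ => hi (h ▸ Set.mem_insert_of_mem _ rfl)]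
  simp

include hβδ hδβ in
-- The difference lies in the span of `β` and `δ`, on which the two pairings are independent because
-- the `B₂` Cartan matrix is nonsingular.
lemma ext_of_lexHom_pair {x y : R.weightLattice} (h : b.lexHom α {β, δ} x = b.lexHom α {β, δ} y)
    (h₁ : R.weightCoeffHom β x = R.weightCoeffHom β y)
    (h₂ : R.weightCoeffHom δ x = R.weightCoeffHom δ y) : x = y := by
  rw [lexHom_eq_iff] at h
  have hne : β ≠ δ := by
    rintro rfl
    rw [R.pairing_same] at hβδ
    norm_num at hβδ
  let v : M := (x : M) - y
  have hv : ∀ i ∉ ({β, δ} : Set b.support), b.coord i v = 0 := by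
    intro i hi
    simp only [v, map_sub, h i hi, sub_self]
  have hsum : ∀ j : ι, R.coroot' j v = b.coord β v * R.pairing β j + b.coord δ v * R.pairing δ j := by
    intro j
    classical
    rw [b.coroot'_eq_sum_coord, ← Finset.sum_subset (Finset.subset_univ {β, δ}),
      Finset.sum_pair hne]
    intro i _ hi
    rw [hv i (by simpa using hi), zero_mul]
  have h₁' : R.coroot' β v = 0 := by
    simp only [v, map_sub, ← weightCoeffHom_cast, h₁, sub_self]
  have h₂' : R.coroot' δ v = 0 := by
    simp only [v, map_sub, ← weightCoeffHom_cast, h₂, sub_self]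
  rw [hsum, R.pairing_same] at h₁' h₂'
  rw [hδβ] at h₁'
  rw [hβδ] at h₂'
  refine Subtype.ext (sub_eq_zero.1 (b.ext_coord (x := v) fun i => ?_))
  rw [map_zero]
  by_cases hi : i ∈ ({β, δ} : Set b.support)
  · rcases hi with rfl | hi
    · linarith
    · obtain rfl : i = δ := hi
      linarith
  · exact hv i hi

section Words

variable {η : R.weightLattice} (u : R.weylGroup)

variable (β δ) in
/-- The elements of a coset of the parabolic subgroup of type `B₂`. -/
def rankTwoWord (u : R.weylGroup) (t : Bool × Bool × Bool) : R.weylGroup :=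
  -- On the pairings with `δ` and `δ' = s_β δ`, the first letter negates the one with `δ`, the
  -- second, the reflection in `δ'`, negates the one with `δ'`, and `s_β` exchanges them. This lists
  -- all eight elements of the Weyl group of type `B₂`.
  (if t.1 then R.simpleRefl δ else 1) *
    ((if t.2.1 then R.simpleRefl β * (R.simpleRefl δ * R.simpleRefl β) else 1) *
      ((if t.2.2 then R.simpleRefl β else 1) * u))

lemma weylSign_rankTwoWord (t : Bool × Bool × Bool) :
    R.weylSign (rankTwoWord β δ u t) = (if t.1 then -1 else 1) * (if t.2.1 then -1 else 1) *
      (if t.2.2 then -1 else 1) * R.weylSign u := by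
  obtain ⟨_ | _, _ | _, _ | _⟩ := t <;>
    simp [rankTwoWord, mul_assoc, weylSign_simpleRefl_mul]

lemma lexHom_rankTwoWord (t : Bool × Bool × Bool) :
    b.lexHom α {β, δ} (R.weylAct (rankTwoWord β δ u t) η) =
      b.lexHom α {β, δ} (R.weylAct u η) := by
  have hβ : ∀ x, b.lexHom α {β, δ} (R.weylAct (R.simpleRefl β) x) = b.lexHom α {β, δ} x :=
    lexHom_simpleRefl_of_mem (Set.mem_insert _ _)
  have hδ : ∀ x, b.lexHom α {β, δ} (R.weylAct (R.simpleRefl δ) x) = b.lexHom α {β, δ} x :=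
    lexHom_simpleRefl_of_mem (Set.mem_insert_of_mem _ rfl)
  obtain ⟨_ | _, _ | _, _ | _⟩ := t <;> simp [rankTwoWord, weylAct_mul, hβ, hδ]

include hβδ hδβ in
lemma weightCoeffHom_rankTwoWord (t : Bool × Bool × Bool) (p r : ℤ)
    (hp : R.weightCoeffHom δ (R.weylAct u η) = p) (hr : R.weightCoeffHom β (R.weylAct u η) = r) :
    R.weightCoeffHom δ (R.weylAct (rankTwoWord β δ u t) η) =
      (if t.1 then -1 else 1) * (if t.2.2 then p + 2 * r else p) ∧
    R.weightCoeffHom δ (R.weylAct (rankTwoWord β δ u t) η) +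
      2 * R.weightCoeffHom β (R.weylAct (rankTwoWord β δ u t) η) =
      (if t.2.1 then -1 else 1) * (if t.2.2 then p else p + 2 * r) := by
  have h1 : ∀ x, R.weightCoeffHom δ (R.weylAct (R.simpleRefl β) x) =
      R.weightCoeffHom δ x + 2 * R.weightCoeffHom β x := weightCoeffHom_simpleRefl_long hβδ
  have h2 : ∀ x, R.weightCoeffHom β (R.weylAct (R.simpleRefl δ) x) =
      R.weightCoeffHom β x + R.weightCoeffHom δ x := weightCoeffHom_simpleRefl_short hδβ
  have h3 : ∀ i x, R.weightCoeffHom i (R.weylAct (R.simpleRefl i) x) = -R.weightCoeffHom i x :=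
    R.weightCoeffHom_simpleRefl
  obtain ⟨_ | _, _ | _, _ | _⟩ := t <;> constructor <;>
    simp [rankTwoWord, weylAct_mul, h1, h2, h3, hp, hr] <;> ring

include hβδ hδβ in
/-- The pairings of the elements of a coset of the parabolic subgroup with `δ` and its reflection
are permuted up to signs. -/
lemma weightCoeffHom_of_mem_closure {p r : ℤ}
    (hp : R.weightCoeffHom δ (R.weylAct u η) = p) (hr : R.weightCoeffHom β (R.weylAct u η) = r)
    {v : R.weylGroup}
    (hv : v ∈ Subgroup.closure ((fun i : b.support => R.simpleRefl i) '' {β, δ})) :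
    ∃ t : Bool × Bool × Bool, R.weightCoeffHom δ (R.weylAct (v * u) η) =
      (if t.1 then -1 else 1) * (if t.2.2 then p + 2 * r else p) ∧
    R.weightCoeffHom δ (R.weylAct (v * u) η) + 2 * R.weightCoeffHom β (R.weylAct (v * u) η) =
      (if t.2.1 then -1 else 1) * (if t.2.2 then p else p + 2 * r) := by
  have hclosed : ∀ (i : b.support), i ∈ ({β, δ} : Set b.support) → ∀ v : R.weylGroup,
      (∃ t : Bool × Bool × Bool, R.weightCoeffHom δ (R.weylAct (v * u) η) =
        (if t.1 then -1 else 1) * (if t.2.2 then p + 2 * r else p) ∧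
      R.weightCoeffHom δ (R.weylAct (v * u) η) + 2 * R.weightCoeffHom β (R.weylAct (v * u) η) =
        (if t.2.1 then -1 else 1) * (if t.2.2 then p else p + 2 * r)) →
      ∃ t : Bool × Bool × Bool, R.weightCoeffHom δ (R.weylAct (R.simpleRefl i * v * u) η) =
        (if t.1 then -1 else 1) * (if t.2.2 then p + 2 * r else p) ∧
      R.weightCoeffHom δ (R.weylAct (R.simpleRefl i * v * u) η) +
        2 * R.weightCoeffHom β (R.weylAct (R.simpleRefl i * v * u) η) =
        (if t.2.1 then -1 else 1) * (if t.2.2 then p else p + 2 * r) := by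
    rintro i hi v ⟨⟨t₁, t₂, t₃⟩, h₁, h₂⟩
    rw [mul_assoc, weylAct_mul]
    rcases hi with rfl | hi
    · refine ⟨⟨t₂, t₁, !t₃⟩, ?_, ?_⟩
      · rw [weightCoeffHom_simpleRefl_long hβδ, h₂]
        cases t₃ <;> simp
      · rw [weightCoeffHom_simpleRefl_long hβδ, weightCoeffHom_simpleRefl]
        rw [mul_neg, add_neg_cancel_right, h₁]
        cases t₃ <;> simp
    · obtain rfl : i = δ := hi
      refine ⟨⟨!t₁, t₂, t₃⟩, ?_, ?_⟩
      · rw [weightCoeffHom_simpleRefl, h₁]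
        cases t₁ <;> cases t₃ <;> simp
      · rw [weightCoeffHom_simpleRefl, weightCoeffHom_simpleRefl_short hδβ, ← h₂]
        ring
  induction hv using Subgroup.closure_induction_left with
  | one => exact ⟨⟨false, false, false⟩, by simp [hp], by simp [hp, hr]⟩
  | mul_left x hx v hv ih =>
    obtain ⟨i, hi, rfl⟩ := hx
    exact hclosed i hi v ih
  | inv_mul_cancel x hx v hv ih =>
    obtain ⟨i, hi, rfl⟩ := hx
    simp only [simpleRefl_inv]
    exact hclosed i hi v ih

end Words

variable [IsDomain A] {d c : ℕ} {η : R.weightLattice}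

include hβδ hδβ in
/-- If invariants vanishing at a long and an adjacent short simple root generate an ideal containing
`S(η) / S(dρ)`, then the pairings of the elements in the orbit of `η` satisfy a strong identity. -/
lemma mul_antisymmPow_eq (hηd : b.DominantRegular η)
    {F₁ F₂ X₁ X₂ : AddMonoidAlgebra A R.weightLattice}
    (h₁ : R.VanishesAt (β : ι) z F₁) (h₂ : R.VanishesAt (δ : ι) z F₂)
    (hinv : F₂ ∈ R.weylInvariants A)
    (hη : (F₁ * X₁ + F₂ * X₂) * R.schurWeyl A (d • b.rho) = R.schurWeyl A η)
    {u : R.weylGroup}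
    (hu : ∀ v : R.weylGroup, (∀ i ∉ ({β, δ} : Set b.support),
      b.coord i (v • (η : M)) = b.coord i (u • (η : M))) →
        v * u⁻¹ ∈ Subgroup.closure ((fun i : b.support => R.simpleRefl i) '' {β, δ}))
    {p r : ℤ} (hp : R.weightCoeffHom δ (R.weylAct u η) = p)
    (hr : R.weightCoeffHom β (R.weylAct u η) = r) (hp0 : 0 < p) (hr0 : 0 < r) :
    (p : K) * z.antisymmPow (p + 2 * r) = (p + 2 * r : ℤ) * z.antisymmPow p := by
  classical
  let := Fintype.ofFinite R.weylGroup
  set δ' := R.weylGroupToPerm (R.simpleRefl β) δ with hδ'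
  let ζ : (DualNumber K)ˣ := Units.map (TrivSqZeroExt.inlHom K K : K →* DualNumber K) z
  -- The character is `(1 + ε)^⟨x, δ*⟩ z^⟨x, δ'*⟩` with `δ' = s_β δ`. At `ε = 0` only the pairing
  -- with `δ'` remains, for which both `F₁` and `F₂` vanish modulo `β` and `δ`.
  let χ : Multiplicative R.weightLattice →* DualNumber K :=
    powChar (DualNumber.tangentUnit 1) (R.weightCoeffHom δ) * powChar ζ (R.weightCoeffHom δ')
  let g := b.lexHom β {β, δ}
  have hζ : ∀ n : ℤ, ((ζ ^ n : (DualNumber K)ˣ) : DualNumber K) =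
      TrivSqZeroExt.inl ((z ^ n : Kˣ) : K) := by
    intro n
    rw [← map_zpow]
    rfl
  have hχ : ∀ x, χ (Multiplicative.ofAdd x) =
      (TrivSqZeroExt.inl 1 + TrivSqZeroExt.inr (R.weightCoeffHom δ x : K)) *
        TrivSqZeroExt.inl ((z ^ R.weightCoeffHom δ' x : Kˣ) : K) := by
    intro x
    rw [← hζ, MonoidHom.mul_apply, powChar_apply, powChar_apply, DualNumber.tangentUnit_zpow]
    simp
  have hfst : ∀ F : AddMonoidAlgebra A R.weightLattice,
      twist (powChar z (R.weightCoeffHom δ')) g F = 0 → ∀ x, ((twist χ g F).coeff x).fst = 0 := by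
    intro F hF x
    have h := map_coeff_twist (TrivSqZeroExt.fstHom A K K) χ g F x
    have hcomp : ((TrivSqZeroExt.fstHom A K K : DualNumber K →ₐ[A] K) : DualNumber K →* K).comp χ =
        powChar z (R.weightCoeffHom δ') := by
      refine MonoidHom.ext fun x => ?_
      change (χ (Multiplicative.ofAdd x.toAdd)).fst = powChar z _ (Multiplicative.ofAdd x.toAdd)
      rw [hχ, powChar_apply]
      simp
    rw [hcomp, hF] at h
    exact h
  -- The roots `δ` and `δ'` are orthogonal, so `s_δ` preserves the reduced character and the terms
  -- of `S(dρ)` cancel in pairs.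
  have hS0 : twist (powChar z (R.weightCoeffHom δ')) g (R.schurWeyl A (d • b.rho)) = 0 := by
    refine R.twist_schurWeyl_eq_zero (δ : ι) (fun w => ?_)
      (lexHom_simpleRefl_of_mem (Set.mem_insert_of_mem _ rfl))
    rw [powChar_apply, powChar_apply, hδ', weightCoeffHom_perm_long hβδ,
      weightCoeffHom_perm_long hβδ, weightCoeffHom_simpleRefl, weightCoeffHom_simpleRefl_short hδβ]
    congr 2
    ring
  have hzero : twist χ g (R.schurWeyl A η) = 0 := by
    rw [← hη, map_mul]
    -- Both factors have all coefficients in the ideal of `ε`, and `ε² = 0`.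
    refine mul_eq_zero_of_fst (hfst _ ?_) (hfst _ hS0)
    rw [map_add, map_mul, map_mul, twist_eq_zero_of_vanishesAt_long hβδ h₁,
      twist_eq_zero_of_vanishesAt_short hδβ hinv h₂, zero_mul, zero_mul, add_zero]
  have hcoeff : (twist χ g (R.schurWeyl A η)).coeff (g (R.weylAct u η)) = 0 := by
    rw [hzero]
    rfl
  have hinj : Function.Injective (rankTwoWord β δ u) := by
    intro t t' htt
    obtain ⟨ha, hb⟩ := weightCoeffHom_rankTwoWord hβδ hδβ u t p r hp hr
    obtain ⟨ha', hb'⟩ := weightCoeffHom_rankTwoWord hβδ hδβ u t' p r hp hr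
    rw [htt, ha'] at ha
    rw [htt, hb'] at hb
    obtain ⟨_ | _, _ | _, _ | _⟩ := t <;> obtain ⟨_ | _, _ | _, _ | _⟩ := t' <;>
      simp at ha hb ⊢ <;> omega
  -- The orbit points over the class of `u η` are given by the coset of `u` under the `B₂` parabolic
  -- subgroup.
  have hfibre : Finset.univ.filter (fun v : R.weylGroup => g (R.weylAct v η) = g (R.weylAct u η)) =
      Finset.univ.image (rankTwoWord β δ u) := by
    ext v
    simp only [Finset.mem_filter, Finset.mem_univ, true_and, Finset.mem_image]
    constructor
    · intro hv
      obtain ⟨t, ha, hb⟩ := weightCoeffHom_of_mem_closure hβδ hδβ u hp hr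
        (hu v (lexHom_eq_iff.1 hv))
      rw [inv_mul_cancel_right] at ha hb
      obtain ⟨ha', hb'⟩ := weightCoeffHom_rankTwoWord hβδ hδβ u t p r hp hr
      refine ⟨t, b.weylAct_injective_of_dominantRegular hηd
        (ext_of_lexHom_pair (α := β) hβδ hδβ ?_ ?_ ?_)⟩
      · rw [lexHom_rankTwoWord]
        exact hv.symm
      · linarith
      · rw [ha, ha']
    · rintro ⟨t, rfl⟩
      exact lexHom_rankTwoWord u t
  rw [coeff_twist_schurWeyl, hfibre, Finset.sum_image hinj.injOn] at hcoeff
  have hsnd := congrArg TrivSqZeroExt.snd hcoeff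
  have hterm : ∀ t, ((R.weylSign (rankTwoWord β δ u t) : DualNumber K) *
      χ (Multiplicative.ofAdd (R.weylAct (rankTwoWord β δ u t) η))).snd =
      (R.weylSign u : K) * ((if t.1 then -1 else 1) * (if t.2.1 then -1 else 1) *
      (if t.2.2 then -1 else 1)) * (((if t.1 then -1 else 1) * (if t.2.2 then p + 2 * r else p) : ℤ) *
      ((z ^ ((if t.2.1 then -1 else 1) * (if t.2.2 then p else p + 2 * r)) : Kˣ) : K)) := by
    intro t
    obtain ⟨ha, hb⟩ := weightCoeffHom_rankTwoWord hβδ hδβ u t p r hp hr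
    have hsign : ((R.weylSign (rankTwoWord β δ u t) : ℤ) : DualNumber K) =
        TrivSqZeroExt.inl ((R.weylSign (rankTwoWord β δ u t) : ℤ) : K) := by simp
    rw [hχ, hδ', weightCoeffHom_perm_long hβδ, hb, ha, hsign, weylSign_rankTwoWord]
    simp only [TrivSqZeroExt.snd_mul, TrivSqZeroExt.fst_mul, TrivSqZeroExt.snd_add,
      TrivSqZeroExt.snd_inl, TrivSqZeroExt.fst_inl, TrivSqZeroExt.snd_inr, smul_eq_mul,
      MulOpposite.smul_eq_mul_unop, MulOpposite.unop_op]
    push_cast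
    ring
  rw [TrivSqZeroExt.snd_sum] at hsnd
  simp_rw [hterm] at hsnd
  rw [TrivSqZeroExt.snd_zero] at hsnd
  simp only [Fintype.sum_prod_type, Fintype.sum_bool] at hsnd
  have hsu : (R.weylSign u : K) ≠ 0 := by
    rcases R.weylSign_eq_or u with h | h <;> simp [h]
  have h2 : (2 : K) * (R.weylSign u : K) ≠ 0 := mul_ne_zero two_ne_zero hsu
  -- Up to the sign of `u`, the `ε`-parts of the eight terms sum to `2 (p [p + 2r] - (p + 2r) [p])`.
  refine mul_left_cancel₀ h2 (sub_eq_zero.1 (Eq.trans ?_ hsnd))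
  simp only [Units.antisymmPow, if_true, if_false, Bool.false_eq_true, one_mul, neg_mul, neg_add]
  push_cast
  ring

end RankTwo

end RootPairing.Base

/-! ### Root lengths, the gcd condition and the choice of orbit points -/

namespace RootPairing

variable {ι M N : Type*} [Fintype ι] [AddCommGroup M] [Module ℝ M] [AddCommGroup N] [Module ℝ N]
  (R : RootPairing ι ℝ M N) [R.IsRootSystem] [R.IsCrystallographic]

lemma normSq_pos (i : ι) : 0 < R.normSq i := R.rootForm_pos_of_ne_zero (by simp) (R.ne_zero i)

lemma normSq_perm (w : R.weylGroup) (i : ι) : R.normSq (R.weylGroupToPerm w i) = R.normSq i := by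
  rw [normSq, weyl_smul_root]
  exact InvariantForm.apply_weylGroup_smul R (B := R.toInvariantForm) w _ _

lemma pairingIn_mul_normSq (i j : ι) :
    (R.pairingIn ℤ i j : ℝ) * R.normSq j = R.pairingIn ℤ j i * R.normSq i := by
  have h := R.toInvariantForm.pairing_mul_eq_pairing_mul_swap i j
  rw [← R.algebraMap_pairingIn ℤ, ← R.algebraMap_pairingIn ℤ] at h
  exact h.symm

variable [R.IsReduced]

lemma normSq_eq_or [R.IsIrreducible] {i j : ι} (h : R.normSq i ≠ R.normSq j) (k : ι) :
    R.normSq k = R.normSq i ∨ R.normSq k = R.normSq j :=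
  R.toInvariantForm.apply_eq_or_of_apply_ne h k

lemma abs_pairingIn_le_one_of_normSq_eq {i j : ι} (h : R.normSq i = R.normSq j)
    (hne : R.root i ≠ R.root j) (hne' : R.root i ≠ -R.root j) : |R.pairingIn ℤ i j| ≤ 1 := by
  have h1 := R.pairingIn_mul_normSq i j
  rw [h] at h1
  have h2 := mul_right_cancel₀ (R.normSq_pos j).ne' h1
  have h3 : R.pairingIn ℤ i j = R.pairingIn ℤ j i := by exact_mod_cast h2
  have h4 := R.pairingIn_pairingIn_mem_set_of_isCrystal_of_isRed' i j hne hne'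
  rw [← h3] at h4
  simp only [Set.mem_insert_iff, Set.mem_singleton_iff, Prod.mk.injEq] at h4
  rw [abs_le]
  omega

/-- Pairings of a short root with non-proportional roots are at most one in absolute value. -/
lemma abs_pairingIn_eq_one_of_normSq_le {i j : ι} (h : R.normSq i ≤ R.normSq j)
    (hne : R.root i ≠ R.root j) (hne' : R.root i ≠ -R.root j) (h0 : R.pairingIn ℤ i j ≠ 0) :
    |R.pairingIn ℤ i j| = 1 := by
  have h1 := R.pairingIn_mul_normSq i j
  have h4 := R.pairingIn_pairingIn_mem_set_of_isCrystal_of_isRed' i j hne hne'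
  have hi := R.normSq_pos i
  have hj := R.normSq_pos j
  simp only [Set.mem_insert_iff, Set.mem_singleton_iff, Prod.mk.injEq] at h4
  rcases h4 with h4 | h4 | h4 | h4 | h4 | h4 | h4 | h4 | h4 | h4 | h4 <;>
    obtain ⟨ha, hb⟩ := h4 <;> rw [hb, ha] at h1 <;> rw [ha] at h0 ⊢ <;> first
    | rfl
    | exact absurd rfl h0
    | (push_cast at h1; linarith)

namespace Base

variable {R} {b : R.Base}

variable {α β δ : b.support} {c d e : ℕ}

/-- Nonzero pairings of a short root with coroots of non-proportional roots are `±1`. -/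
lemma gcdCondition_of_isShort (hα : R.IsShort α) (hce : Int.gcd c e = d) :
    b.GcdCondition α c e d := by
  intro w i hi hi' h0
  have h := R.abs_pairingIn_eq_one_of_normSq_le (i := R.weylGroupToPerm w α) (j := i)
    (by rw [normSq_perm]; exact hα i) (by rw [weyl_smul_root]; exact hi.symm)
    (by rw [weyl_smul_root]; exact fun h => hi' (by rw [h, neg_neg])) h0
  rcases (abs_eq zero_le_one).1 h with h1 | h1 <;> rw [h1] <;> simpa using hce

/-- A long root has nonzero pairings `±1` with coroots of non-proportional long roots and `±m(Φ)`
with those of short ones, which is why both gcds are needed. -/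
lemma gcdCondition_of_isLong [R.IsIrreducible] (hα : R.IsLong α) (hce : Int.gcd c e = d)
    (hmce : Int.gcd (R.lengthRatio * c : ℕ) e = d) : b.GcdCondition α c e d := by
  intro w i hi hi' h0
  set γ := R.weylGroupToPerm w α with hγ
  have hNγ : R.normSq γ = R.normSq α := R.normSq_perm w α
  have hne : R.root i ≠ R.root γ := by rwa [weyl_smul_root]
  have hne' : R.root i ≠ -R.root γ := by rwa [weyl_smul_root]
  have hswap := R.pairingIn_mul_normSq γ i
  have h0' : R.pairingIn ℤ i γ ≠ 0 := by
    intro h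
    rw [h, Int.cast_zero, zero_mul] at hswap
    exact h0 (by exact_mod_cast (mul_eq_zero.1 hswap).resolve_right (R.normSq_pos i).ne')
  have h1 := R.abs_pairingIn_eq_one_of_normSq_le (by rw [hNγ]; exact hα i) hne hne' h0'
  by_cases heq : R.normSq i = R.normSq α
  · rw [hNγ, heq] at hswap
    have h2 : R.pairingIn ℤ γ i = R.pairingIn ℤ i γ := by
      exact_mod_cast mul_right_cancel₀ (R.normSq_pos α).ne' hswap
    rcases (abs_eq zero_le_one).1 h1 with h3 | h3 <;> rw [h2, h3] <;> simpa using hce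
  · have hshort : R.IsShort i := by
      intro j
      rcases R.normSq_eq_or heq j with h | h <;> rw [h]
      exact hα i
    have h2 := R.normSq_eq_lengthRatio_mul hα hshort
    rw [hNγ, h2, ← mul_assoc] at hswap
    have h3 : R.pairingIn ℤ γ i = R.pairingIn ℤ i γ * R.lengthRatio := by
      exact_mod_cast mul_right_cancel₀ (R.normSq_pos i).ne' hswap
    rw [Nat.cast_mul] at hmce
    rcases (abs_eq zero_le_one).1 h1 with h4 | h4 <;> rw [h3, h4] <;> simpa using hmce

/-- A triple bond forces rank two, so `β` and `δ` are all the simple roots. -/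
lemma hasCartanMatrix_G₂ [R.IsIrreducible] (h : R.pairingIn ℤ β δ = -3) :
    b.HasCartanMatrix CartanMatrix.G₂ := by
  classical
  have : R.IsG2 := ⟨⟨β, δ, h⟩⟩
  have hcard := IsG2.card_base_support_eq_two b
  have hne : β ≠ δ := by
    rintro rfl
    rw [R.pairingIn_same] at h
    norm_num at h
  have huniv : ∀ i : b.support, i = β ∨ i = δ := by
    have h1 : ({β, δ} : Finset b.support) = Finset.univ := by
      refine Finset.eq_univ_of_card _ ?_
      rw [Finset.card_pair hne, Fintype.card_coe, hcard]
    intro i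
    have := Finset.mem_univ i
    rw [← h1] at this
    simpa using this
  have h' : R.pairingIn ℤ δ β = -1 := by
    have := R.pairingIn_pairingIn_mem_set_of_isCrystal_of_isRed β δ
    rw [h] at this
    simp only [Set.mem_insert_iff, Set.mem_singleton_iff, Prod.mk.injEq] at this
    omega
  let f : b.support ≃ Fin 2 :=
    { toFun := fun i => if i = β then 0 else 1
      invFun := fun k => if k = 0 then β else δ
      left_inv := fun i => by
        rcases huniv i with rfl | rfl
        · simp
        · simp [hne.symm]
      right_inv := fun k => by
        fin_cases k
        · simp
        · simp [hne.symm] }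
  refine ⟨f, ?_⟩
  have f0 : f.symm 0 = β := rfl
  have f1 : f.symm 1 = δ := rfl
  ext i j
  rw [Matrix.reindex_apply, Matrix.submatrix_apply, cartanMatrix, cartanMatrixIn_def]
  fin_cases i <;> fin_cases j
  · change R.pairingIn ℤ β β = 2
    simp
  · exact h
  · exact h'
  · change R.pairingIn ℤ δ δ = 2
    simp

/-- Adjacent simple roots of the same length are conjugate under the Weyl group. -/
lemma exists_perm_eq_of_pairing (h : R.pairing β δ = -1) (h' : R.pairing δ β = -1) :
    ∃ w : R.weylGroup, R.weylGroupToPerm w β = δ := by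
  refine ⟨R.simpleRefl β * R.simpleRefl δ, R.root.injective ?_⟩
  rw [weyl_smul_root, mul_smul, simpleRefl_smul, simpleRefl_smul]
  simp only [map_sub, map_smul, R.root_coroot'_eq_pairing, R.pairing_same, h, h', smul_eq_mul]
  module

variable {μ η : R.weightLattice} [R.IsIrreducible]

/-- The `α`-coordinate `1` shows that `w α` is not proportional to the simple root `i ≠ α`;
non-proportional roots of equal length pair to `0` or `±1`. -/
lemma abs_pairingIn_le_one_of_coord {w : R.weylGroup} {i : b.support} (hi : i ≠ α)
    (hw : b.coord α (w • R.root α) = 1) (hN : R.normSq α = R.normSq i) :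
    |R.pairingIn ℤ (R.weylGroupToPerm w α) i| ≤ 1 := by
  have hiα : b.coord α (R.root i) = 0 := b.coord_root_of_ne hi.symm
  refine R.abs_pairingIn_le_one_of_normSq_eq (by rw [normSq_perm, hN]) (fun h => ?_) fun h => ?_
  · rw [← weyl_smul_root, h, hiα] at hw
    exact zero_ne_one hw
  · rw [← weyl_smul_root, h, map_neg, hiα] at hw
    norm_num at hw

/-- An element of the orbit of `η` whose pairings with two adjacent simple roots of different
lengths are controlled modulo `e`. -/
lemma exists_fibre (hμ : b.DominantRegular μ)
    (heμ : ∀ i ∈ b.support, (e : ℤ) ∣ R.weightCoeff i μ)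
    (hη : η = μ + c • b.fundamentalWeight α)
    (hgood : b.GcdCondition α c e d) (hβδ : R.pairing β δ = -2) (hδβ : R.pairing δ β = -1) :
    ∃ u : R.weylGroup, 0 < R.weightCoeffHom δ (R.weylAct u η) ∧
      0 < R.weightCoeffHom β (R.weylAct u η) ∧
      (∀ v : R.weylGroup, (∀ i ∉ ({β, δ} : Set b.support),
        b.coord i (v • (η : M)) = b.coord i (u • (η : M))) →
        v * u⁻¹ ∈ Subgroup.closure ((fun i : b.support => R.simpleRefl i) '' {β, δ})) ∧
      (((e : ℤ) ∣ R.weightCoeffHom δ (R.weylAct u η) ∧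
        (e : ℤ) ∣ R.weightCoeffHom β (R.weylAct u η) - c ∧ Int.gcd (2 * c) e = d) ∨
      ((e : ℤ) ∣ R.weightCoeffHom δ (R.weylAct u η) - c ∧
        (e : ℤ) ∣ R.weightCoeffHom β (R.weylAct u η))) := by
  have hηd := dominantRegular_add_smul_fundamentalWeight hμ hη
  have hηd' := b.dominantRegular_iff.1 hηd
  have hne : β ≠ δ := by
    rintro rfl
    rw [R.pairing_same] at hβδ
    norm_num at hβδ
  have hβδ' : R.pairingIn ℤ β δ = -2 := by
    rw [← R.algebraMap_pairingIn ℤ] at hβδ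
    exact_mod_cast (by simpa using hβδ : ((R.pairingIn ℤ β δ : ℤ) : ℝ) = -2)
  have hcast : ∀ {i : ι} {x : R.weightLattice}, 0 < R.coroot' i (x : M) →
      0 < R.weightCoeffHom i x := by
    intro i x h
    rw [← weightCoeffHom_cast] at h
    exact_mod_cast h
  by_cases hαJ : α ∈ ({β, δ} : Set b.support)
  · refine ⟨1, ?_, ?_, fun v hv => b.isAdapted_empty_one.mem_closure (Set.empty_disjoint _) hηd' hv,
      ?_⟩
    · rw [weylAct_one]
      exact hcast (hηd' δ)
    · rw [weylAct_one]
      exact hcast (hηd' β)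
    · rcases hαJ with rfl | hαJ
      · left
        refine ⟨?_, ?_, ?_⟩
        · have := dvd_weightCoeffHom_sub heμ hη 1 δ (n := 0) (by
            rw [one_smul, b.coroot'_fundamentalWeight_of_ne hne, Int.cast_zero])
          rwa [zero_mul, sub_zero] at this
        · have := dvd_weightCoeffHom_sub heμ hη 1 α (n := 1) (by
            rw [one_smul, b.coroot'_fundamentalWeight_self, Int.cast_one])
          rwa [one_mul] at this
        · have h1 := hgood 1 δ (by
            rw [one_smul]
            exact fun h => hne (Subtype.ext (R.root.injective h.symm))) (by
            rw [one_smul]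
            intro h
            have h2 := congrArg (b.coord δ) h
            rw [map_neg, b.coord_root_self, b.coord_root_of_ne hne.symm] at h2
            norm_num at h2) (by simp [hβδ'])
          simpa [hβδ'] using h1
      · obtain rfl : α = δ := hαJ
        right
        refine ⟨?_, ?_⟩
        · have := dvd_weightCoeffHom_sub heμ hη 1 α (n := 1) (by
            rw [one_smul, b.coroot'_fundamentalWeight_self, Int.cast_one])
          rwa [one_mul] at this
        · have := dvd_weightCoeffHom_sub heμ hη 1 β (n := 0) (by
            rw [one_smul, b.coroot'_fundamentalWeight_of_ne hne.symm, Int.cast_zero])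
          rwa [zero_mul, sub_zero] at this
  obtain ⟨K, u, w, hKJ, had, huα, hwα, -, hle, hlt⟩ :=
    b.exists_isAdapted α {β, δ} ⟨β, Set.mem_insert _ _⟩ hαJ
  have hαβ : α ≠ β := fun h => hαJ (h ▸ Set.mem_insert _ _)
  have hαδ : α ≠ δ := fun h => hαJ (h ▸ Set.mem_insert_of_mem _ rfl)
  have hβK : β ∉ K := Set.disjoint_right.1 hKJ (Set.mem_insert _ _)
  have hδK : δ ∉ K := Set.disjoint_right.1 hKJ (Set.mem_insert_of_mem _ rfl)
  refine ⟨u, hcast (had.pos _ hηd' δ hδK), hcast (had.pos _ hηd' β hβK),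
    fun v hv => had.mem_closure hKJ hηd' hv, ?_⟩
  set γ := R.weylGroupToPerm w α with hγ
  have hcong : ∀ i : b.support, α ≠ i →
      (e : ℤ) ∣ R.weightCoeffHom i (R.weylAct u η) - -R.pairingIn ℤ γ i * c := by
    intro i hi
    refine dvd_weightCoeffHom_sub heμ hη u i ?_
    rw [huα, map_sub, b.coroot'_fundamentalWeight_of_ne hi, coroot'_smul_root, zero_sub,
      Int.cast_neg]
  have hβ := hcong β hαβ
  have hδ := hcong δ hαδ
  have hkβ : R.pairingIn ℤ γ β ≤ 0 := by
    have := hle β (Set.mem_insert _ _)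
    rw [coroot'_smul_root] at this
    exact_mod_cast this
  have hkδ : R.pairingIn ℤ γ δ ≤ 0 := by
    have := hle δ (Set.mem_insert_of_mem _ rfl)
    rw [coroot'_smul_root] at this
    exact_mod_cast this
  have hk : R.pairingIn ℤ γ β < 0 ∨ R.pairingIn ℤ γ δ < 0 := by
    obtain ⟨i, hi, h⟩ := hlt
    rw [coroot'_smul_root] at h
    have h' : R.pairingIn ℤ γ i < 0 := by exact_mod_cast h
    rcases hi with rfl | hi
    · exact Or.inl h'
    · obtain rfl : i = δ := hi
      exact Or.inr h'
  have hcoord : ∀ i : b.support, α ≠ i → b.coord α ((R.simpleRefl i * w) • R.root α) = 1 := by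
    intro i hi
    rw [mul_smul, b.coord_simpleRefl_of_ne hi, hwα]
  have hpair : ∀ i j : b.support, R.pairingIn ℤ (R.weylGroupToPerm (R.simpleRefl i * w) α) j =
      R.pairingIn ℤ γ j - R.pairingIn ℤ γ i * R.pairingIn ℤ i j := by
    intro i j
    have h1 := coroot'_smul_root (R.simpleRefl i * w) j α
    rw [mul_smul, simpleRefl_smul, map_sub, (R.coroot' j).map_smul, coroot'_smul_root,
      coroot'_smul_root, R.root_coroot'_eq_pairing, ← R.algebraMap_pairingIn ℤ, smul_eq_mul] at h1
    have h2 : (((R.pairingIn ℤ γ j - R.pairingIn ℤ γ i * R.pairingIn ℤ i j : ℤ)) : ℝ) =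
        (R.pairingIn ℤ (R.weylGroupToPerm (R.simpleRefl i * w) α) j : ℤ) := by
      rw [← h1]
      push_cast
      rfl
    exact_mod_cast h2.symm
  have hδβ' : R.pairingIn ℤ δ β = -1 := by
    rw [← R.algebraMap_pairingIn ℤ] at hδβ
    exact_mod_cast (by simpa using hδβ : ((R.pairingIn ℤ δ β : ℤ) : ℝ) = -1)
  have hN : R.normSq β = 2 * R.normSq δ := by
    have := R.pairingIn_mul_normSq β δ
    rw [hβδ', hδβ'] at this
    push_cast at this
    linarith
  have hNδ := R.normSq_pos δ
  rcases R.normSq_eq_or (i := β) (j := δ) (by linarith) α with hα | hα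
  -- For long `α` the pairing of `γ = w α` with `δ` is even. The bound on the pairing of `s_δ γ`
  -- with `β` then leaves only `0` with `δ` and `-1` with `β`. The root `s_β γ` pairs to `-2` with
  -- `δ`, which gives the gcd of `2 * c`.
  · left
    have heven : R.pairingIn ℤ γ δ = 2 * R.pairingIn ℤ δ γ := by
      have h1 := R.pairingIn_mul_normSq γ δ
      rw [hγ, normSq_perm, ← hγ, hα, hN] at h1
      have h2 : (R.pairingIn ℤ γ δ : ℝ) = 2 * R.pairingIn ℤ δ γ :=
        mul_right_cancel₀ hNδ.ne' (by linarith)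
      exact_mod_cast h2
    have h1 := abs_pairingIn_le_one_of_coord hαβ.symm (hcoord δ hαδ) hα
    rw [hpair, hδβ', abs_le] at h1
    have h2 : R.pairingIn ℤ γ δ = 0 := by omega
    have h3 : R.pairingIn ℤ γ β = -1 := by omega
    rw [h2, neg_zero, zero_mul, sub_zero] at hδ
    rw [h3, neg_neg, one_mul] at hβ
    refine ⟨hδ, hβ, ?_⟩
    have h4 := hpair β δ
    rw [h2, h3, hβδ'] at h4
    have hδα : b.coord α (R.root δ) = 0 := b.coord_root_of_ne hαδ
    have h5 := hgood (R.simpleRefl β * w) δ (fun h => by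
        rw [h, hcoord β hαβ] at hδα
        norm_num at hδα) (fun h => by
        rw [h, map_neg, hcoord β hαβ] at hδα
        norm_num at hδα) (by rw [h4]; norm_num)
    rw [h4] at h5
    simpa using h5
  -- For short `α` the bound on the pairing of `s_β γ` with `δ` leaves only `0` with `β` and `-1`
  -- with `δ`.
  · right
    have h1 := abs_pairingIn_le_one_of_coord hαδ.symm (hcoord β hαβ) hα
    rw [hpair, hβδ', abs_le] at h1
    have h2 : R.pairingIn ℤ γ β = 0 := by omega
    have h3 : R.pairingIn ℤ γ δ = -1 := by omega
    rw [h2, neg_zero, zero_mul, sub_zero] at hβ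
    rw [h3, neg_neg, one_mul] at hδ
    exact ⟨hδ, hβ⟩

end Base

end RootPairing

lemma Units.antisymmPow_ne_zero_of_gcd {B : Type*} [CommRing B] {z : Bˣ} {d e n : ℤ}
    (he : z ^ (2 * e) = 1) (hd : z.antisymmPow d ≠ 0) (hn : (Int.gcd n e : ℤ) = d) :
    z.antisymmPow n ≠ 0 := by
  rw [Ne, antisymmPow_eq_zero_iff] at hd ⊢
  exact zpow_two_mul_ne_one he hd hn.dvd

/-! ### Contradiction from the gcd condition, and the theorem -/

namespace RootPairing

variable {ι M N : Type*} [Fintype ι] [AddCommGroup M] [Module ℝ M] [AddCommGroup N] [Module ℝ N]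
  {R : RootPairing ι ℝ M N} [R.IsRootSystem] [R.IsCrystallographic] [R.IsReduced]
  [R.IsIrreducible]

lemma one_le_lengthRatio [Nonempty ι] : 1 ≤ R.lengthRatio := by
  obtain ⟨i, hi⟩ := Finite.exists_max R.normSq
  obtain ⟨j, hj⟩ := Finite.exists_min R.normSq
  have h := R.normSq_eq_lengthRatio_mul hi hj
  rw [Nat.one_le_iff_ne_zero]
  intro h0
  rw [h0, Nat.cast_zero, zero_mul] at h
  exact (R.normSq_pos i).ne' h

namespace Base

variable {b : R.Base} {μ η : R.weightLattice} {α β δ : b.support} {c d e : ℕ}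
  {A K : Type*} [CommRing A] [IsDomain A] [Field K] [CharZero K] [Algebra A K]
  {F U V X Y Z : AddMonoidAlgebra A R.weightLattice}

/-- At a primitive `2d`-th root of unity `S(dρ)` twists to zero, hence so does `S(η)`; its
coefficient `[m_α(η)]` vanishes only if `d ∣ m_α(η)`. -/
lemma dvd_of_mul_schurWeyl_eq [FaithfulSMul A K] [IsAlgClosed K] (hd : 0 < d)
    (hη : b.DominantRegular η) (h : F * R.schurWeyl A (d • b.rho) = R.schurWeyl A η) :
    (d : ℤ) ∣ R.weightCoeffHom α η := by
  have : NeZero ((2 * d : ℕ) : K) := ⟨by exact_mod_cast (by omega : 2 * d ≠ 0)⟩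
  obtain ⟨x, hx⟩ := HasEnoughRootsOfUnity.exists_primitiveRoot K (2 * d)
  have hx0 : x ≠ 0 := hx.ne_zero (by omega)
  have hz : Units.mk0 x hx0 ^ (2 * (d : ℤ)) = 1 := Units.ext (by
    have := hx.pow_eq_one
    rw [Units.val_zpow_eq_zpow_val, Units.val_mk0, Units.val_one]
    exact_mod_cast this)
  have h1 := coeff_twist_schurWeyl_singleton (A := A) b hη α α 1 (Units.mk0 x hx0)
  have h2 := twist_schurWeyl_eq_zero_of_dvd (A := A) (b := b) (e := d) (x := d • b.rho)
    (fun i hi => by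
      rw [← weightCoeffHom_apply, b.weightCoeffHom_smul_rho ⟨i, hi⟩]) α α hz
  rw [← h, map_mul, h2, mul_zero, weylSign_one, weylAct_one, Int.cast_one, one_mul] at h1
  have h3 := Units.antisymmPow_eq_zero_iff.1 h1.symm
  have h4 := congrArg Units.val h3
  rw [Units.val_zpow_eq_zpow_val, Units.val_mk0, Units.val_one, hx.zpow_eq_one_iff_dvd] at h4
  push_cast at h4
  exact (mul_dvd_mul_iff_left two_ne_zero).1 h4

/-- Invariants `F₁`, `F₂` as in `mul_antisymmPow_eq` cannot exist. -/
lemma false_of_vanishesAt_of_vanishesAt (hμ : b.DominantRegular μ)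
    (heμ : ∀ i ∈ b.support, (e : ℤ) ∣ R.weightCoeff i μ)
    (hη : η = μ + c • b.fundamentalWeight α) (hce : Int.gcd c e = d)
    (hgood : b.GcdCondition α c e d) (hβδ : R.pairing β δ = -2) (hδβ : R.pairing δ β = -1)
    {z : Kˣ} (hze : z ^ (2 * (e : ℤ)) = 1) (hzd : z.antisymmPow d ≠ 0)
    (hU : R.VanishesAt (β : ι) z U) (hV : R.VanishesAt (δ : ι) z V)
    (hinv : V ∈ R.weylInvariants A)
    (hUV : (U * X + V * Y) * R.schurWeyl A (d • b.rho) = R.schurWeyl A η) : False := by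
  obtain ⟨u, hp, hr, hu, h⟩ := exists_fibre hμ heμ hη hgood hβδ hδβ
  have key := mul_antisymmPow_eq hβδ hδβ (dominantRegular_add_smul_fundamentalWeight hμ hη)
    hU hV hinv hUV hu rfl rfl hp hr
  set p := R.weightCoeffHom δ (R.weylAct u η)
  set r := R.weightCoeffHom β (R.weylAct u η)
  rcases h with ⟨h1, h2, h3⟩ | ⟨h1, h2⟩
  -- Here `[p] = 0`, so `p [p + 2r] = 0`; but `p + 2r` is congruent to `2c` modulo `e`, which makes
  -- `[p + 2r]` nonzero.
  · rw [antisymmPow_eq_zero_of_dvd hze h1, mul_zero] at key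
    refine Units.antisymmPow_ne_zero_of_gcd hze hzd ?_
      ((mul_eq_zero.1 key).resolve_left (by exact_mod_cast hp.ne'))
    rw [Int.gcd_eq_gcd_of_dvd_sub (m := 2 * c), h3]
    rw [show p + 2 * r - 2 * c = p + 2 * (r - c) by ring]
    exact dvd_add h1 (h2.mul_left 2)
  -- Here `e ∣ r`, so `[p + 2r] = [p]`, which is nonzero because `p` is congruent to `c`. Cancelling
  -- it gives `p = p + 2r`, against `r > 0`.
  · obtain ⟨k, hk⟩ := h2
    rw [hk, ← mul_assoc, Units.antisymmPow_add_mul hze] at key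
    have h3 : z.antisymmPow p ≠ 0 :=
      Units.antisymmPow_ne_zero_of_gcd hze hzd (by rw [Int.gcd_eq_gcd_of_dvd_sub h1, hce])
    have h4 : p = p + 2 * e * k := by exact_mod_cast mul_right_cancel₀ h3 key
    rw [mul_assoc, ← hk] at h4
    omega

/-- The coprimality condition `UX + VY = C(η, d)` contradicts the factorization `UV = C(μ, d)` if
`d` is the greatest common divisor of `e` and the relevant multiples of `c`. -/
lemma false_of_gcdCondition (hG₂ : ¬ b.HasCartanMatrix CartanMatrix.G₂)
    (hd : 0 < d) (he : 0 < e) (hde : d ∣ e) (hne : e ≠ d) (hμ : b.DominantRegular μ)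
    (heμ : ∀ i ∈ b.support, (e : ℤ) ∣ R.weightCoeff i μ)
    (hη : η = μ + c • b.fundamentalWeight α) (hce : Int.gcd c e = d)
    (hgood : b.GcdCondition α c e d) [FaithfulSMul A K] [IsAlgClosed K]
    {U V : R.weylInvariants A} (hU : ¬ IsUnit U) (hV : ¬ IsUnit V)
    (hUV : (U * V : AddMonoidAlgebra A R.weightLattice) * R.schurWeyl A (d • b.rho) =
      R.schurWeyl A μ)
    (hVZ : (V : AddMonoidAlgebra A R.weightLattice) * Z * R.schurWeyl A (d • b.rho) =
      R.schurWeyl A (e • b.rho))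
    (hXY : ((U : AddMonoidAlgebra A R.weightLattice) * X + V * Y) *
      R.schurWeyl A (d • b.rho) = R.schurWeyl A η)
    (hprime : ∀ β : b.support, ∀ p : ℕ, p.Prime → (p : ℤ) ≤ 2 * R.weightCoeff β μ →
      ¬ IsUnit (p : A)) : False := by
  obtain ⟨y, y', hy, hy', hsum, hunit⟩ := exists_isLeading α hd hμ hUV
  obtain ⟨z, hze, hzd⟩ := exists_zpow_eq_one_of_dvd (K := K) hde hne he
  have hdich := fun β => vanishesAt_dichotomy (K := K) hd he hμ heμ hη hce hgood hUV hVZ hXY hy hy'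
    hsum β (hprime β) U.2 V.2
  have hzero : ∀ {x : R.weightLattice}, (∀ β : b.support, R.weightCoeffHom β x = 0) → x = 0 := by
    intro x hx
    refine Subtype.ext (b.eq_zero_of_coroot'_eq_zero fun β => ?_)
    rw [← weightCoeffHom_cast, hx, Int.cast_zero]
  let P : b.support → Prop := fun β => R.VanishesAt (β : ι) z
    (V : AddMonoidAlgebra A R.weightLattice) ∧
      ¬ R.VanishesAt (β : ι) z (U : AddMonoidAlgebra A R.weightLattice)
  let Q : b.support → Prop := fun β => R.VanishesAt (β : ι) z
    (U : AddMonoidAlgebra A R.weightLattice) ∧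
      ¬ R.VanishesAt (β : ι) z (V : AddMonoidAlgebra A R.weightLattice)
  have hPQ : ∀ β : b.support, (R.weightCoeffHom β y = 0 ∧ P β) ∨ (R.weightCoeffHom β y' = 0 ∧ Q β) := fun β =>
    (hdich β).imp (fun h => ⟨h.1, h.2 z hze hzd⟩) fun h => ⟨h.1, h.2 z hze hzd⟩
  -- If `U` vanished at all simple roots, the leading exponent of `V` would be orthogonal to all of
  -- them, so `V` would be a constant with invertible value.
  have hnotQ : ¬ ∀ β, Q β := by
    intro h
    obtain rfl := hzero fun β => ((hPQ β).resolve_left fun h' => (h β).2 h'.2.1).1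
    rw [mul_comm] at hunit
    exact hV (isUnit_of_isLeading_zero hy' hunit)
  have hnotP : ¬ ∀ β, P β := by
    intro h
    obtain rfl := hzero fun β => ((hPQ β).resolve_right fun h' => (h β).2 h'.2.1).1
    exact hU (isUnit_of_isLeading_zero hy hunit)
  -- Both kinds of simple roots occur, so connectedness of the diagram gives an edge between the two
  -- kinds.
  have hadj : ∃ β δ : b.support, P β ∧ Q δ ∧ R.pairingIn ℤ δ β ≠ 0 := by
    by_contra! hcon
    obtain ⟨β, hβ⟩ : ∃ β, P β := by
      by_contra! h
      exact hnotQ fun β => ((hPQ β).resolve_left fun h' => h β h'.2).2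
    refine hnotP fun δ => b.induction_on_cartanMatrix P hβ fun i j hi hij => ?_
    by_contra hj
    exact hij (hcon i j hi ((hPQ j).resolve_left fun h' => hj h'.2).2)
  obtain ⟨β, δ, hβ, hδ, hne0⟩ := hadj
  have hβδ : β ≠ δ := by
    rintro rfl
    exact hδ.2 hβ.1
  have hpair : ∀ {i j : b.support} {n : ℤ}, R.pairingIn ℤ i j = n → R.pairing i j = n := by
    intro i j n h
    rw [← R.algebraMap_pairingIn ℤ, h]
    rfl
  have h1 := b.pairingIn_le_zero_of_ne (i := δ) (j := β) (fun h => hβδ (Subtype.ext h.symm)) δ.2 β.2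
  have h2 := R.pairingIn_pairingIn_mem_set_of_isCrystal_of_isRed' δ β
    (fun h => hβδ (Subtype.ext (R.root.injective h.symm))) fun h => by
      have h' := congrArg (b.coord δ) h
      rw [map_neg, b.coord_root_self, b.coord_root_of_ne hβδ.symm] at h'
      norm_num at h'
  simp only [Set.mem_insert_iff, Set.mem_singleton_iff, Prod.mk.injEq] at h2
  have h3 : R.pairingIn ℤ δ β ≠ -3 := fun h => hG₂ (hasCartanMatrix_G₂ h)
  have h4 : R.pairingIn ℤ β δ ≠ -3 := fun h => hG₂ (hasCartanMatrix_G₂ h)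
  obtain ⟨h, h'⟩ | ⟨h, h'⟩ | ⟨h, h'⟩ :
      (R.pairingIn ℤ δ β = -1 ∧ R.pairingIn ℤ β δ = -1) ∨
      (R.pairingIn ℤ δ β = -2 ∧ R.pairingIn ℤ β δ = -1) ∨
      (R.pairingIn ℤ δ β = -1 ∧ R.pairingIn ℤ β δ = -2) := by
    omega
  -- Over a simple bond the two roots are conjugate, so the invariant `U` would vanish at `β` as
  -- well.
  · obtain ⟨w, hw⟩ := exists_perm_eq_of_pairing (by simpa using hpair h) (by simpa using hpair h')
    exact hβ.2 (hw ▸ hδ.1.perm U.2 w)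
  · exact false_of_vanishesAt_of_vanishesAt hμ heμ hη hce hgood (by simpa using hpair h)
      (by simpa using hpair h') hze hzd hδ.1 hβ.1 V.2 hXY
  · rw [add_comm] at hXY
    exact false_of_vanishesAt_of_vanishesAt hμ heμ hη hce hgood (by simpa using hpair h')
      (by simpa using hpair h) hze hzd hβ.1 hδ.1 U.2 hXY

end Base

end RootPairing

end

theorem proposition5 {ι M N : Type*} [Fintype ι] [AddCommGroup M] [Module ℝ M]
    [AddCommGroup N] [Module ℝ N] (R : RootPairing ι ℝ M N) [R.IsRootSystem]
    [R.IsCrystallographic] [R.IsReduced] [R.IsIrreducible] (b : R.Base)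
    (hF₄ : ¬ b.HasCartanMatrix CartanMatrix.F₄) (hG₂ : ¬ b.HasCartanMatrix CartanMatrix.G₂)
    (μ η : R.weightLattice) (hμ : b.DominantRegular μ)
    (α : b.support) (hα : ¬ R.SimplyLaced → b.IsCorner α)
    (c : ℕ) (hc : 0 < c) (hη : η = μ + c • b.fundamentalWeight α)
    (𝒪 : Type*) [CommRing 𝒪] [IsDomain 𝒪] [CharZero 𝒪]
    (h𝒪 : ∀ p : ℕ, p.Prime → (p : ℤ) ≤ 2 * R.lengthRatio * ∑ β ∈ b.support, R.weightCoeff β μ →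
      ¬ IsUnit (p : 𝒪))
    (d e : ℕ) (hde : d ∣ e) (hne : e ≠ d) (heμ : e ∣ b.weightGcd μ)
    (U V : R.weylInvariants 𝒪) (hU : ¬ IsUnit U) (hV : ¬ IsUnit V)
    (hUV : b.IsC (U * V : AddMonoidAlgebra 𝒪 R.weightLattice) μ d)
    (hVe : ∃ Z : AddMonoidAlgebra 𝒪 R.weightLattice, b.IsC ((V : AddMonoidAlgebra 𝒪 R.weightLattice) * Z) (e • b.rho) d)
    (X Y : AddMonoidAlgebra 𝒪 R.weightLattice)
    (hXY : b.IsC ((U : AddMonoidAlgebra 𝒪 R.weightLattice) * X +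
      (V : AddMonoidAlgebra 𝒪 R.weightLattice) * Y) η d) :
    (R.SimplyLaced ∨ R.IsShort α → d < Nat.gcd e c) ∧
    (¬ R.SimplyLaced ∧ R.IsLong α → d < Nat.gcd e (R.lengthRatio * c)) := by
  obtain ⟨Z, hVZ⟩ := hVe
  have : Nonempty ι := ⟨α⟩
  have heμ' : ∀ i ∈ b.support, (e : ℤ) ∣ R.weightCoeff i μ := fun i hi =>
    Int.natCast_dvd.2 (heμ.trans (Finset.gcd_dvd hi))
  have he : 0 < e := by
    rw [Nat.pos_iff_ne_zero]
    rintro rfl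
    have h := heμ' α α.2
    rw [Nat.cast_zero, zero_dvd_iff] at h
    exact (hμ α α.2).ne' h
  have hd : 0 < d := Nat.pos_of_dvd_of_pos hde he
  -- This field contains all the roots of unity needed, and integrality over `𝒪` is measured in it.
  let K := AlgebraicClosure (FractionRing 𝒪)
  have : FaithfulSMul 𝒪 K := FaithfulSMul.trans 𝒪 (FractionRing 𝒪) K
  have : CharZero K := charZero_of_injective_algebraMap (FaithfulSMul.algebraMap_injective 𝒪 K)
  have hηd := RootPairing.Base.dominantRegular_add_smul_fundamentalWeight hμ hη
  have hdc : d ∣ c := by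
    have h1 := RootPairing.Base.dvd_of_mul_schurWeyl_eq (K := K) (α := α) hd hηd hXY
    have h2 : (d : ℤ) ∣ R.weightCoeffHom α μ := (Int.natCast_dvd_natCast.2 hde).trans (heμ' α α.2)
    classical
    rw [hη, map_add, map_nsmul, b.weightCoeffHom_fundamentalWeight, if_pos rfl, dvd_add_right h2,
      nsmul_one] at h1
    exact_mod_cast h1
  have hprime : ∀ β : b.support, ∀ p : ℕ, p.Prime → (p : ℤ) ≤ 2 * R.weightCoeff β μ →
      ¬ IsUnit (p : 𝒪) := by
    intro β p hp hle
    refine h𝒪 p hp (hle.trans ?_)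
    have h1 : R.weightCoeff β μ ≤ ∑ β ∈ b.support, R.weightCoeff β μ :=
      Finset.single_le_sum (fun i hi => (hμ i hi).le) β.2
    have h2 : (1 : ℤ) ≤ R.lengthRatio := by exact_mod_cast R.one_le_lengthRatio
    have h3 := hμ β β.2
    nlinarith
  have hmain : Nat.gcd e c = d → ¬ b.GcdCondition α c e d := fun h hgood =>
    RootPairing.Base.false_of_gcdCondition (K := K) hG₂ hd he hde hne hμ heμ' hη
      (by rw [Int.gcd_natCast_natCast, Nat.gcd_comm, h]) hgood hU hV hUV hVZ hXY hprime
  constructor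
  · intro hα'
    have hshort : R.IsShort α := hα'.elim (fun h j => (h α j).le) id
    by_contra! hle
    have hgcd : Nat.gcd e c = d := hle.antisymm
      (Nat.le_of_dvd (Nat.gcd_pos_of_pos_left _ he) (Nat.dvd_gcd hde hdc))
    exact hmain hgcd (RootPairing.Base.gcdCondition_of_isShort hshort
      (by rw [Int.gcd_natCast_natCast, Nat.gcd_comm, hgcd]))
  · rintro ⟨-, hlong⟩
    by_contra! hle
    -- `gcd(e, c)` divides `gcd(e, m(Φ) c)`, so both are squeezed to `d`.
    have hgcd : Nat.gcd e c = d := ((Nat.le_of_dvd (Nat.gcd_pos_of_pos_left _ he)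
      (Nat.gcd_dvd_gcd_mul_left_right _ _ _)).trans hle).antisymm
      (Nat.le_of_dvd (Nat.gcd_pos_of_pos_left _ he) (Nat.dvd_gcd hde hdc))
    have hgcd' : Nat.gcd e (R.lengthRatio * c) = d := hle.antisymm
      (Nat.le_of_dvd (Nat.gcd_pos_of_pos_left _ he) (Nat.dvd_gcd hde (hdc.mul_left _)))
    exact hmain hgcd (RootPairing.Base.gcdCondition_of_isLong hlong
      (by rw [Int.gcd_natCast_natCast, Nat.gcd_comm, hgcd])
      (by rw [Int.gcd_natCast_natCast, Nat.gcd_comm, hgcd']))
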